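/- **Theorem.** Consider in the plane with coordinates \(x_1=\tfrac12(\xi^2-\eta^2)\), \(x_2=\xi\eta\) the Hamiltonian \[H=\tfrac12(p_1^2+p_2^2)+V,\qquad V(\xi,\eta)=\frac{W_1(\xi)+W_2(\eta)}{\xi^2+\eta^2},\] on a connected open set \(\Omega\) of the real \((\xi,\eta)\)-plane with \((0,0)\notin\Omega\), where \(W_1,W_2\) are real-valued and smooth on the projections \(I,J\) of \(\Omega\) to the \(\xi\)- and the \(\eta\)-axis. Suppose that \(H\) admits a third-order integral of motion on \(\Omega\), in one of these two senses: * (quantum) for some \(\hbar>0\), with \(p_1=-i\hbar\,\partial_{x_1}\) and \(p_2=-i\hbar\,\partial_{x_2}\), a differential operator \(X=\sum_{j+k\le 3}f_{jk}(\xi,\eta)\,p_1^jp_2^k\) with smooth complex coefficients, not all \(f_{jk}\) with \(j+k=3\) vanishing identically on \(\Omega\), satisfies \([H,X]=0\) on \(C^\infty(\Omega)\); * (classical) a function \(X=\sum_{j+k\le 3}f_{jk}(\xi,\eta)\,p_1^jp_2^k\) on the phase space over \(\Omega\) with smooth real coefficients, not all \(f_{jk}\) with \(j+k=3\) vanishing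 identically on \(\Omega\), Poisson commutes with \(H\). Or suppose only that \(V\) solves on \(\Omega\) the linear compatibility condition \[\partial_{x_2}^2\bigl(3F_1V_{x_1}+F_2V_{x_2}\bigr)-\partial_{x_1}\partial_{x_2}\bigl(2F_2V_{x_1}+2F_3V_{x_2}\bigr)+\partial_{x_1}^2\bigl(F_3V_{x_1}+3F_4V_{x_2}\bigr)=0\] for some real constants \(A_{jkl}\) \((j+k+l=3)\), not all zero, where \(F_1,\dots,F_4\) are the polynomials in \(x_1,x_2\) with \[\sum_{j+k+l=3}A_{jkl}(x_1p_2-x_2p_1)^jp_1^kp_2^l=F_1p_1^3+F_2p_1^2p_2+F_3p_1p_2^2+F_4p_2^3 .\] Then there are real constants \(c_0,\dots,c_{16},c_{-2},c_{-4},c_{-6},B_1\), complex constants \(\alpha_1,\alpha_2\), and a choice of the sign of the square root such that \[W_1(\xi)=\sum_{j=0}^{16}c_j\xi^j+\frac{c_{-2}}{\xi^2}+\frac{c_{-4}}{\xi^4}+\frac{c_{-6}}{\xi^6}+\frac{\alpha_1\,\xi\ln\bigl(\xi+\sqrt{\xi^2+B_1}\bigr)+\alpha_2\,\xi}{\sqrt{\xi^2+B_1}}\]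 for all \(\xi\in I\) with \(\xi\ne0\) and \(\xi^2+B_1\ne0\). Likewise there are real constants \(d_0,\dots,d_{16},d_{-2},d_{-4},d_{-6},B_2\), complex constants \(\beta_1,\beta_2\), and a choice of the sign of the square root such that \[W_2(\eta)=\sum_{j=0}^{16}d_j\eta^j+\frac{d_{-2}}{\eta^2}+\frac{d_{-4}}{\eta^4}+\frac{d_{-6}}{\eta^6}+\frac{\beta_1\,\eta\ln\bigl(\eta+\sqrt{\eta^2+B_2}\bigr)+\beta_2\,\eta}{\sqrt{\eta^2+B_2}}\] for all \(\eta\in J\) with \(\eta\ne0\) and \(\eta^2+B_2\ne0\). Here \(\ln\) is the principal complex logarithm, and \(\sqrt{\cdot}\) is plus or minus the principal complex square root, with one sign throughout for \(W_1\) and one for \(W_2\). -/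

import Mathlib

open Set
open scoped ContDiff

noncomputable section

namespace Parabolic

/-! The plane of parabolic coordinates `q = (ξ, η)`, with `x₁ = (ξ² - η²) / 2`, `x₂ = ξ η`. -/

/-- Partial derivative in `ξ` (real or complex valued functions). -/
def dXi {E : Type*} [NormedAddCommGroup E] [NormedSpace ℝ E] (f : ℝ × ℝ → E) : ℝ × ℝ → E :=
  fun q => fderiv ℝ f q (1, 0)

/-- Partial derivative in `η`. -/
def dEta {E : Type*} [NormedAddCommGroup E] [NormedSpace ℝ E] (f : ℝ × ℝ → E) : ℝ × ℝ → E :=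
  fun q => fderiv ℝ f q (0, 1)

/-- `∂/∂x₁ = (ξ ∂_ξ - η ∂_η) / (ξ² + η²)`. -/
def D1 {E : Type*} [NormedAddCommGroup E] [NormedSpace ℝ E] (f : ℝ × ℝ → E) : ℝ × ℝ → E :=
  fun q => (1 / (q.1 ^ 2 + q.2 ^ 2)) • (q.1 • dXi f q - q.2 • dEta f q)

/-- `∂/∂x₂ = (η ∂_ξ + ξ ∂_η) / (ξ² + η²)`. -/
def D2 {E : Type*} [NormedAddCommGroup E] [NormedSpace ℝ E] (f : ℝ × ℝ → E) : ℝ × ℝ → E :=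
  fun q => (1 / (q.1 ^ 2 + q.2 ^ 2)) • (q.2 • dXi f q + q.1 • dEta f q)

/-- The separable potential `V(ξ, η) = (W₁(ξ) + W₂(η)) / (ξ² + η²)`. -/
def potential (W₁ W₂ : ℝ → ℝ) : ℝ × ℝ → ℝ :=
  fun q => (W₁ q.1 + W₂ q.2) / (q.1 ^ 2 + q.2 ^ 2)

/-! ### Quantum mechanics -/

/-- The momentum operator `p₁ = -i ħ ∂/∂x₁`. -/
def qP1 (ħ : ℝ) (ψ : ℝ × ℝ → ℂ) : ℝ × ℝ → ℂ := fun q => -(Complex.I * (ħ : ℂ)) * D1 ψ q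

/-- The momentum operator `p₂ = -i ħ ∂/∂x₂`. -/
def qP2 (ħ : ℝ) (ψ : ℝ × ℝ → ℂ) : ℝ × ℝ → ℂ := fun q => -(Complex.I * (ħ : ℂ)) * D2 ψ q

/-- The Hamiltonian `H = (p₁² + p₂²) / 2 + V`. -/
def qH (ħ : ℝ) (V : ℝ × ℝ → ℝ) (ψ : ℝ × ℝ → ℂ) : ℝ × ℝ → ℂ :=
  fun q => (1 / 2 : ℂ) * (qP1 ħ (qP1 ħ ψ) q + qP2 ħ (qP2 ħ ψ) q) + (V q : ℂ) * ψ q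

/-- The operator `X = ∑_{j + k ≤ 3} f_{jk} p₁^j p₂^k`. -/
def qX (ħ : ℝ) (f : ℕ → ℕ → ℝ × ℝ → ℂ) (ψ : ℝ × ℝ → ℂ) : ℝ × ℝ → ℂ :=
  fun q => ∑ j ∈ Finset.range 4, ∑ k ∈ Finset.range (4 - j),
    f j k q * ((qP1 ħ)^[j] ((qP2 ħ)^[k] ψ)) q

/-- On `Ω` there is a differential operator of order exactly three, with smooth coefficients,
that commutes with `H` on smooth functions. -/
def HasQuantumIntegral (ħ : ℝ) (Ω : Set (ℝ × ℝ)) (V : ℝ × ℝ → ℝ) : Prop :=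
  ∃ f : ℕ → ℕ → ℝ × ℝ → ℂ,
    (∀ j k, j + k ≤ 3 → ContDiffOn ℝ ∞ (f j k) Ω) ∧
    (∃ j k, j + k = 3 ∧ ∃ q ∈ Ω, f j k q ≠ 0) ∧
    ∀ ψ : ℝ × ℝ → ℂ, ContDiffOn ℝ ∞ ψ Ω →
      ∀ q ∈ Ω, qH ħ V (qX ħ f ψ) q = qX ħ f (qH ħ V ψ) q

/-! ### Classical mechanics

A point of phase space is `z = ((ξ, η), (p_ξ, p_η))`. -/

/-- The canonical Poisson bracket. -/
def poisson (F G : (ℝ × ℝ) × (ℝ × ℝ) → ℝ) : (ℝ × ℝ) × (ℝ × ℝ) → ℝ := fun z =>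
  fderiv ℝ F z ((1, 0), (0, 0)) * fderiv ℝ G z ((0, 0), (1, 0))
    - fderiv ℝ F z ((0, 0), (1, 0)) * fderiv ℝ G z ((1, 0), (0, 0))
    + fderiv ℝ F z ((0, 1), (0, 0)) * fderiv ℝ G z ((0, 0), (0, 1))
    - fderiv ℝ F z ((0, 0), (0, 1)) * fderiv ℝ G z ((0, 1), (0, 0))

/-- The Cartesian momentum `p₁ = (ξ p_ξ - η p_η) / (ξ² + η²)`. -/
def cP1 (z : (ℝ × ℝ) × (ℝ × ℝ)) : ℝ :=
  (z.1.1 * z.2.1 - z.1.2 * z.2.2) / (z.1.1 ^ 2 + z.1.2 ^ 2)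

/-- The Cartesian momentum `p₂ = (η p_ξ + ξ p_η) / (ξ² + η²)`. -/
def cP2 (z : (ℝ × ℝ) × (ℝ × ℝ)) : ℝ :=
  (z.1.2 * z.2.1 + z.1.1 * z.2.2) / (z.1.1 ^ 2 + z.1.2 ^ 2)

/-- The Hamiltonian `H = (p₁² + p₂²) / 2 + V`. -/
def cH (V : ℝ × ℝ → ℝ) (z : (ℝ × ℝ) × (ℝ × ℝ)) : ℝ :=
  (1 / 2) * (cP1 z ^ 2 + cP2 z ^ 2) + V z.1

/-- The phase space function `X = ∑_{j + k ≤ 3} f_{jk} p₁^j p₂^k`. -/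
def cX (f : ℕ → ℕ → ℝ × ℝ → ℝ) (z : (ℝ × ℝ) × (ℝ × ℝ)) : ℝ :=
  ∑ j ∈ Finset.range 4, ∑ k ∈ Finset.range (4 - j), f j k z.1 * cP1 z ^ j * cP2 z ^ k

/-- Over `Ω` there is a polynomial in the momenta of degree exactly three, with smooth
coefficients, that Poisson commutes with `H`. -/
def HasClassicalIntegral (Ω : Set (ℝ × ℝ)) (V : ℝ × ℝ → ℝ) : Prop :=
  ∃ f : ℕ → ℕ → ℝ × ℝ → ℝ,
    (∀ j k, j + k ≤ 3 → ContDiffOn ℝ ∞ (f j k) Ω) ∧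
    (∃ j k, j + k = 3 ∧ ∃ q ∈ Ω, f j k q ≠ 0) ∧
    ∀ q ∈ Ω, ∀ p : ℝ × ℝ, poisson (cH V) (cX f) (q, p) = 0

/-! ### The linear compatibility condition -/

/-- The Cartesian coordinate `x₁`. -/
def x1 (q : ℝ × ℝ) : ℝ := (q.1 ^ 2 - q.2 ^ 2) / 2

/-- The Cartesian coordinate `x₂`. -/
def x2 (q : ℝ × ℝ) : ℝ := q.1 * q.2

/-! The coefficients in `∑ A_{jkl} (x₁ p₂ - x₂ p₁)^j p₁^k p₂^l =
F₁ p₁³ + F₂ p₁² p₂ + F₃ p₁ p₂² + F₄ p₂³`, the sum being over `j + k + l = 3`. -/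

/-- Coefficient of `p₁³`. -/
def F1 (A : ℕ → ℕ → ℕ → ℝ) (q : ℝ × ℝ) : ℝ :=
  -A 3 0 0 * x2 q ^ 3 + A 2 1 0 * x2 q ^ 2 - A 1 2 0 * x2 q + A 0 3 0

/-- Coefficient of `p₁² p₂`. -/
def F2 (A : ℕ → ℕ → ℕ → ℝ) (q : ℝ × ℝ) : ℝ :=
  3 * A 3 0 0 * x1 q * x2 q ^ 2 - 2 * A 2 1 0 * x1 q * x2 q + A 2 0 1 * x2 q ^ 2
    + A 1 2 0 * x1 q - A 1 1 1 * x2 q + A 0 2 1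

/-- Coefficient of `p₁ p₂²`. -/
def F3 (A : ℕ → ℕ → ℕ → ℝ) (q : ℝ × ℝ) : ℝ :=
  -3 * A 3 0 0 * x1 q ^ 2 * x2 q + A 2 1 0 * x1 q ^ 2 - 2 * A 2 0 1 * x1 q * x2 q
    + A 1 1 1 * x1 q - A 1 0 2 * x2 q + A 0 1 2

/-- Coefficient of `p₂³`. -/
def F4 (A : ℕ → ℕ → ℕ → ℝ) (q : ℝ × ℝ) : ℝ :=
  A 3 0 0 * x1 q ^ 3 + A 2 0 1 * x1 q ^ 2 + A 1 0 2 * x1 q + A 0 0 3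

/-- For some constants `A_{jkl}`, `j + k + l = 3`, not all zero, `V` satisfies on `Ω` the
compatibility condition of the determining equations
`∂₁ g₁ = 3 F₁ ∂₁V + F₂ ∂₂V`, `∂₂ g₁ + ∂₁ g₂ = 2 (F₂ ∂₁V + F₃ ∂₂V)`,
`∂₂ g₂ = F₃ ∂₁V + 3 F₄ ∂₂V` for the first order part of a third order integral. -/
def SolvesCompatibility (Ω : Set (ℝ × ℝ)) (V : ℝ × ℝ → ℝ) : Prop :=
  ∃ A : ℕ → ℕ → ℕ → ℝ, (∃ j k l, j + k + l = 3 ∧ A j k l ≠ 0) ∧ ∀ q ∈ Ω,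
    D2 (D2 (fun r => 3 * F1 A r * D1 V r + F2 A r * D2 V r)) q
      - D1 (D2 (fun r => 2 * (F2 A r * D1 V r + F3 A r * D2 V r))) q
      + D1 (D1 (fun r => F3 A r * D1 V r + 3 * F4 A r * D2 V r)) q = 0

/-! ### The family of admissible functions -/

/-- The function `(α₁ t log (t + s) + α₂ t) / s`, where `s = σ √(t² + B)`; the square root and
the logarithm are the principal complex ones. -/
def irrationalTerm (B : ℝ) (σ α₁ α₂ : ℂ) (t : ℝ) : ℂ :=
  (α₁ * t * Complex.log (t + σ * Complex.sqrt ((t ^ 2 + B : ℝ) : ℂ)) + α₂ * t) /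
    (σ * Complex.sqrt ((t ^ 2 + B : ℝ) : ℂ))

/-- On `I` the function `W` has the form
`∑_{j=0}^{16} c_j t^j + c₋₂ t⁻² + c₋₄ t⁻⁴ + c₋₆ t⁻⁶ + (α₁ t log (t + s) + α₂ t) / s`
with constant coefficients, where `s` is one of the two branches `± √(t² + B)`. The points where
the expression is undefined (`t = 0`, `t² + B = 0`) are left out. -/
def InFamily (W : ℝ → ℝ) (I : Set ℝ) : Prop :=
  ∃ (c : ℕ → ℝ) (c₂ c₄ c₆ B : ℝ) (σ α₁ α₂ : ℂ), (σ = 1 ∨ σ = -1) ∧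
    ∀ t ∈ I, t ≠ 0 → t ^ 2 + B ≠ 0 →
      (W t : ℂ) = ((∑ j ∈ Finset.range 17, c j * t ^ j
          + c₂ / t ^ 2 + c₄ / t ^ 4 + c₆ / t ^ 6 : ℝ) : ℂ) + irrationalTerm B σ α₁ α₂ t

end Parabolic

end

/-! All three hypotheses lead to the linear compatibility condition, and that condition is then read
as a polynomial identity in one coordinate.

Commuting with `H`. Classically, the bracket of `H` and `X` at a fixed position is a polynomial in
the Cartesian momenta. In the quantum case one applies both products to exponentials of linear
functions of `x₁, x₂`, which are joint eigenfunctions of the momenta, and gets a polynomial in the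
two eigenvalues. These polynomials vanish, so their coefficients do. Degree four gives the Killing
equations for the leading coefficients, whose solutions are cubic polynomials in the linear and
angular momenta; this produces the constants `A`. Degree two says that certain combinations of the
derivatives of `V` form, classically, a symmetrized gradient, and `compatOp` annihilates those. In
the quantum case a Laplacian of the second order part is added. The degree three equations express
the symmetrized gradient of that part by Laplacians of the leading coefficients; applying the
compatibility operator to the added term leaves fifth derivatives of cubic polynomials, which vanish
(`compatOp_laplace_eq_zero`). So ħ drops out. Complex leading coefficients are split into real and
imaginary parts.

Separation. For `V = (W₁ + W₂) / (ξ² + η²)` the condition, multiplied by `8 (ξ² + η²)⁷`, becomes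
`P(ξ, η) + Q(ξ, η) = 0`. Here `P` is linear in `W₁` and its first three derivatives at `ξ` and
polynomial in `η` of degree at most 13; `Q` has the same form with the coordinates exchanged. For
fixed `η`, `Q` is a polynomial in `ξ` of degree at most 13. Interpolating `P` at 14 values of `η`
shows that each coefficient of a power of `η` in `P` is locally a polynomial in `ξ` of degree at
most 13, and connectedness makes this polynomial global (`exists_coeff_compatPolynomial`). Each
power of `η` thus yields a linear third order equation for `W₁` alone with polynomial right hand
side.

Solution. Taking the highest power of `η` that is present leaves few operators: Euler operators,
`y'''`, and two operators involving `t² + B` (`inFamily_of_compatPoly`). A polynomial particular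
solution has degree at most 16. The Euler operators contribute negative powers, and the others,
after one or two integrations, reduce to `(t² + B) y'' + 3 t y' = k`. For `B ≠ 0` this gives the
square root and logarithm terms; for `B = 0` it gives a logarithm and an inverse square. Exchanging
`ξ` and `η` gives the result for `W₂`. -/

noncomputable section
namespace Parabolic
open TopologicalSpace

/-! ### The algebra of smooth functions on an open set and its Cartesian derivations. -/

variable {𝕜 : Type*} [RCLike 𝕜]

/-- The algebra of smooth functions on an open set of the plane. -/
def smoothAlg (Ω : Opens (ℝ × ℝ)) (𝕜 : Type*) [RCLike 𝕜] : Subalgebra 𝕜 (Ω → 𝕜) where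
  carrier := {f | ∃ F : ℝ × ℝ → 𝕜, ContDiffOn ℝ ∞ F Ω ∧ ∀ q : Ω, f q = F q}
  mul_mem' := by
    rintro f g ⟨F, hF, hf⟩ ⟨G, hG, hg⟩
    exact ⟨fun q => F q * G q, hF.mul hG, fun q => by simp [hf, hg]⟩
  add_mem' := by
    rintro f g ⟨F, hF, hf⟩ ⟨G, hG, hg⟩
    exact ⟨fun q => F q + G q, hF.add hG, fun q => by simp [hf, hg]⟩
  algebraMap_mem' c := ⟨fun _ => c, contDiffOn_const, fun q => rfl⟩

variable {Ω : Opens (ℝ × ℝ)}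

/-- Restriction of a function that is smooth on `Ω`. -/
def smoothMk (F : ℝ × ℝ → 𝕜) (hF : ContDiffOn ℝ ∞ F Ω) : smoothAlg Ω 𝕜 :=
  ⟨fun q => F q, F, hF, fun _ => rfl⟩

@[simp] lemma smoothMk_apply (F : ℝ × ℝ → 𝕜) (hF : ContDiffOn ℝ ∞ F Ω) (q : Ω) :
    (smoothMk F hF).1 q = F q := rfl

lemma exists_eq_smoothMk (f : smoothAlg Ω 𝕜) : ∃ F hF, f = smoothMk F hF := by
  obtain ⟨f, F, hF, h⟩ := f
  exact ⟨F, hF, Subtype.ext (funext h)⟩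

lemma smoothMk_eq_iff {F G : ℝ × ℝ → 𝕜} {hF : ContDiffOn ℝ ∞ F Ω} {hG : ContDiffOn ℝ ∞ G Ω} :
    smoothMk F hF = smoothMk G hG ↔ EqOn F G Ω := by
  constructor
  · intro h q hq
    exact congrFun (congrArg Subtype.val h) ⟨q, hq⟩
  · intro h
    exact Subtype.ext (funext fun q => h q.2)

lemma smoothAlg_ext {f g : smoothAlg Ω 𝕜} (h : ∀ q, f.1 q = g.1 q) : f = g :=
  Subtype.ext (funext h)

lemma smoothMk_mul {F G : ℝ × ℝ → 𝕜} (hF : ContDiffOn ℝ ∞ F Ω) (hG : ContDiffOn ℝ ∞ G Ω) :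
    smoothMk F hF * smoothMk G hG = smoothMk (fun q => F q * G q) (hF.mul hG) := rfl

lemma smoothMk_add {F G : ℝ × ℝ → 𝕜} (hF : ContDiffOn ℝ ∞ F Ω) (hG : ContDiffOn ℝ ∞ G Ω) :
    smoothMk F hF + smoothMk G hG = smoothMk (fun q => F q + G q) (hF.add hG) := rfl

lemma smoothMk_smul {F : ℝ × ℝ → 𝕜} (c : 𝕜) (hF : ContDiffOn ℝ ∞ F Ω) :
    c • smoothMk F hF = smoothMk (fun q => c * F q) (contDiffOn_const.mul hF) := rfl

lemma contDiffOn_fderiv_apply {F : ℝ × ℝ → 𝕜} (hF : ContDiffOn ℝ ∞ F Ω) (v : ℝ × ℝ) :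
    ContDiffOn ℝ ∞ (fun q => fderiv ℝ F q v) Ω :=
  (hF.fderiv_of_isOpen Ω.2 (by norm_num)).clm_apply contDiffOn_const

lemma differentiableAt_of_contDiffOn {F : ℝ × ℝ → 𝕜} (hF : ContDiffOn ℝ ∞ F Ω) {q : ℝ × ℝ}
    (hq : q ∈ Ω) : DifferentiableAt ℝ F q :=
  (hF.contDiffAt (Ω.2.mem_nhds hq)).differentiableAt (by norm_num)

/-- The underlying function of the directional derivative. -/
def dirFun (v : ℝ × ℝ) (f : smoothAlg Ω 𝕜) : smoothAlg Ω 𝕜 :=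
  smoothMk (fun q => fderiv ℝ (exists_eq_smoothMk f).choose q v)
    (contDiffOn_fderiv_apply (exists_eq_smoothMk f).choose_spec.choose v)

/-- Two extensions of the same function on `Ω` agree near every point of the open set, so the
derivative does not depend on the extension chosen in `dirFun`. -/
lemma dirFun_mk (v : ℝ × ℝ) {F : ℝ × ℝ → 𝕜} (hF : ContDiffOn ℝ ∞ F Ω) :
    dirFun v (smoothMk F hF) = smoothMk (fun q => fderiv ℝ F q v) (contDiffOn_fderiv_apply hF v) := by
  rw [dirFun, smoothMk_eq_iff]
  intro q hq
  have h := smoothMk_eq_iff.1 (exists_eq_smoothMk (smoothMk F hF)).choose_spec.choose_spec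
  have : F =ᶠ[nhds q] (exists_eq_smoothMk (smoothMk F hF)).choose :=
    Filter.eventuallyEq_of_mem (Ω.2.mem_nhds hq) h
  simp only
  rw [this.fderiv_eq]

/-- The directional derivative as a derivation of the algebra of smooth functions. -/
def dirDeriv (Ω : Opens (ℝ × ℝ)) (𝕜 : Type*) [RCLike 𝕜] (v : ℝ × ℝ) : Derivation 𝕜 (smoothAlg Ω 𝕜) (smoothAlg Ω 𝕜) :=
  Derivation.mk'
    { toFun := dirFun v
      map_add' := by
        intro f g
        obtain ⟨F, hF, rfl⟩ := exists_eq_smoothMk f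
        obtain ⟨G, hG, rfl⟩ := exists_eq_smoothMk g
        rw [smoothMk_add, dirFun_mk, dirFun_mk, dirFun_mk, smoothMk_add, smoothMk_eq_iff]
        intro q hq
        simp only
        rw [fderiv_fun_add (differentiableAt_of_contDiffOn hF hq)
          (differentiableAt_of_contDiffOn hG hq)]
        rfl
      map_smul' := by
        intro c f
        obtain ⟨F, hF, rfl⟩ := exists_eq_smoothMk f
        rw [smoothMk_smul, dirFun_mk, dirFun_mk, RingHom.id_apply, smoothMk_smul, smoothMk_eq_iff]
        intro q hq
        simp only
        rw [fderiv_const_mul (differentiableAt_of_contDiffOn hF hq)]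
        rfl }
    (by
      intro f g
      obtain ⟨F, hF, rfl⟩ := exists_eq_smoothMk f
      obtain ⟨G, hG, rfl⟩ := exists_eq_smoothMk g
      simp only [LinearMap.coe_mk, AddHom.coe_mk, smul_eq_mul]
      rw [smoothMk_mul, dirFun_mk, dirFun_mk, dirFun_mk, smoothMk_mul, smoothMk_mul, smoothMk_add,
        smoothMk_eq_iff]
      intro q hq
      simp only
      rw [fderiv_fun_mul (differentiableAt_of_contDiffOn hF hq)
          (differentiableAt_of_contDiffOn hG hq)]
      rfl)

lemma dirDeriv_mk (v : ℝ × ℝ) {F : ℝ × ℝ → 𝕜} (hF : ContDiffOn ℝ ∞ F Ω) :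
    dirDeriv Ω 𝕜 v (smoothMk F hF) =
      smoothMk (fun q => fderiv ℝ F q v) (contDiffOn_fderiv_apply hF v) :=
  dirFun_mk v hF

lemma dirDeriv_comm (v w : ℝ × ℝ) (f : smoothAlg Ω 𝕜) :
    dirDeriv Ω 𝕜 v (dirDeriv Ω 𝕜 w f) = dirDeriv Ω 𝕜 w (dirDeriv Ω 𝕜 v f) := by
  obtain ⟨F, hF, rfl⟩ := exists_eq_smoothMk f
  simp only [dirDeriv_mk]
  rw [smoothMk_eq_iff]
  intro q hq
  have hd : DifferentiableAt ℝ (fderiv ℝ F) q :=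
    ((hF.fderiv_of_isOpen (m := ∞) Ω.2 (by norm_num)).contDiffAt
      (Ω.2.mem_nhds hq)).differentiableAt (by norm_num)
  have hs : IsSymmSndFDerivAt ℝ F q :=
    (hF.contDiffAt (Ω.2.mem_nhds hq)).isSymmSndFDerivAt
      (by rw [minSmoothness_of_isRCLikeNormedField]; exact WithTop.coe_le_coe.2 le_top)
  simp only
  rw [fderiv_clm_apply hd (by fun_prop), fderiv_clm_apply hd (by fun_prop)]
  simpa using hs v w

lemma contDiffOn_ofReal {g : ℝ × ℝ → ℝ} (hg : ContDiffOn ℝ ∞ g Ω) :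
    ContDiffOn ℝ ∞ (fun q => (g q : 𝕜)) Ω :=
  (RCLike.ofRealCLM (K := 𝕜)).contDiff.comp_contDiffOn hg

/-- The coordinate `ξ`. -/
def xiFn (Ω : Opens (ℝ × ℝ)) (𝕜 : Type*) [RCLike 𝕜] : smoothAlg Ω 𝕜 :=
  smoothMk (fun q => (q.1 : 𝕜)) (contDiffOn_ofReal contDiffOn_fst)

/-- The coordinate `η`. -/
def etaFn (Ω : Opens (ℝ × ℝ)) (𝕜 : Type*) [RCLike 𝕜] : smoothAlg Ω 𝕜 :=
  smoothMk (fun q => (q.2 : 𝕜)) (contDiffOn_ofReal contDiffOn_snd)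

lemma sq_add_sq_ne {q : ℝ × ℝ} (h : q ≠ (0, 0)) : q.1 ^ 2 + q.2 ^ 2 ≠ 0 := by
  intro h'
  apply h
  have h1 : q.1 = 0 := by nlinarith [sq_nonneg q.1, sq_nonneg q.2]
  have h2 : q.2 = 0 := by nlinarith [sq_nonneg q.1, sq_nonneg q.2]
  exact Prod.ext h1 h2

lemma sq_add_sq_ne_of_mem (h0 : (0, 0) ∉ Ω) {q : ℝ × ℝ} (hq : q ∈ Ω) : q.1 ^ 2 + q.2 ^ 2 ≠ 0 :=
  sq_add_sq_ne fun h => h0 (h ▸ hq)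

lemma contDiffOn_inv_rho (h0 : (0, 0) ∉ Ω) :
    ContDiffOn ℝ ∞ (fun q : ℝ × ℝ => 1 / (q.1 ^ 2 + q.2 ^ 2)) Ω :=
  ContDiffOn.div (by fun_prop) (by fun_prop) fun _ hq => sq_add_sq_ne_of_mem h0 hq

/-- The function `1 / (ξ² + η²)`. -/
def invRho (𝕜 : Type*) [RCLike 𝕜] (h0 : (0, 0) ∉ Ω) : smoothAlg Ω 𝕜 :=
  smoothMk (fun q => ((1 / (q.1 ^ 2 + q.2 ^ 2) : ℝ) : 𝕜))
  (contDiffOn_ofReal (contDiffOn_inv_rho h0))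

lemma invRho_mul (𝕜 : Type*) [RCLike 𝕜] (h0 : (0, 0) ∉ Ω) :
    invRho 𝕜 h0 * (xiFn Ω 𝕜 ^ 2 + etaFn Ω 𝕜 ^ 2) = 1 := by
  apply smoothAlg_ext
  intro q
  have h := sq_add_sq_ne_of_mem h0 q.2
  have h' : ((q.1.1 : 𝕜) ^ 2 + (q.1.2 : 𝕜) ^ 2) ≠ 0 := by exact_mod_cast h
  change ((1 / (q.1.1 ^ 2 + q.1.2 ^ 2) : ℝ) : 𝕜) * ((q.1.1 : 𝕜) ^ 2 + (q.1.2 : 𝕜) ^ 2) = 1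
  push_cast
  field_simp

lemma fderiv_ofReal_comp {g : ℝ × ℝ → ℝ} {q : ℝ × ℝ} (hg : DifferentiableAt ℝ g q) (v : ℝ × ℝ) :
    fderiv ℝ (fun q => (g q : 𝕜)) q v = ((fderiv ℝ g q v : ℝ) : 𝕜) := by
  have := ((RCLike.ofRealCLM (K := 𝕜)).hasFDerivAt.comp q hg.hasFDerivAt).fderiv
  have h2 : (⇑(RCLike.ofRealCLM (K := 𝕜)) ∘ g) = fun q => (g q : 𝕜) := rfl
  rw [h2] at this
  rw [this]; simp

@[simp] lemma dirDeriv_xiFn (v : ℝ × ℝ) :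
    dirDeriv Ω 𝕜 v (xiFn Ω 𝕜) = algebraMap 𝕜 _ (v.1 : 𝕜) := by
  rw [xiFn, dirDeriv_mk]
  apply smoothAlg_ext
  intro q
  simp only [smoothMk_apply]
  rw [fderiv_ofReal_comp (by fun_prop), fderiv_fst]
  rfl

@[simp] lemma dirDeriv_etaFn (v : ℝ × ℝ) :
    dirDeriv Ω 𝕜 v (etaFn Ω 𝕜) = algebraMap 𝕜 _ (v.2 : 𝕜) := by
  rw [etaFn, dirDeriv_mk]
  apply smoothAlg_ext
  intro q
  simp only [smoothMk_apply]
  rw [fderiv_ofReal_comp (by fun_prop), fderiv_snd]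
  rfl

@[simp] lemma dirDeriv_invRho (h0 : (0, 0) ∉ Ω) (v : ℝ × ℝ) :
    dirDeriv Ω 𝕜 v (invRho 𝕜 h0) =
      -2 * invRho 𝕜 h0 ^ 2 * (xiFn Ω 𝕜 * algebraMap 𝕜 _ (v.1 : 𝕜) + etaFn Ω 𝕜 * algebraMap 𝕜 _ (v.2 : 𝕜)) := by
  -- Differentiate `r (ξ² + η²) = 1` and solve for the derivative of `r`.
  have h := congrArg (dirDeriv Ω 𝕜 v) (invRho_mul 𝕜 h0)
  simp only [Derivation.leibniz, Derivation.leibniz_pow, map_add, Derivation.map_one_eq_zero, smul_eq_mul,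
    dirDeriv_xiFn, dirDeriv_etaFn, nsmul_eq_mul] at h
  have h1 := invRho_mul 𝕜 h0
  push_cast at h
  linear_combination invRho 𝕜 h0 * h - (dirDeriv Ω 𝕜 v (invRho 𝕜 h0)) * h1

/-- `∂/∂x₁` as a derivation. -/
def d1 (𝕜 : Type*) [RCLike 𝕜] (h0 : (0, 0) ∉ Ω) :
    Derivation 𝕜 (smoothAlg Ω 𝕜) (smoothAlg Ω 𝕜) :=
  (invRho 𝕜 h0 * xiFn Ω 𝕜) • dirDeriv Ω 𝕜 (1, 0) - (invRho 𝕜 h0 * etaFn Ω 𝕜) • dirDeriv Ω 𝕜 (0, 1)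

/-- `∂/∂x₂` as a derivation. -/
def d2 (𝕜 : Type*) [RCLike 𝕜] (h0 : (0, 0) ∉ Ω) :
    Derivation 𝕜 (smoothAlg Ω 𝕜) (smoothAlg Ω 𝕜) :=
  (invRho 𝕜 h0 * etaFn Ω 𝕜) • dirDeriv Ω 𝕜 (1, 0) + (invRho 𝕜 h0 * xiFn Ω 𝕜) • dirDeriv Ω 𝕜 (0, 1)

lemma d1_apply (h0 : (0, 0) ∉ Ω) (f : smoothAlg Ω 𝕜) :
    d1 𝕜 h0 f = invRho 𝕜 h0 * xiFn Ω 𝕜 * dirDeriv Ω 𝕜 (1, 0) f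
      - invRho 𝕜 h0 * etaFn Ω 𝕜 * dirDeriv Ω 𝕜 (0, 1) f := rfl

lemma d2_apply (h0 : (0, 0) ∉ Ω) (f : smoothAlg Ω 𝕜) :
    d2 𝕜 h0 f = invRho 𝕜 h0 * etaFn Ω 𝕜 * dirDeriv Ω 𝕜 (1, 0) f
      + invRho 𝕜 h0 * xiFn Ω 𝕜 * dirDeriv Ω 𝕜 (0, 1) f := rfl

lemma d1_d2_comm (h0 : (0, 0) ∉ Ω) (f : smoothAlg Ω 𝕜) :
    d1 𝕜 h0 (d2 𝕜 h0 f) = d2 𝕜 h0 (d1 𝕜 h0 f) := by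
  simp only [d1_apply, d2_apply, map_add, map_sub, Derivation.leibniz, smul_eq_mul,
    dirDeriv_xiFn, dirDeriv_etaFn, dirDeriv_invRho, dirDeriv_comm (0, 1) (1, 0) f,
    RCLike.ofReal_one, RCLike.ofReal_zero, map_one, map_zero]
  have h := invRho_mul 𝕜 h0
  linear_combination (invRho 𝕜 h0 ^ 2 * (2 * etaFn Ω 𝕜 * dirDeriv Ω 𝕜 (1, 0) f
    - 2 * xiFn Ω 𝕜 * dirDeriv Ω 𝕜 (0, 1) f)) * h

lemma contDiffOn_D1 (h0 : (0, 0) ∉ Ω) {F : ℝ × ℝ → 𝕜} (hF : ContDiffOn ℝ ∞ F Ω) :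
    ContDiffOn ℝ ∞ (D1 F) Ω := by
  exact (contDiffOn_inv_rho h0).smul ((contDiffOn_fst.smul (contDiffOn_fderiv_apply hF _)).sub
    (contDiffOn_snd.smul (contDiffOn_fderiv_apply hF _)))

lemma contDiffOn_D2 (h0 : (0, 0) ∉ Ω) {F : ℝ × ℝ → 𝕜} (hF : ContDiffOn ℝ ∞ F Ω) :
    ContDiffOn ℝ ∞ (D2 F) Ω := by
  exact (contDiffOn_inv_rho h0).smul ((contDiffOn_snd.smul (contDiffOn_fderiv_apply hF _)).add
    (contDiffOn_fst.smul (contDiffOn_fderiv_apply hF _)))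

lemma d1_mk (h0 : (0, 0) ∉ Ω) {F : ℝ × ℝ → 𝕜} (hF : ContDiffOn ℝ ∞ F Ω) :
    d1 𝕜 h0 (smoothMk F hF) = smoothMk (D1 F) (contDiffOn_D1 h0 hF) := by
  rw [d1_apply, dirDeriv_mk, dirDeriv_mk]
  apply smoothAlg_ext
  intro q
  change ((1 / (q.1.1 ^ 2 + q.1.2 ^ 2) : ℝ) : 𝕜) * (q.1.1 : 𝕜) * fderiv ℝ F q (1, 0)
    - ((1 / (q.1.1 ^ 2 + q.1.2 ^ 2) : ℝ) : 𝕜) * (q.1.2 : 𝕜) * fderiv ℝ F q (0, 1) = D1 F q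
  simp only [D1, dXi, dEta, RCLike.real_smul_eq_coe_mul]
  ring

lemma d2_mk (h0 : (0, 0) ∉ Ω) {F : ℝ × ℝ → 𝕜} (hF : ContDiffOn ℝ ∞ F Ω) :
    d2 𝕜 h0 (smoothMk F hF) = smoothMk (D2 F) (contDiffOn_D2 h0 hF) := by
  rw [d2_apply, dirDeriv_mk, dirDeriv_mk]
  apply smoothAlg_ext
  intro q
  change ((1 / (q.1.1 ^ 2 + q.1.2 ^ 2) : ℝ) : 𝕜) * (q.1.2 : 𝕜) * fderiv ℝ F q (1, 0)
    + ((1 / (q.1.1 ^ 2 + q.1.2 ^ 2) : ℝ) : 𝕜) * (q.1.1 : 𝕜) * fderiv ℝ F q (0, 1) = D2 F q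
  simp only [D2, dXi, dEta, RCLike.real_smul_eq_coe_mul]
  ring

/-- `x₁` as an element of the algebra of smooth functions. -/
def x1Fn (Ω : Opens (ℝ × ℝ)) (𝕜 : Type*) [RCLike 𝕜] : smoothAlg Ω 𝕜 :=
  algebraMap 𝕜 _ (1 / 2) * (xiFn Ω 𝕜 ^ 2 - etaFn Ω 𝕜 ^ 2)

/-- `x₂` as an element of the algebra of smooth functions. -/
def x2Fn (Ω : Opens (ℝ × ℝ)) (𝕜 : Type*) [RCLike 𝕜] : smoothAlg Ω 𝕜 := xiFn Ω 𝕜 * etaFn Ω 𝕜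

lemma two_mul_half : (2 : smoothAlg Ω 𝕜) * algebraMap 𝕜 _ (1 / 2) = 1 := by
  rw [← map_ofNat (algebraMap 𝕜 (smoothAlg Ω 𝕜)) 2, ← map_mul]
  simp

@[simp] lemma d1_x1Fn (h0 : (0, 0) ∉ Ω) : d1 𝕜 h0 (x1Fn Ω 𝕜) = 1 := by
  simp only [x1Fn, d1_apply, map_sub, Derivation.leibniz, Derivation.leibniz_pow, smul_eq_mul,
    dirDeriv_xiFn, dirDeriv_etaFn, RCLike.ofReal_one, RCLike.ofReal_zero, map_one, map_zero,
    Derivation.map_algebraMap, nsmul_eq_mul]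
  push_cast
  linear_combination (invRho 𝕜 h0 * (xiFn Ω 𝕜 ^ 2 + etaFn Ω 𝕜 ^ 2)) * two_mul_half (Ω := Ω) (𝕜 := 𝕜)
    + invRho_mul 𝕜 h0

@[simp] lemma d2_x1Fn (h0 : (0, 0) ∉ Ω) : d2 𝕜 h0 (x1Fn Ω 𝕜) = 0 := by
  simp only [x1Fn, d2_apply, map_sub, Derivation.leibniz, Derivation.leibniz_pow, smul_eq_mul,
    dirDeriv_xiFn, dirDeriv_etaFn, RCLike.ofReal_one, RCLike.ofReal_zero, map_one, map_zero,
    Derivation.map_algebraMap, nsmul_eq_mul]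
  push_cast
  ring

@[simp] lemma d1_x2Fn (h0 : (0, 0) ∉ Ω) : d1 𝕜 h0 (x2Fn Ω 𝕜) = 0 := by
  simp only [x2Fn, d1_apply, Derivation.leibniz, smul_eq_mul,
    dirDeriv_xiFn, dirDeriv_etaFn, RCLike.ofReal_one, RCLike.ofReal_zero, map_one, map_zero]
  ring

@[simp] lemma d2_x2Fn (h0 : (0, 0) ∉ Ω) : d2 𝕜 h0 (x2Fn Ω 𝕜) = 1 := by
  simp only [x2Fn, d2_apply, Derivation.leibniz, smul_eq_mul,
    dirDeriv_xiFn, dirDeriv_etaFn, RCLike.ofReal_one, RCLike.ofReal_zero, map_one, map_zero]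
  linear_combination invRho_mul 𝕜 h0

/-- A smooth function on a connected open set with vanishing gradient is constant. -/
lemma exists_eq_algebraMap (h0 : (0, 0) ∉ Ω) (hc : IsPreconnected (Ω : Set (ℝ × ℝ)))
    {f : smoothAlg Ω 𝕜} (hf1 : d1 𝕜 h0 f = 0) (hf2 : d2 𝕜 h0 f = 0) :
    ∃ c : 𝕜, f = algebraMap 𝕜 _ c := by
  have hr := invRho_mul 𝕜 h0
  -- Inverting the Cartesian derivatives: `∂_ξ = ξ ∂₁ + η ∂₂` and `∂_η = -η ∂₁ + ξ ∂₂`.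
  have e1 : dirDeriv Ω 𝕜 (1, 0) f = 0 := by
    rw [d1_apply] at hf1; rw [d2_apply] at hf2
    linear_combination (xiFn Ω 𝕜) * hf1 + (etaFn Ω 𝕜) * hf2 - dirDeriv Ω 𝕜 (1, 0) f * hr
  have e2 : dirDeriv Ω 𝕜 (0, 1) f = 0 := by
    rw [d1_apply] at hf1; rw [d2_apply] at hf2
    linear_combination -(etaFn Ω 𝕜) * hf1 + (xiFn Ω 𝕜) * hf2 - dirDeriv Ω 𝕜 (0, 1) f * hr
  obtain ⟨F, hF, rfl⟩ := exists_eq_smoothMk f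
  rw [dirDeriv_mk] at e1 e2
  have h : EqOn (fderiv ℝ F) 0 Ω := by
    intro q hq
    have a1 : fderiv ℝ F q (1, 0) = 0 := congrFun (congrArg Subtype.val e1) ⟨q, hq⟩
    have a2 : fderiv ℝ F q (0, 1) = 0 := congrFun (congrArg Subtype.val e2) ⟨q, hq⟩
    ext
    · simpa using a1
    · simpa using a2
  obtain ⟨c, hcF⟩ := Ω.2.exists_is_const_of_fderiv_eq_zero hc
    (hF.differentiableOn (by norm_num)) h
  refine ⟨c, smoothAlg_ext fun q => hcF q.1 q.2⟩

end Parabolic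
end

/-! ### Vanishing of polynomials at integers, Killing equations and the compatibility operator. -/

noncomputable section
namespace Parabolic
open TopologicalSpace

/-- A quartic is determined by its values at `0, ±1, ±2`. The weights below invert this Vandermonde
system, and the factor 24 clears the denominators. -/
lemma coeff_eq_zero_of_forall_int {K : Type*} [Field K] [CharZero K] (c : ℕ → K)
    (h : ∀ m : ℤ, ∑ i ∈ Finset.range 5, c i * (m : K) ^ i = 0) : ∀ i < 5, c i = 0 := by
  have h0 := h 0
  have h1 := h 1
  have h2 := h (-1)
  have h3 := h 2
  have h4 := h (-2)
  simp only [Finset.sum_range_succ, Finset.sum_range_zero] at h0 h1 h2 h3 h4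
  push_cast at h0 h1 h2 h3 h4
  intro i hi
  have e : (24 : K) * c i = 0 := by
    interval_cases i
    · linear_combination 24 * h0
    · linear_combination 16 * h1 - 16 * h2 - 2 * h3 + 2 * h4
    · linear_combination 16 * h1 + 16 * h2 - h3 - h4 - 30 * h0
    · linear_combination -4 * h1 + 4 * h2 + 2 * h3 - 2 * h4
    · linear_combination -4 * h1 - 4 * h2 + h3 + h4 + 6 * h0
  simpa using e

/-- A polynomial of degree at most four in each of two variables that vanishes at all integer
points is zero. -/
lemma coeff_eq_zero_of_forall_int_int {K : Type*} [Field K] [CharZero K] (c : ℕ → ℕ → K)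
    (h : ∀ m n : ℤ, ∑ i ∈ Finset.range 5, ∑ j ∈ Finset.range 5, c i j * (m : K) ^ i * (n : K) ^ j = 0) :
    ∀ i < 5, ∀ j < 5, c i j = 0 := by
  intro i hi
  apply coeff_eq_zero_of_forall_int
  intro n
  refine coeff_eq_zero_of_forall_int (fun i => ∑ j ∈ Finset.range 5, c i j * (n : K) ^ j) ?_ i hi
  intro m
  rw [← h m n]
  refine Finset.sum_congr rfl fun i _ => ?_
  rw [Finset.sum_mul]
  exact Finset.sum_congr rfl fun j _ => by ring

section Commuting

variable {M : Type*} [AddCommGroup M]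

/-- The Killing equations for the leading coefficients of a cubic integral. -/
structure IsKilling (a b : M → M) (g₁ g₂ g₃ g₄ : M) : Prop where
  eq₁ : a g₁ = 0
  eq₂ : b g₁ + a g₂ = 0
  eq₃ : b g₂ + a g₃ = 0
  eq₄ : b g₃ + a g₄ = 0
  eq₅ : b g₄ = 0

/-- The compatibility operator of the equations `a u = s₁`, `b u + a v = s₂`, `b v = s₃`. -/
def compatOp (a b : M → M) (s₁ s₂ s₃ : M) : M := b (b s₁) - a (b s₂) + a (a s₃)

variable {a b : M →+ M}

/-- Every third derivative of `u` and of `v` occurs twice with opposite signs once `a` and `b`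
commute. -/
lemma compatOp_eq_zero (hab : ∀ f, a (b f) = b (a f)) (u v : M) :
    compatOp a b (a u) (b u + a v) (b v) = 0 := by
  simp only [compatOp, map_add, hab]
  abel

/-- The Laplacian of the compatibility operator vanishes on the second order part of a quantum
integral. -/
lemma compatOp_laplace_eq_zero (hab : ∀ f, a (b f) = b (a f)) (T : M →+ M)
    (hTa : ∀ f, T (a f) = a (T f)) (hTb : ∀ f, T (b f) = b (T f))
    {g₁ g₂ g₃ g₄ : M} (hg : IsKilling a b g₁ g₂ g₃ g₄) {s₁ s₂ s₃ : M}
    (h₁ : a s₁ = T (a (a g₁) + b (b g₁)))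
    (h₂ : b s₁ + a s₂ = T (a (a g₂) + b (b g₂)))
    (h₃ : b s₂ + a s₃ = T (a (a g₃) + b (b g₃)))
    (h₄ : b s₃ = T (a (a g₄) + b (b g₄))) :
    compatOp a b (a (a s₁) + b (b s₁)) (a (a s₂) + b (b s₂)) (a (a s₃) + b (b s₃)) = 0 := by
  -- Differentiated Killing equations; together they make the fifth derivatives of the `gᵢ` that
  -- occur below vanish.
  have k₁ : a (a g₂) = 0 := by
    have := congrArg a hg.eq₂
    simpa [hab, hg.eq₁] using this
  have k₂ : b (b g₃) = 0 := by
    have := congrArg b hg.eq₄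
    simpa [hab, ← hab, hg.eq₅] using this
  have k₃ : b (b (b g₂)) = 0 := by
    have := congrArg (fun x => b (b x)) hg.eq₃
    simpa [← hab, k₂] using this
  have k₄ : a (a (a g₃)) = 0 := by
    have := congrArg (fun x => a (a x)) hg.eq₃
    simpa [hab, k₁] using this
  have e₁ := congrArg (fun x => a (b (b x))) h₁
  have e₂ := congrArg (fun x => b (b (b x))) h₂
  have e₃ := congrArg (fun x => a (a (b x))) h₂
  have e₄ := congrArg (fun x => a (b (b x))) h₃
  have e₅ := congrArg (fun x => a (a (a x))) h₃
  have e₆ := congrArg (fun x => a (a (b x))) h₄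
  have z₁ : a g₁ = 0 := hg.eq₁
  have z₂ : b g₄ = 0 := hg.eq₅
  have z₃ : b (b (a g₃)) = 0 := by rw [← hab, ← hab, k₂, map_zero]
  have z₄ : b (a (a (a (a g₄)))) = 0 := by simp [← hab, z₂]
  have z₅ : b (b (b (a (a g₄)))) = 0 := by simp [← hab, z₂]
  simp only [← hTa, ← hTb, map_add, hab, z₄, z₅, z₁, z₂, k₁, k₂, k₃, k₄, z₃, map_zero, add_zero, zero_add,
    compatOp] at e₁ e₂ e₃ e₄ e₅ e₆ ⊢
  -- With the weights 3, 1, -2, -2, 1, 3 the left hand sides add up to the compatibility operator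
  -- applied to the Laplacians of the `sᵢ`; the right hand sides have already been reduced to zero.
  linear_combination (norm := skip) (3 : ℤ) • e₁ + e₂ - (2 : ℤ) • e₃ - (2 : ℤ) • e₄ + e₅ + (3 : ℤ) • e₆
  module

end Commuting

end Parabolic
end

/-! ### Solving the Killing equations, and the resulting constants. -/

noncomputable section
namespace Parabolic
open TopologicalSpace

section KillingTensors

variable {K R : Type*} [Field K] [CharZero K] [CommRing R] [Algebra K R] {a b : Derivation K R R} {x y : R}

omit [CharZero K] in
lemma derivation_two_three (D : Derivation K R R) : D 2 = 0 ∧ D 3 = 0 :=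
  ⟨by simpa using D.map_natCast 2, by simpa using D.map_natCast 3⟩

lemma algebraMap_eq_natCast_mul (c : K) (n : ℕ) [n.AtLeastTwo] :
    algebraMap K R c = (OfNat.ofNat n) * algebraMap K R (c / (OfNat.ofNat n)) := by
  rw [← map_ofNat (algebraMap K R) n, ← map_mul, mul_div_cancel₀]
  exact OfNat.ofNat_ne_zero n

/-- Derivations `a = ∂/∂x` and `b = ∂/∂y` whose common kernel consists of the constants. -/
structure IsCoordinatePair (a b : Derivation K R R) (x y : R) : Prop where
  comm : ∀ f, a (b f) = b (a f)
  ax : a x = 1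
  ay : a y = 0
  bx : b x = 0
  by_ : b y = 1
  const : ∀ f, a f = 0 → b f = 0 → ∃ c : K, f = algebraMap K R c

variable (h : IsCoordinatePair a b x y)
include h

-- Integration in `y`: a primitive of `b f` is subtracted from `f`, and the difference lies in the
-- common kernel of `a` and `b`, that is, among the constants. The quadratic and cubic versions
-- iterate this.
omit [CharZero K] in
lemma exists_eq_linear {f : R} (hf1 : a f = 0) (hf2 : b (b f) = 0) :
    ∃ c₀ c₁ : K, f = algebraMap K R c₀ + algebraMap K R c₁ * y := by
  obtain ⟨c₁, h₁⟩ := h.const (b f) (by rw [h.comm, hf1, map_zero]) hf2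
  obtain ⟨c₀, h₀⟩ := h.const (f - algebraMap K R c₁ * y) (by simp [hf1, h.ay]) (by simp [h₁, h.by_])
  exact ⟨c₀, c₁, by linear_combination h₀⟩

lemma exists_eq_quadratic {f : R} (hf1 : a f = 0) (hf2 : b (b (b f)) = 0) :
    ∃ c₀ c₁ c₂ : K, f = algebraMap K R c₀ + algebraMap K R c₁ * y + algebraMap K R c₂ * y ^ 2 := by
  obtain ⟨c₁, c₂, h₁⟩ := exists_eq_linear h (f := b f) (by rw [h.comm, hf1, map_zero]) hf2
  have e := algebraMap_eq_natCast_mul (R := R) c₂ 2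
  obtain ⟨c₀, h₀⟩ := h.const (f - algebraMap K R c₁ * y - algebraMap K R (c₂ / 2) * y ^ 2)
    (by simp [hf1, h.ay]) (by simp [h₁, e, h.by_]; ring)
  exact ⟨c₀, c₁, c₂ / 2, by linear_combination h₀⟩

lemma exists_eq_cubic {f : R} (hf1 : a f = 0) (hf2 : b (b (b (b f))) = 0) :
    ∃ c₀ c₁ c₂ c₃ : K, f = algebraMap K R c₀ + algebraMap K R c₁ * y
      + algebraMap K R c₂ * y ^ 2 + algebraMap K R c₃ * y ^ 3 := by
  obtain ⟨c₁, c₂, c₃, h₁⟩ := exists_eq_quadratic h (f := b f) (by rw [h.comm, hf1, map_zero]) hf2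
  have e := algebraMap_eq_natCast_mul (R := R) c₂ 2
  have e' := algebraMap_eq_natCast_mul (R := R) c₃ 3
  obtain ⟨c₀, h₀⟩ := h.const (f - algebraMap K R c₁ * y - algebraMap K R (c₂ / 2) * y ^ 2
      - algebraMap K R (c₃ / 3) * y ^ 3)
    (by simp [hf1, h.ay]) (by simp [h₁, e, e', h.by_]; ring)
  exact ⟨c₀, c₁, c₂ / 2, c₃ / 3, by linear_combination h₀⟩

/-- Solutions of the Killing equations are the cubic polynomials in the linear momenta and the
angular momentum. -/
lemma IsKilling.exists_coefficients {g₁ g₂ g₃ g₄ : R} (hg : IsKilling a b g₁ g₂ g₃ g₄) :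
    ∃ c300 c210 c201 c120 c111 c102 c030 c021 c012 c003 : K,
      g₁ = -algebraMap K R c300 * y ^ 3 + algebraMap K R c210 * y ^ 2 - algebraMap K R c120 * y
        + algebraMap K R c030 ∧
      g₂ = 3 * algebraMap K R c300 * x * y ^ 2 - 2 * algebraMap K R c210 * x * y
        + algebraMap K R c201 * y ^ 2 + algebraMap K R c120 * x - algebraMap K R c111 * y
        + algebraMap K R c021 ∧
      g₃ = -3 * algebraMap K R c300 * x ^ 2 * y + algebraMap K R c210 * x ^ 2
        - 2 * algebraMap K R c201 * x * y + algebraMap K R c111 * x - algebraMap K R c102 * y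
        + algebraMap K R c012 ∧
      g₄ = algebraMap K R c300 * x ^ 3 + algebraMap K R c201 * x ^ 2 + algebraMap K R c102 * x
        + algebraMap K R c003 := by
  have hab := h.comm
  -- Going back through the Killing equations, `b² g₃ = 0` gives `b³ g₂ = 0` and then `b⁴ g₁ = 0`.
  -- So `g₁` is a cubic in `y`, and the remaining coefficients follow by integrating forward.
  have k₂ : b (b g₃) = 0 := by
    have := congrArg b hg.eq₄
    simpa [← hab, hg.eq₅] using this
  have k₃ : b (b (b g₂)) = 0 := by
    have := congrArg (fun x => b (b x)) hg.eq₃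
    simpa [← hab, k₂] using this
  have k₄ : b (b (b (b g₁))) = 0 := by
    have := congrArg (fun x => b (b (b x))) hg.eq₂
    simpa [← hab, k₃] using this
  obtain ⟨c030, c120, c210, c300, e₁⟩ := exists_eq_cubic h hg.eq₁ k₄
  obtain ⟨h1, h2, h3, h4⟩ := And.intro h.ax (And.intro h.ay (And.intro h.bx h.by_))
  obtain ⟨a2, a3⟩ := derivation_two_three a
  obtain ⟨b2, b3⟩ := derivation_two_three b
  have l₁ := hg.eq₂
  simp [e₁, h1, h2, h3, h4, a2, a3, b2, b3] at l₁
  obtain ⟨c021, c111, c201, e₂⟩ := exists_eq_quadratic h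
    (f := g₂ - (-3 * algebraMap K R c300 * x * y ^ 2 - 2 * algebraMap K R c210 * x * y
      - algebraMap K R c120 * x))
    (by
      simp [h1, h2, h3, h4, a2, a3, b2, b3]
      linear_combination l₁)
    (by simp [h1, h2, h3, h4, a2, a3, b2, b3, k₃])
  have e₂' := eq_add_of_sub_eq e₂
  have l₂ := hg.eq₃
  simp [e₂', h1, h2, h3, h4, a2, a3, b2, b3] at l₂
  obtain ⟨c012, c102, e₃⟩ := exists_eq_linear h
    (f := g₃ - (3 * algebraMap K R c300 * x ^ 2 * y + algebraMap K R c210 * x ^ 2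
      - 2 * algebraMap K R c201 * x * y - algebraMap K R c111 * x))
    (by
      simp [h1, h2, h3, h4, a2, a3, b2, b3]
      linear_combination l₂)
    (by simp [h1, h2, h3, h4, a2, a3, b2, b3, k₂])
  have e₃' := eq_add_of_sub_eq e₃
  have l₃ := hg.eq₄
  simp [e₃', h1, h2, h3, h4, a2, a3, b2, b3] at l₃
  obtain ⟨c003, e₄⟩ := h.const
    (g₄ - (-algebraMap K R c300 * x ^ 3 + algebraMap K R c201 * x ^ 2 - algebraMap K R c102 * x))
    (by
      simp [h1, h2, h3, h4, a2, a3, b2, b3]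
      linear_combination l₃)
    (by simp [h1, h2, h3, h4, a2, a3, b2, b3, hg.eq₅])
  -- The signs translate the constants of integration into coefficients of powers of `x₁ p₂ - x₂
  -- p₁`.
  refine ⟨-c300, c210, c201, -c120, -c111, -c102, c030, c021, c012, c003, ?_, ?_, ?_, ?_⟩
  · rw [e₁]; simp only [map_neg]; ring
  · rw [e₂']; simp only [map_neg]; ring
  · rw [e₃']; simp only [map_neg]; ring
  · rw [eq_add_of_sub_eq e₄]; simp only [map_neg]; ring

end KillingTensors

variable {Ω : Opens (ℝ × ℝ)}

lemma isCoordinatePair (𝕜 : Type*) [RCLike 𝕜] (h0 : (0, 0) ∉ Ω)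
    (hc : IsPreconnected (Ω : Set (ℝ × ℝ))) :
    IsCoordinatePair (d1 𝕜 h0) (d2 𝕜 h0) (x1Fn Ω 𝕜) (x2Fn Ω 𝕜) :=
  ⟨d1_d2_comm h0, d1_x1Fn h0, d1_x2Fn h0, d2_x1Fn h0, d2_x2Fn h0,
    fun _ => exists_eq_algebraMap h0 hc⟩

lemma x1Fn_apply (q : Ω) : (x1Fn Ω ℝ).1 q = x1 q := by
  change (1 / 2 : ℝ) * (q.1.1 ^ 2 - q.1.2 ^ 2) = (q.1.1 ^ 2 - q.1.2 ^ 2) / 2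
  ring

lemma smoothAlg_eval (q : Ω) : ∃ φ : smoothAlg Ω ℝ →+* ℝ,
    (∀ f, φ f = f.1 q) ∧ φ (x1Fn Ω ℝ) = x1 q ∧ φ (x2Fn Ω ℝ) = x2 q ∧
      ∀ c, φ (algebraMap ℝ _ c) = c :=
  ⟨(Pi.evalRingHom (fun _ : Ω => ℝ) q).comp (smoothAlg Ω ℝ).val.toRingHom, fun _ => rfl,
    x1Fn_apply q, rfl, fun _ => rfl⟩

lemma contDiff_F (A : ℕ → ℕ → ℕ → ℝ) : ContDiff ℝ ∞ (F1 A) ∧ ContDiff ℝ ∞ (F2 A) ∧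
    ContDiff ℝ ∞ (F3 A) ∧ ContDiff ℝ ∞ (F4 A) := by
  unfold F1 F2 F3 F4 x1 x2
  refine ⟨?_, ?_, ?_, ?_⟩ <;> fun_prop

/-- The left hand side of the compatibility condition as an element of the algebra. -/
def compatExpr {𝕜 : Type*} [RCLike 𝕜] (h0 : (0, 0) ∉ Ω) (g₁ g₂ g₃ g₄ V : smoothAlg Ω 𝕜) :
    smoothAlg Ω 𝕜 :=
  compatOp (d1 𝕜 h0) (d2 𝕜 h0) (3 * g₁ * d1 𝕜 h0 V + g₂ * d2 𝕜 h0 V)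
    (2 * (g₂ * d1 𝕜 h0 V + g₃ * d2 𝕜 h0 V)) (g₃ * d1 𝕜 h0 V + 3 * g₄ * d2 𝕜 h0 V)

lemma compatExpr_mk_apply (h0 : (0, 0) ∉ Ω) {G₁ G₂ G₃ G₄ V : ℝ × ℝ → ℝ}
    (h₁ : ContDiffOn ℝ ∞ G₁ Ω) (h₂ : ContDiffOn ℝ ∞ G₂ Ω) (h₃ : ContDiffOn ℝ ∞ G₃ Ω)
    (h₄ : ContDiffOn ℝ ∞ G₄ Ω) (hV : ContDiffOn ℝ ∞ V Ω) (q : Ω) :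
    (compatExpr h0 (smoothMk G₁ h₁) (smoothMk G₂ h₂) (smoothMk G₃ h₃) (smoothMk G₄ h₄)
      (smoothMk V hV)).1 q =
    D2 (D2 (fun r => 3 * G₁ r * D1 V r + G₂ r * D2 V r)) q
      - D1 (D2 (fun r => 2 * (G₂ r * D1 V r + G₃ r * D2 V r))) q
      + D1 (D1 (fun r => G₃ r * D1 V r + 3 * G₄ r * D2 V r)) q := by
  have hV1 := contDiffOn_D1 h0 hV
  have hV2 := contDiffOn_D2 h0 hV
  have s₁ : ContDiffOn ℝ ∞ (fun r => 3 * G₁ r * D1 V r + G₂ r * D2 V r) Ω :=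
    ((contDiffOn_const.mul h₁).mul hV1).add (h₂.mul hV2)
  have s₂ : ContDiffOn ℝ ∞ (fun r => 2 * (G₂ r * D1 V r + G₃ r * D2 V r)) Ω :=
    contDiffOn_const.mul ((h₂.mul hV1).add (h₃.mul hV2))
  have s₃ : ContDiffOn ℝ ∞ (fun r => G₃ r * D1 V r + 3 * G₄ r * D2 V r) Ω :=
    (h₃.mul hV1).add ((contDiffOn_const.mul h₄).mul hV2)
  have e : compatExpr h0 (smoothMk G₁ h₁) (smoothMk G₂ h₂) (smoothMk G₃ h₃) (smoothMk G₄ h₄)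
      (smoothMk V hV) = compatOp (d1 ℝ h0) (d2 ℝ h0) (smoothMk _ s₁) (smoothMk _ s₂)
        (smoothMk _ s₃) := by
    rw [compatExpr, d1_mk, d2_mk]; rfl
  rw [e, compatOp]
  simp only [d1_mk, d2_mk]
  rfl

/-- Both the quantum and the classical case end here: the Killing equations supply the constants
`A`, and if all ten were zero then all leading coefficients would vanish. -/
lemma solvesCompatibility_of_isKilling (h0 : (0, 0) ∉ Ω) (hc : IsPreconnected (Ω : Set (ℝ × ℝ)))
    {V : ℝ × ℝ → ℝ} (hV : ContDiffOn ℝ ∞ V Ω) {g₁ g₂ g₃ g₄ : smoothAlg Ω ℝ}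
    (hg : IsKilling (d1 ℝ h0) (d2 ℝ h0) g₁ g₂ g₃ g₄)
    (hne : ¬ (g₁ = 0 ∧ g₂ = 0 ∧ g₃ = 0 ∧ g₄ = 0))
    (hC : compatExpr h0 g₁ g₂ g₃ g₄ (smoothMk V hV) = 0) : SolvesCompatibility Ω V := by
  obtain ⟨c300, c210, c201, c120, c111, c102, c030, c021, c012, c003, e₁, e₂, e₃, e₄⟩ :=
    hg.exists_coefficients (isCoordinatePair ℝ h0 hc)
  let A : ℕ → ℕ → ℕ → ℝ := fun
    | 3, 0, 0 => c300
    | 2, 1, 0 => c210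
    | 2, 0, 1 => c201
    | 1, 2, 0 => c120
    | 1, 1, 1 => c111
    | 1, 0, 2 => c102
    | 0, 3, 0 => c030
    | 0, 2, 1 => c021
    | 0, 1, 2 => c012
    | 0, 0, 3 => c003
    | _, _, _ => 0
  obtain ⟨s₁, s₂, s₃, s₄⟩ := contDiff_F A
  have f₁ : g₁ = smoothMk (F1 A) s₁.contDiffOn := smoothAlg_ext fun q => by
    obtain ⟨φ, hφ, hx, hy, hφc⟩ := smoothAlg_eval q
    rw [← hφ, e₁]
    simp [hx, hy, hφc, map_ofNat φ 2, map_ofNat φ 3, F1, A]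
  have f₂ : g₂ = smoothMk (F2 A) s₂.contDiffOn := smoothAlg_ext fun q => by
    obtain ⟨φ, hφ, hx, hy, hφc⟩ := smoothAlg_eval q
    rw [← hφ, e₂]
    simp [hx, hy, hφc, map_ofNat φ 2, map_ofNat φ 3, F2, A]
  have f₃ : g₃ = smoothMk (F3 A) s₃.contDiffOn := smoothAlg_ext fun q => by
    obtain ⟨φ, hφ, hx, hy, hφc⟩ := smoothAlg_eval q
    rw [← hφ, e₃]
    simp [hx, hy, hφc, map_ofNat φ 2, map_ofNat φ 3, F3, A]
  have f₄ : g₄ = smoothMk (F4 A) s₄.contDiffOn := smoothAlg_ext fun q => by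
    obtain ⟨φ, hφ, hx, hy, hφc⟩ := smoothAlg_eval q
    rw [← hφ, e₄]
    simp [hx, hy, hφc, map_ofNat φ 2, map_ofNat φ 3, F4, A]
  refine ⟨A, ?_, fun q hq => ?_⟩
  · by_contra hA
    push Not at hA
    have z := fun j k l h => hA j k l h
    apply hne
    have z1 := hA 3 0 0 rfl
    have z2 := hA 2 1 0 rfl
    have z3 := hA 2 0 1 rfl
    have z4 := hA 1 2 0 rfl
    have z5 := hA 1 1 1 rfl
    have z6 := hA 1 0 2 rfl
    have z7 := hA 0 3 0 rfl
    have z8 := hA 0 2 1 rfl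
    have z9 := hA 0 1 2 rfl
    have z10 := hA 0 0 3 rfl
    simp only [A] at z1 z2 z3 z4 z5 z6 z7 z8 z9 z10
    subst z1 z2 z3 z4 z5 z6 z7 z8 z9 z10
    rw [e₁, e₂, e₃, e₄]
    simp only [map_zero]
    refine ⟨?_, ?_, ?_, ?_⟩ <;> ring
  · rw [f₁, f₂, f₃, f₄] at hC
    rw [← compatExpr_mk_apply h0 s₁.contDiffOn s₂.contDiffOn s₃.contDiffOn s₄.contDiffOn hV ⟨q, hq⟩,
      hC]
    rfl

end Parabolic
end

/-! ### Classical integrals. -/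

noncomputable section
namespace Parabolic
open TopologicalSpace

section Classical

lemma hasFDerivAt_cP (z : (ℝ × ℝ) × (ℝ × ℝ)) (hz : z.1.1 ^ 2 + z.1.2 ^ 2 ≠ 0) :
    DifferentiableAt ℝ cP1 z ∧ DifferentiableAt ℝ cP2 z ∧
    (∀ u, fderiv ℝ cP1 z u = (u.1.1 * z.2.1 + z.1.1 * u.2.1 - u.1.2 * z.2.2 - z.1.2 * u.2.2
      - cP1 z * (2 * z.1.1 * u.1.1 + 2 * z.1.2 * u.1.2)) / (z.1.1 ^ 2 + z.1.2 ^ 2)) ∧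
    (∀ u, fderiv ℝ cP2 z u = (u.1.2 * z.2.1 + z.1.2 * u.2.1 + u.1.1 * z.2.2 + z.1.1 * u.2.2
      - cP2 z * (2 * z.1.1 * u.1.1 + 2 * z.1.2 * u.1.2)) / (z.1.1 ^ 2 + z.1.2 ^ 2)) := by
  have a : HasFDerivAt (fun z : (ℝ × ℝ) × (ℝ × ℝ) => z.1.1) _ z :=
    ((ContinuousLinearMap.fst ℝ ℝ ℝ).comp (ContinuousLinearMap.fst ℝ (ℝ × ℝ) (ℝ × ℝ))).hasFDerivAt
  have b : HasFDerivAt (fun z : (ℝ × ℝ) × (ℝ × ℝ) => z.1.2) _ z :=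
    ((ContinuousLinearMap.snd ℝ ℝ ℝ).comp (ContinuousLinearMap.fst ℝ (ℝ × ℝ) (ℝ × ℝ))).hasFDerivAt
  have c : HasFDerivAt (fun z : (ℝ × ℝ) × (ℝ × ℝ) => z.2.1) _ z :=
    ((ContinuousLinearMap.fst ℝ ℝ ℝ).comp (ContinuousLinearMap.snd ℝ (ℝ × ℝ) (ℝ × ℝ))).hasFDerivAt
  have d : HasFDerivAt (fun z : (ℝ × ℝ) × (ℝ × ℝ) => z.2.2) _ z :=
    ((ContinuousLinearMap.snd ℝ ℝ ℝ).comp (ContinuousLinearMap.snd ℝ (ℝ × ℝ) (ℝ × ℝ))).hasFDerivAt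
  have r := (hasDerivAt_inv hz).comp_hasFDerivAt z ((a.pow 2).add (b.pow 2))
  have h1 : HasFDerivAt cP1 _ z := (((a.mul c).sub (b.mul d)).mul r).congr_of_eventuallyEq
    (Filter.Eventually.of_forall fun w => by simp [cP1, div_eq_mul_inv])
  have h2 : HasFDerivAt cP2 _ z := (((b.mul c).add (a.mul d)).mul r).congr_of_eventuallyEq
    (Filter.Eventually.of_forall fun w => by simp [cP2, div_eq_mul_inv])
  refine ⟨h1.differentiableAt, h2.differentiableAt, fun u => ?_, fun u => ?_⟩
  · rw [h1.fderiv, cP1]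
    simp
    field_simp
    ring
  · rw [h2.fderiv, cP2]
    simp
    field_simp
    ring

/-- Bracketing with `F` is differentiation along a vector that depends only on the differential of
`F`, the Hamiltonian vector field up to sign. -/
lemma poisson_eq (F G : (ℝ × ℝ) × (ℝ × ℝ) → ℝ) (z : (ℝ × ℝ) × (ℝ × ℝ)) :
    poisson F G z = fderiv ℝ G z
      ((-fderiv ℝ F z ((0, 0), (1, 0)), -fderiv ℝ F z ((0, 0), (0, 1))),
        (fderiv ℝ F z ((1, 0), (0, 0)), fderiv ℝ F z ((0, 1), (0, 0)))) := by
  have e : ∀ a b c d : ℝ, (((a, b), (c, d)) : (ℝ × ℝ) × (ℝ × ℝ)) =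
      a • ((1, 0), (0, 0)) + b • ((0, 1), (0, 0)) + c • ((0, 0), (1, 0)) + d • ((0, 0), (0, 1)) := by
    intro a b c d; simp
  rw [e, map_add, map_add, map_add, map_smul, map_smul, map_smul, map_smul, poisson]
  simp only [smul_eq_mul]
  ring

variable {V : ℝ × ℝ → ℝ} {q : ℝ × ℝ}

lemma fderiv_eq_dXi_dEta (F : ℝ × ℝ → ℝ) (q u : ℝ × ℝ) :
    fderiv ℝ F q u = u.1 * dXi F q + u.2 * dEta F q := by
  have e : u = u.1 • ((1, 0) : ℝ × ℝ) + u.2 • ((0, 1) : ℝ × ℝ) := by simp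
  conv_lhs => rw [e]
  rw [map_add, map_smul, map_smul]; rfl

lemma fderiv_comp_fst {F : ℝ × ℝ → ℝ} {z : (ℝ × ℝ) × (ℝ × ℝ)} (hF : DifferentiableAt ℝ F z.1) :
    HasFDerivAt (fun z : (ℝ × ℝ) × (ℝ × ℝ) => F z.1)
      ((fderiv ℝ F z.1).comp (ContinuousLinearMap.fst ℝ (ℝ × ℝ) (ℝ × ℝ))) z :=
  hF.hasFDerivAt.comp z hasFDerivAt_fst

/-- The Hamiltonian vector field of `cH V`. -/
lemma poisson_cH (hV : DifferentiableAt ℝ V q) (hq : q.1 ^ 2 + q.2 ^ 2 ≠ 0) (α β : ℝ) :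
    ∃ p v, cP1 (q, p) = α ∧ cP2 (q, p) = β ∧ (∀ G, poisson (cH V) G (q, p) = fderiv ℝ G (q, p) v) ∧
      (∀ F : ℝ × ℝ → ℝ, fderiv ℝ F q v.1 = -(α * D1 F q + β * D2 F q)) ∧
      fderiv ℝ cP1 (q, p) v = D1 V q ∧ fderiv ℝ cP2 (q, p) v = D2 V q := by
  -- The parabolic momenta that correspond to the Cartesian momenta `(α, β)`. All of `ℝ²` is
  -- reached, so the bracket may be treated as a polynomial in free variables `α, β`.
  set p : ℝ × ℝ := (q.1 * α + q.2 * β, -q.2 * α + q.1 * β) with hp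
  obtain ⟨d₁, d₂, f₁, f₂⟩ := hasFDerivAt_cP (q, p) hq
  have hα : cP1 (q, p) = α := by simp only [cP1, hp]; field_simp; ring
  have hβ : cP2 (q, p) = β := by simp only [cP2, hp]; field_simp; ring
  have hH : HasFDerivAt (cH V) _ (q, p) :=
    (((d₁.hasFDerivAt.pow 2).add (d₂.hasFDerivAt.pow 2)).const_mul (1 / 2)).add
      (fderiv_comp_fst (z := (q, p)) hV)
  have hH' : ∀ u, fderiv ℝ (cH V) (q, p) u = α * fderiv ℝ cP1 (q, p) u + β * fderiv ℝ cP2 (q, p) u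
      + (u.1.1 * dXi V q + u.1.2 * dEta V q) := by
    intro u
    rw [hH.fderiv, ← fderiv_eq_dXi_dEta]
    simp [hα, hβ]
    ring
  refine ⟨p, _, hα, hβ, fun G => poisson_eq _ _ _, fun F => ?_, ?_, ?_⟩
  · rw [fderiv_eq_dXi_dEta]
    simp only [hH', f₁, f₂, D1, D2, smul_eq_mul]
    field_simp
    ring
  · simp only [f₁, hH', f₂, D1, smul_eq_mul, hα, hβ]
    simp only [hp]
    field_simp
    ring
  · simp only [f₁, hH', f₂, D2, smul_eq_mul, hα, hβ]
    simp only [hp]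
    field_simp
    ring

/-- The Poisson bracket of `cH V` and `cX f` as a polynomial in the Cartesian momenta. -/
lemma poisson_cH_cX (hV : DifferentiableAt ℝ V q) (hq : q.1 ^ 2 + q.2 ^ 2 ≠ 0)
    {f : ℕ → ℕ → ℝ × ℝ → ℝ} (hf : ∀ j k, j + k ≤ 3 → DifferentiableAt ℝ (f j k) q)
    (h : ∀ p, poisson (cH V) (cX f) (q, p) = 0) (α β : ℝ) :
    ∑ j ∈ Finset.range 4, ∑ k ∈ Finset.range (4 - j),
      (-(α * D1 (f j k) q + β * D2 (f j k) q) * α ^ j * β ^ k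
        + f j k q * (j * α ^ (j - 1) * D1 V q) * β ^ k
        + f j k q * α ^ j * (k * β ^ (k - 1) * D2 V q)) = 0 := by
  obtain ⟨p, v, hα, hβ, hG, hF, h₁, h₂⟩ := poisson_cH hV hq α β
  obtain ⟨d₁, d₂, -, -⟩ := hasFDerivAt_cP (q, p) hq
  have hX : HasFDerivAt (cX f) _ (q, p) :=
    HasFDerivAt.fun_sum fun j hj => HasFDerivAt.fun_sum fun k hk =>
      ((fderiv_comp_fst (F := f j k) (z := (q, p))
        (hf j k (by simp only [Finset.mem_range] at hj hk; omega))).mul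
        (d₁.hasFDerivAt.pow j)).mul (d₂.hasFDerivAt.pow k)
  rw [← h p, hG, hX.fderiv]
  simp only [sum_apply]
  refine Finset.sum_congr rfl fun j _ => Finset.sum_congr rfl fun k _ => ?_
  simp [hα, hβ, h₁, h₂, hF]
  ring

end Classical

/-- Regroups the bracket by monomials in the momenta. The conditions `1 ≤ i` and `1 ≤ j` keep the
truncated subtractions from producing spurious terms. -/
lemma sum_classical_coeff {K : Type*} [Field K] (f fx fy : ℕ → ℕ → K) (v w m n : K) :
    ∑ i ∈ Finset.range 5, ∑ j ∈ Finset.range 5,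
      ((if 1 ≤ i ∧ i + j ≤ 4 then -fx (i - 1) j else 0)
        + (if 1 ≤ j ∧ i + j ≤ 4 then -fy i (j - 1) else 0)
        + (if i + j ≤ 2 then (i + 1) * f (i + 1) j * v + (j + 1) * f i (j + 1) * w else 0))
        * m ^ i * n ^ j =
    ∑ j ∈ Finset.range 4, ∑ k ∈ Finset.range (4 - j),
      (-(m * fx j k + n * fy j k) * m ^ j * n ^ k + f j k * (j * m ^ (j - 1) * v) * n ^ k
        + f j k * m ^ j * (k * n ^ (k - 1) * w)) := by
  simp only [Finset.sum_range_succ, Finset.sum_range_zero, Nat.reduceAdd, Nat.reduceSub,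
    Nat.reduceLeDiff, and_true, and_false, if_true, if_false, true_and, false_and, Nat.cast_ofNat,
    Nat.cast_one, Nat.cast_zero]
  ring

variable {Ω : Opens (ℝ × ℝ)}

lemma HasClassicalIntegral.solvesCompatibility (h0 : (0, 0) ∉ Ω)
    (hc : IsPreconnected (Ω : Set (ℝ × ℝ))) {V : ℝ × ℝ → ℝ} (hV : ContDiffOn ℝ ∞ V Ω)
    (h : HasClassicalIntegral Ω V) : SolvesCompatibility Ω V := by
  obtain ⟨f, hf, ⟨j, k, hjk, q₀, hq₀, hne⟩, hP⟩ := h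
  -- The coefficient of `p₁^i p₂^j` in the bracket. The cases `i + j = 4` are the Killing equations,
  -- and `i + j = 2` are the determining equations for `f 1 0` and `f 0 1`.
  have key : ∀ q : Ω, ∀ i < 5, ∀ j < 5,
      (if 1 ≤ i ∧ i + j ≤ 4 then -D1 (f (i - 1) j) q.1 else 0)
        + (if 1 ≤ j ∧ i + j ≤ 4 then -D2 (f i (j - 1)) q.1 else 0)
        + (if i + j ≤ 2 then (i + 1) * f (i + 1) j q.1 * D1 V q.1
            + (j + 1) * f i (j + 1) q.1 * D2 V q.1 else 0) = (0 : ℝ) := by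
    intro q
    apply coeff_eq_zero_of_forall_int_int
    intro m n
    have := poisson_cH_cX (differentiableAt_of_contDiffOn hV q.2) (sq_add_sq_ne_of_mem h0 q.2)
      (fun j k h => differentiableAt_of_contDiffOn (hf j k h) q.2) (hP q.1 q.2) m n
    exact (sum_classical_coeff (fun j k => f j k q) (fun j k => D1 (f j k) q)
      (fun j k => D2 (f j k) q) _ _ _ _).trans this
  let F : ∀ j k, j + k ≤ 3 → smoothAlg Ω ℝ := fun j k h => smoothMk (f j k) (hf j k h)
  apply solvesCompatibility_of_isKilling h0 hc hV
    (g₁ := F 3 0 le_rfl) (g₂ := F 2 1 le_rfl) (g₃ := F 1 2 le_rfl) (g₄ := F 0 3 le_rfl)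
  · refine ⟨?_, ?_, ?_, ?_, ?_⟩ <;> refine smoothAlg_ext fun q => ?_ <;> simp only [F, d1_mk, d2_mk]
    · have := key q 4 (by norm_num) 0 (by norm_num)
      simpa using this
    · have := key q 3 (by norm_num) 1 (by norm_num)
      change D2 (f 3 0) q + D1 (f 2 1) q = 0
      simp at this; linarith
    · have := key q 2 (by norm_num) 2 (by norm_num)
      change D2 (f 2 1) q + D1 (f 1 2) q = 0
      simp at this; linarith
    · have := key q 1 (by norm_num) 3 (by norm_num)
      change D2 (f 1 2) q + D1 (f 0 3) q = 0
      simp at this; linarith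
    · have := key q 0 (by norm_num) 4 (by norm_num)
      simpa using this
  · rintro ⟨z₁, z₂, z₃, z₄⟩
    have e₁ : f 3 0 q₀ = 0 := congrFun (congrArg Subtype.val z₁) ⟨q₀, hq₀⟩
    have e₂ : f 2 1 q₀ = 0 := congrFun (congrArg Subtype.val z₂) ⟨q₀, hq₀⟩
    have e₃ : f 1 2 q₀ = 0 := congrFun (congrArg Subtype.val z₃) ⟨q₀, hq₀⟩
    have e₄ : f 0 3 q₀ = 0 := congrFun (congrArg Subtype.val z₄) ⟨q₀, hq₀⟩
    have hj : j ≤ 3 := by omega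
    obtain rfl : k = 3 - j := by omega
    interval_cases j <;> contradiction
  · have s₁ : 3 * F 3 0 le_rfl * d1 ℝ h0 (smoothMk V hV) + F 2 1 le_rfl * d2 ℝ h0 (smoothMk V hV)
        = d1 ℝ h0 (F 1 0 (by norm_num)) := smoothAlg_ext fun q => by
      have := key q 2 (by norm_num) 0 (by norm_num)
      simp only [F, d1_mk, d2_mk]
      change 3 * f 3 0 q * D1 V q + f 2 1 q * D2 V q = D1 (f 1 0) q
      norm_num at this; linarith
    have s₂ : 2 * (F 2 1 le_rfl * d1 ℝ h0 (smoothMk V hV) + F 1 2 le_rfl * d2 ℝ h0 (smoothMk V hV))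
        = d2 ℝ h0 (F 1 0 (by norm_num)) + d1 ℝ h0 (F 0 1 (by norm_num)) :=
        smoothAlg_ext fun q => by
      have := key q 1 (by norm_num) 1 (by norm_num)
      simp only [F, d1_mk, d2_mk]
      change 2 * (f 2 1 q * D1 V q + f 1 2 q * D2 V q) = D2 (f 1 0) q + D1 (f 0 1) q
      norm_num at this; linarith
    have s₃ : F 1 2 le_rfl * d1 ℝ h0 (smoothMk V hV) + 3 * F 0 3 le_rfl * d2 ℝ h0 (smoothMk V hV)
        = d2 ℝ h0 (F 0 1 (by norm_num)) := smoothAlg_ext fun q => by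
      have := key q 0 (by norm_num) 2 (by norm_num)
      simp only [F, d1_mk, d2_mk]
      change f 1 2 q * D1 V q + 3 * f 0 3 q * D2 V q = D2 (f 0 1) q
      norm_num at this; linarith
    rw [compatExpr, s₁, s₂, s₃]
    exact compatOp_eq_zero (a := (d1 ℝ h0 : _ →ₗ[ℝ] _).toAddMonoidHom)
      (b := (d2 ℝ h0 : _ →ₗ[ℝ] _).toAddMonoidHom) (fun f => d1_d2_comm (𝕜 := ℝ) h0 f) _ _

end Parabolic
end

/-! ### The quantum commutator on joint eigenfunctions of the momenta. -/

noncomputable section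
namespace Parabolic
open TopologicalSpace

section Abstract

variable {R : Type*} [CommRing R] [Algebra ℂ R]

/-- The operator `κ D`. -/
def momentum (κ : ℂ) (D : Derivation ℂ R R) (g : R) : R := algebraMap ℂ R κ * D g

/-- The Hamiltonian built from two momentum operators. -/
def hamiltonianOp (P₁ P₂ : R → R) (V g : R) : R :=
  algebraMap ℂ R (1 / 2) * (P₁ (P₁ g) + P₂ (P₂ g)) + V * g

/-- The third order operator with coefficients `f`. -/
def cubicOp (P₁ P₂ : R → R) (f : ℕ → ℕ → R) (g : R) : R :=
  ∑ j ∈ Finset.range 4, ∑ k ∈ Finset.range (4 - j), f j k * (P₁^[j] (P₂^[k] g))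

variable (κ : ℂ) (a b : Derivation ℂ R R) (V : R) (f : ℕ → ℕ → R) {ψ : R} {m n : ℂ}

/-- The symbol of the operator `∑ f_{jk} P₁^j P₂^k`. -/
def cubicSymbol (m n : R) : R :=
  f 0 0 + f 0 1 * n + f 0 2 * n ^ 2 + f 0 3 * n ^ 3 + f 1 0 * m + f 1 1 * m * n
    + f 1 2 * m * n ^ 2 + f 2 0 * m ^ 2 + f 2 1 * m ^ 2 * n + f 3 0 * m ^ 3

variable {κ}

/-- On multiples of an eigenfunction the momentum acts on the factor as `κ D + m`. This turns
operator products into polynomials in the eigenvalues. -/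
lemma momentum_mul {D : Derivation ℂ R R} (h : momentum κ D ψ = algebraMap ℂ R m * ψ) (g : R) :
    momentum κ D (g * ψ) = (algebraMap ℂ R κ * D g + algebraMap ℂ R m * g) * ψ := by
  simp only [momentum, Derivation.leibniz, smul_eq_mul] at h ⊢
  linear_combination g * h

lemma cubicOp_eq_symbol_mul (h₁ : momentum κ a ψ = algebraMap ℂ R m * ψ)
    (h₂ : momentum κ b ψ = algebraMap ℂ R n * ψ) :
    cubicOp (momentum κ a) (momentum κ b) f ψ =
      cubicSymbol f (algebraMap ℂ R m) (algebraMap ℂ R n) * ψ := by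
  simp only [cubicOp, Finset.sum_range_succ, Finset.sum_range_zero, Function.iterate_succ_apply,
    Function.iterate_zero_apply, Nat.reduceSub, h₁, h₂, momentum_mul h₁, momentum_mul h₂,
    Derivation.leibniz, Derivation.map_algebraMap, smul_eq_mul, map_add, cubicSymbol]
  simp only [Function.iterate_zero, id, mul_zero, add_zero, zero_add, map_zero]
  ring

lemma hamiltonianOp_mul (h₁ : momentum κ a ψ = algebraMap ℂ R m * ψ)
    (h₂ : momentum κ b ψ = algebraMap ℂ R n * ψ) (F : R) :
    hamiltonianOp (momentum κ a) (momentum κ b) V (F * ψ) =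
      (algebraMap ℂ R (1 / 2) * (algebraMap ℂ R κ ^ 2 * (a (a F) + b (b F))
          + 2 * algebraMap ℂ R κ * (algebraMap ℂ R m * a F + algebraMap ℂ R n * b F)
          + (algebraMap ℂ R m ^ 2 + algebraMap ℂ R n ^ 2) * F) + V * F) * ψ := by
  simp only [hamiltonianOp, momentum_mul h₁, momentum_mul h₂,
    Derivation.leibniz, Derivation.map_algebraMap, smul_eq_mul, map_add]
  ring

/-- The coefficients of the commutator, as polynomial in the eigenvalues of the momenta. -/
def commCoeff (K : ℂ) (f fx fy fl : ℕ → ℕ → ℂ) (v₁ v₂ v₁₁ v₁₂ v₂₂ v₃ : ℂ) (i j : ℕ) : ℂ :=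
  (if i + j ≤ 3 then 1 / 2 * K ^ 2 * fl i j else 0)
    + (if 1 ≤ i ∧ i + j ≤ 4 then K * fx (i - 1) j else 0)
    + (if 1 ≤ j ∧ i + j ≤ 4 then K * fy i (j - 1) else 0)
    - (if i + j ≤ 2 then K * ((i + 1) * f (i + 1) j * v₁ + (j + 1) * f i (j + 1) * v₂) else 0)
    - (if i + j ≤ 1 then K ^ 2 * ((i + 2) * (i + 1) / 2 * f (i + 2) j * v₁₁
        + (i + 1) * (j + 1) * f (i + 1) (j + 1) * v₁₂
        + (j + 2) * (j + 1) / 2 * f i (j + 2) * v₂₂) else 0)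
    - (if i + j ≤ 0 then K ^ 3 * v₃ else 0)

/-- Collects the symbol of the commutator by powers of the eigenvalues. The terms with `V`
undifferentiated cancel between the two products and do not occur; `v₃` stands for all third
derivatives of `V`. -/
lemma sum_commCoeff (K : ℂ) (f fx fy fl : ℕ → ℕ → ℂ) (v₁ v₂ v₁₁ v₁₂ v₂₂ v₃ m n : ℂ) :
    ∑ i ∈ Finset.range 5, ∑ j ∈ Finset.range 5,
      commCoeff K f fx fy fl v₁ v₂ v₁₁ v₁₂ v₂₂ v₃ i j * m ^ i * n ^ j =
    1 / 2 * (K ^ 2 * cubicSymbol fl m n + 2 * K * (m * cubicSymbol fx m n + n * cubicSymbol fy m n))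
    - (f 0 1 * (K * v₂) + f 0 2 * (K ^ 2 * v₂₂ + 2 * K * n * v₂)
      + f 1 0 * (K * v₁) + f 1 1 * (K ^ 2 * v₁₂ + K * m * v₂ + K * n * v₁)
      + f 2 0 * (K ^ 2 * v₁₁ + 2 * K * m * v₁)
      + f 0 3 * (3 * K ^ 2 * n * v₂₂ + 3 * K * n ^ 2 * v₂)
      + f 1 2 * (2 * K ^ 2 * n * v₁₂ + K ^ 2 * m * v₂₂ + 2 * K * m * n * v₂ + K * n ^ 2 * v₁)
      + f 2 1 * (2 * K ^ 2 * m * v₁₂ + K ^ 2 * n * v₁₁ + 2 * K * m * n * v₁ + K * m ^ 2 * v₂)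
      + f 3 0 * (3 * K ^ 2 * m * v₁₁ + 3 * K * m ^ 2 * v₁) + K ^ 3 * v₃) := by
  simp only [commCoeff, cubicSymbol, Finset.sum_range_succ, Finset.sum_range_zero, Nat.reduceAdd,
    Nat.reduceSub, Nat.reduceLeDiff, and_true, and_false, if_true, if_false, true_and, false_and,
    Nat.cast_ofNat, Nat.cast_one, Nat.cast_zero]
  ring

/-- `H` sends an eigenfunction `ψ` to `(c + V) ψ` with `c` constant, so this computes `X H ψ`. -/
lemma cubicOp_mul (hab : ∀ g, a (b g) = b (a g)) (h₁ : momentum κ a ψ = algebraMap ℂ R m * ψ)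
    (h₂ : momentum κ b ψ = algebraMap ℂ R n * ψ) (c : ℂ) :
    cubicOp (momentum κ a) (momentum κ b) f ((algebraMap ℂ R c + V) * ψ) =
      ((algebraMap ℂ R c + V) * cubicSymbol f (algebraMap ℂ R m) (algebraMap ℂ R n)
      + (f 0 1 * (algebraMap ℂ R κ * b V)
      + f 0 2 * (algebraMap ℂ R κ ^ 2 * b (b V) + 2 * algebraMap ℂ R κ * algebraMap ℂ R n * b V)
      + f 1 0 * (algebraMap ℂ R κ * a V)
      + f 1 1 * (algebraMap ℂ R κ ^ 2 * b (a V) + algebraMap ℂ R κ * algebraMap ℂ R m * b V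
        + algebraMap ℂ R κ * algebraMap ℂ R n * a V)
      + f 2 0 * (algebraMap ℂ R κ ^ 2 * a (a V) + 2 * algebraMap ℂ R κ * algebraMap ℂ R m * a V)
      + f 0 3 * (3 * algebraMap ℂ R κ ^ 2 * algebraMap ℂ R n * b (b V)
        + 3 * algebraMap ℂ R κ * algebraMap ℂ R n ^ 2 * b V)
      + f 1 2 * (2 * algebraMap ℂ R κ ^ 2 * algebraMap ℂ R n * b (a V)
        + algebraMap ℂ R κ ^ 2 * algebraMap ℂ R m * b (b V)
        + 2 * algebraMap ℂ R κ * algebraMap ℂ R m * algebraMap ℂ R n * b V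
        + algebraMap ℂ R κ * algebraMap ℂ R n ^ 2 * a V)
      + f 2 1 * (2 * algebraMap ℂ R κ ^ 2 * algebraMap ℂ R m * b (a V)
        + algebraMap ℂ R κ ^ 2 * algebraMap ℂ R n * a (a V)
        + 2 * algebraMap ℂ R κ * algebraMap ℂ R m * algebraMap ℂ R n * a V
        + algebraMap ℂ R κ * algebraMap ℂ R m ^ 2 * b V)
      + f 3 0 * (3 * algebraMap ℂ R κ ^ 2 * algebraMap ℂ R m * a (a V)
        + 3 * algebraMap ℂ R κ * algebraMap ℂ R m ^ 2 * a V)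
      + algebraMap ℂ R κ ^ 3 * (f 0 3 * b (b (b V)) + f 1 2 * b (b (a V)) + f 2 1 * b (a (a V))
        + f 3 0 * a (a (a V))))) * ψ := by
  simp only [cubicOp, Finset.sum_range_succ, Finset.sum_range_zero, Function.iterate_succ_apply,
    Function.iterate_zero_apply, Nat.reduceSub, momentum_mul h₁, momentum_mul h₂,
    Derivation.leibniz, Derivation.map_algebraMap, smul_eq_mul, map_add, cubicSymbol]
  simp only [Function.iterate_zero, id, mul_zero, add_zero, zero_add, map_add, hab,
    Derivation.leibniz, Derivation.map_algebraMap, smul_eq_mul, map_zero]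
  ring

/-- The commutation relation implies the vanishing of all coefficients of the commutator. -/
lemma commCoeff_eq_zero (hab : ∀ g, a (b g) = b (a g)) (φ : R →ₐ[ℂ] ℂ)
    (hψ : ∀ m n : ℤ, ∃ ψ, φ ψ ≠ 0 ∧ momentum κ a ψ = algebraMap ℂ R m * ψ ∧
      momentum κ b ψ = algebraMap ℂ R n * ψ ∧
      hamiltonianOp (momentum κ a) (momentum κ b) V (cubicOp (momentum κ a) (momentum κ b) f ψ) =
      cubicOp (momentum κ a) (momentum κ b) f (hamiltonianOp (momentum κ a) (momentum κ b) V ψ)) :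
    ∀ i < 5, ∀ j < 5, commCoeff κ (fun j k => φ (f j k)) (fun j k => φ (a (f j k)))
      (fun j k => φ (b (f j k))) (fun j k => φ (a (a (f j k)) + b (b (f j k))))
      (φ (a V)) (φ (b V)) (φ (a (a V))) (φ (b (a V))) (φ (b (b V)))
      (φ (f 0 3 * b (b (b V)) + f 1 2 * b (b (a V)) + f 2 1 * b (a (a V))
        + f 3 0 * a (a (a V)))) i j = 0 := by
  apply coeff_eq_zero_of_forall_int_int
  intro m n
  obtain ⟨ψ, hne, h₁, h₂, h⟩ := hψ m n
  -- The case of the constant factor 1.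
  have e : hamiltonianOp (momentum κ a) (momentum κ b) V ψ =
      (algebraMap ℂ R (1 / 2 * ((m : ℂ) ^ 2 + (n : ℂ) ^ 2)) + V) * ψ := by
    have := hamiltonianOp_mul a b V h₁ h₂ 1
    simp only [one_mul, mul_one, Derivation.map_one_eq_zero, map_zero, mul_zero, add_zero, zero_add]
      at this
    rw [this, map_mul, map_add, map_pow, map_pow]
  rw [cubicOp_eq_symbol_mul a b f h₁ h₂, hamiltonianOp_mul a b V h₁ h₂, e,
    cubicOp_mul a b V f hab h₁ h₂] at h
  have h' := congrArg φ h
  rw [map_mul, map_mul] at h'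
  have h'' := mul_right_cancel₀ hne h'
  refine (sum_commCoeff _ _ _ _ _ _ _ _ _ _ _ _ _).trans ?_
  simp only [cubicSymbol, map_add, map_mul, map_pow, AlgHom.commutes, Derivation.leibniz,
    Derivation.leibniz_pow, Derivation.map_algebraMap, smul_eq_mul, nsmul_eq_mul, map_ofNat,
    mul_zero, smul_zero, add_zero, zero_add, Algebra.algebraMap_self, RingHom.id_apply,
    map_zero] at h'' ⊢
  linear_combination h''

end Abstract

end Parabolic
end

/-! ### Concrete operators as algebraic ones, exponentials, real and imaginary parts. -/

noncomputable section
namespace Parabolic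
open TopologicalSpace

variable {Ω : Opens (ℝ × ℝ)}

/-- The function `F` is smooth on `Ω` and restricts to `g`. -/
def IsRep (F : ℝ × ℝ → ℂ) (g : smoothAlg Ω ℂ) : Prop := ∃ hF, smoothMk F hF = g

lemma IsRep.apply {F : ℝ × ℝ → ℂ} {g : smoothAlg Ω ℂ} (h : IsRep F g) (q : Ω) : g.1 q = F q := by
  obtain ⟨hF, rfl⟩ := h; rfl

lemma IsRep.add {F G : ℝ × ℝ → ℂ} {f g : smoothAlg Ω ℂ} (hF : IsRep F f) (hG : IsRep G g) :
    IsRep (fun q => F q + G q) (f + g) := by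
  obtain ⟨hF, rfl⟩ := hF; obtain ⟨hG, rfl⟩ := hG; exact ⟨hF.add hG, rfl⟩

lemma IsRep.mul {F G : ℝ × ℝ → ℂ} {f g : smoothAlg Ω ℂ} (hF : IsRep F f) (hG : IsRep G g) :
    IsRep (fun q => F q * G q) (f * g) := by
  obtain ⟨hF, rfl⟩ := hF; obtain ⟨hG, rfl⟩ := hG; exact ⟨hF.mul hG, rfl⟩

lemma isRep_const (c : ℂ) : IsRep (fun _ => c) (algebraMap ℂ (smoothAlg Ω ℂ) c) :=
  ⟨contDiffOn_const, rfl⟩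

lemma IsRep.sum {ι : Type*} {s : Finset ι} {F : ι → ℝ × ℝ → ℂ} {f : ι → smoothAlg Ω ℂ}
    (h : ∀ i ∈ s, IsRep (F i) (f i)) : IsRep (fun q => ∑ i ∈ s, F i q) (∑ i ∈ s, f i) := by
  classical
  induction s using Finset.induction_on with
  | empty => simpa using isRep_const 0
  | insert i s hi ih =>
    simp only [Finset.sum_insert hi]
    exact (h i (Finset.mem_insert_self i s)).add
      (ih fun j hj => h j (Finset.mem_insert_of_mem hj))

variable (h0 : (0, 0) ∉ Ω)
include h0

lemma IsRep.qP1 {F : ℝ × ℝ → ℂ} {g : smoothAlg Ω ℂ} (ħ : ℝ) (h : IsRep F g) :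
    IsRep (qP1 ħ F) (momentum (-(Complex.I * ħ)) (d1 ℂ h0) g) := by
  obtain ⟨hF, rfl⟩ := h
  exact (isRep_const _).mul ⟨contDiffOn_D1 h0 hF, (d1_mk h0 hF).symm⟩

lemma IsRep.qP2 {F : ℝ × ℝ → ℂ} {g : smoothAlg Ω ℂ} (ħ : ℝ) (h : IsRep F g) :
    IsRep (qP2 ħ F) (momentum (-(Complex.I * ħ)) (d2 ℂ h0) g) := by
  obtain ⟨hF, rfl⟩ := h
  exact (isRep_const _).mul ⟨contDiffOn_D2 h0 hF, (d2_mk h0 hF).symm⟩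

lemma IsRep.qH {F : ℝ × ℝ → ℂ} {g v : smoothAlg Ω ℂ} (ħ : ℝ) {V : ℝ × ℝ → ℝ}
    (hV : IsRep (fun q => (V q : ℂ)) v) (h : IsRep F g) :
    IsRep (qH ħ V F) (hamiltonianOp (momentum (-(Complex.I * ħ)) (d1 ℂ h0))
      (momentum (-(Complex.I * ħ)) (d2 ℂ h0)) v g) :=
  ((isRep_const _).mul (((h.qP1 h0 ħ).qP1 h0 ħ).add ((h.qP2 h0 ħ).qP2 h0 ħ))).add (hV.mul h)

lemma IsRep.qX {F : ℝ × ℝ → ℂ} {g : smoothAlg Ω ℂ} (ħ : ℝ) {f : ℕ → ℕ → ℝ × ℝ → ℂ}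
    {f' : ℕ → ℕ → smoothAlg Ω ℂ} (hf : ∀ j k, j + k ≤ 3 → IsRep (f j k) (f' j k)) (h : IsRep F g) :
    IsRep (qX ħ f F) (cubicOp (momentum (-(Complex.I * ħ)) (d1 ℂ h0))
      (momentum (-(Complex.I * ħ)) (d2 ℂ h0)) f' g) := by
  refine IsRep.sum fun j hj => IsRep.sum fun k hk => ?_
  refine (hf j k (by simp only [Finset.mem_range] at hj hk; omega)).mul ?_
  have h₂ : IsRep ((Parabolic.qP2 ħ)^[k] F) ((momentum (-(Complex.I * ħ)) (d2 ℂ h0))^[k] g) := by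
    clear hk
    induction k with
    | zero => exact h
    | succ k ih => simpa only [Function.iterate_succ_apply'] using ih.qP2 h0 ħ
  clear hj
  induction j with
  | zero => exact h₂
  | succ j ih =>
    simp only [Function.iterate_succ_apply']
    have := (ih (by simp only [Finset.mem_range] at hk ⊢; omega)).qP1 h0 ħ
    simpa only [Function.iterate_succ_apply'] using this

omit h0 in
lemma exists_exp (g : smoothAlg Ω ℂ) :
    ∃ ψ : smoothAlg Ω ℂ, (∀ q, ψ.1 q ≠ 0) ∧ ∀ v, dirDeriv Ω ℂ v ψ = dirDeriv Ω ℂ v g * ψ := by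
  obtain ⟨G, hG, rfl⟩ := exists_eq_smoothMk g
  refine ⟨smoothMk (fun q => Complex.exp (G q)) hG.cexp, fun q => Complex.exp_ne_zero _, fun v => ?_⟩
  rw [dirDeriv_mk, dirDeriv_mk]
  refine smoothAlg_ext fun q => ?_
  have := ((differentiableAt_of_contDiffOn hG q.2).hasFDerivAt.cexp).fderiv
  change fderiv ℝ (fun q => Complex.exp (G q)) q v = fderiv ℝ G q v * Complex.exp (G q)
  rw [this]
  simp [mul_comm]

/-- Joint eigenfunctions of the momentum operators. -/
lemma exists_eigenfunction {κ : ℂ} (hκ : κ ≠ 0) (m n : ℂ) :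
    ∃ ψ : smoothAlg Ω ℂ, (∀ q, ψ.1 q ≠ 0) ∧
      momentum κ (d1 ℂ h0) ψ = algebraMap ℂ _ m * ψ ∧
      momentum κ (d2 ℂ h0) ψ = algebraMap ℂ _ n * ψ := by
  obtain ⟨ψ, hne, hψ⟩ := exists_exp (algebraMap ℂ _ (m / κ) * x1Fn Ω ℂ
    + algebraMap ℂ _ (n / κ) * x2Fn Ω ℂ)
  have e₁ : d1 ℂ h0 ψ = d1 ℂ h0 (algebraMap ℂ _ (m / κ) * x1Fn Ω ℂ
      + algebraMap ℂ _ (n / κ) * x2Fn Ω ℂ) * ψ := by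
    rw [d1_apply, d1_apply, hψ, hψ]; ring
  have e₂ : d2 ℂ h0 ψ = d2 ℂ h0 (algebraMap ℂ _ (m / κ) * x1Fn Ω ℂ
      + algebraMap ℂ _ (n / κ) * x2Fn Ω ℂ) * ψ := by
    rw [d2_apply, d2_apply, hψ, hψ]; ring
  have c : ∀ m : ℂ, algebraMap ℂ (smoothAlg Ω ℂ) κ * algebraMap ℂ _ (m / κ) = algebraMap ℂ _ m := by
    intro m; rw [← map_mul, mul_div_cancel₀ m hκ]
  refine ⟨ψ, hne, ?_, ?_⟩
  · rw [momentum, e₁]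
    simp only [map_add, Derivation.leibniz, smul_eq_mul, d1_x1Fn, d1_x2Fn, Derivation.map_algebraMap]
    linear_combination ψ * c m
  · rw [momentum, e₂]
    simp only [map_add, Derivation.leibniz, smul_eq_mul, d2_x1Fn, d2_x2Fn, Derivation.map_algebraMap]
    linear_combination ψ * c n

omit h0 in
/-- Post-composition with a real linear functional. -/
def realPart (L : ℂ →L[ℝ] ℝ) : smoothAlg Ω ℂ →+ smoothAlg Ω ℝ where
  toFun g := ⟨fun q => L (g.1 q), by
    obtain ⟨_, F, hF, h⟩ := g
    exact ⟨fun q => L (F q), L.contDiff.comp_contDiffOn hF, fun q => by simp [h]⟩⟩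
  map_zero' := smoothAlg_ext fun q => map_zero L
  map_add' f g := smoothAlg_ext fun q => map_add L _ _

omit h0 in
lemma realPart_dirDeriv (L : ℂ →L[ℝ] ℝ) (v : ℝ × ℝ) (g : smoothAlg Ω ℂ) :
    dirDeriv Ω ℝ v (realPart L g) = realPart L (dirDeriv Ω ℂ v g) := by
  obtain ⟨F, hF, rfl⟩ := exists_eq_smoothMk g
  have e : realPart L (smoothMk F hF) = smoothMk (fun q => L (F q)) (L.contDiff.comp_contDiffOn hF) :=
    rfl
  rw [e, dirDeriv_mk, dirDeriv_mk]
  refine smoothAlg_ext fun q => ?_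
  change fderiv ℝ (fun q => L (F q)) q v = L (fderiv ℝ F q v)
  have := (L.hasFDerivAt.comp q.1 (differentiableAt_of_contDiffOn hF q.2).hasFDerivAt).fderiv
  exact congrArg (fun T : ℝ × ℝ →L[ℝ] ℝ => T v) this

lemma d1_realPart (L : ℂ →L[ℝ] ℝ) (g : smoothAlg Ω ℂ) :
    d1 ℝ h0 (realPart L g) = realPart L (d1 ℂ h0 g) := by
  rw [d1_apply, d1_apply, realPart_dirDeriv, realPart_dirDeriv]
  refine smoothAlg_ext fun q => ?_
  change (1 / (q.1.1 ^ 2 + q.1.2 ^ 2) : ℝ) * q.1.1 * L _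
    - (1 / (q.1.1 ^ 2 + q.1.2 ^ 2) : ℝ) * q.1.2 * L _ =
    L (((1 / (q.1.1 ^ 2 + q.1.2 ^ 2) : ℝ) : ℂ) * (q.1.1 : ℂ) * _
    - ((1 / (q.1.1 ^ 2 + q.1.2 ^ 2) : ℝ) : ℂ) * (q.1.2 : ℂ) * _)
  rw [← Complex.ofReal_mul, ← Complex.ofReal_mul, map_sub, ← Complex.real_smul, ← Complex.real_smul,
    map_smul, map_smul]
  rfl

lemma d2_realPart (L : ℂ →L[ℝ] ℝ) (g : smoothAlg Ω ℂ) :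
    d2 ℝ h0 (realPart L g) = realPart L (d2 ℂ h0 g) := by
  rw [d2_apply, d2_apply, realPart_dirDeriv, realPart_dirDeriv]
  refine smoothAlg_ext fun q => ?_
  change (1 / (q.1.1 ^ 2 + q.1.2 ^ 2) : ℝ) * q.1.2 * L _
    + (1 / (q.1.1 ^ 2 + q.1.2 ^ 2) : ℝ) * q.1.1 * L _ =
    L (((1 / (q.1.1 ^ 2 + q.1.2 ^ 2) : ℝ) : ℂ) * (q.1.2 : ℂ) * _
    + ((1 / (q.1.1 ^ 2 + q.1.2 ^ 2) : ℝ) : ℂ) * (q.1.1 : ℂ) * _)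
  rw [← Complex.ofReal_mul, ← Complex.ofReal_mul, map_add, ← Complex.real_smul, ← Complex.real_smul,
    map_smul, map_smul]
  rfl

lemma IsKilling.realPart (L : ℂ →L[ℝ] ℝ) {g₁ g₂ g₃ g₄ : smoothAlg Ω ℂ}
    (h : IsKilling (d1 ℂ h0) (d2 ℂ h0) g₁ g₂ g₃ g₄) :
    IsKilling (d1 ℝ h0) (d2 ℝ h0) (realPart L g₁) (realPart L g₂) (realPart L g₃)
      (realPart L g₄) := by
  constructor <;> simp only [d1_realPart, d2_realPart, ← map_add, h.eq₁, h.eq₂, h.eq₃, h.eq₄, h.eq₅,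
    map_zero]

/-- The potential is real, so the compatibility expression is real linear in the leading
coefficients and `L` passes through it. -/
lemma realPart_compatExpr (L : ℂ →L[ℝ] ℝ) {V : ℝ × ℝ → ℝ} (hV : ContDiffOn ℝ ∞ V Ω)
    (g₁ g₂ g₃ g₄ : smoothAlg Ω ℂ) :
    realPart L (compatExpr h0 g₁ g₂ g₃ g₄ (smoothMk (fun q => (V q : ℂ)) (contDiffOn_ofReal hV))) =
      compatExpr h0 (realPart L g₁) (realPart L g₂) (realPart L g₃) (realPart L g₄)
        (smoothMk V hV) := by
  have dv : ∀ v, ∀ q : Ω, (dirDeriv Ω ℂ v (smoothMk (fun q => (V q : ℂ)) (contDiffOn_ofReal hV))).1 q =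
      ((dirDeriv Ω ℝ v (smoothMk V hV)).1 q : ℂ) := by
    intro v q
    rw [dirDeriv_mk, dirDeriv_mk]
    exact fderiv_ofReal_comp (𝕜 := ℂ) (differentiableAt_of_contDiffOn hV q.2) v
  have dv₁ : ∀ q : Ω, (d1 ℂ h0 (smoothMk (fun q => (V q : ℂ)) (contDiffOn_ofReal hV))).1 q =
      ((d1 ℝ h0 (smoothMk V hV)).1 q : ℂ) := by
    intro q
    rw [d1_apply, d1_apply]
    change ((1 / (q.1.1 ^ 2 + q.1.2 ^ 2) : ℝ) : ℂ) * (q.1.1 : ℂ) * _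
      - ((1 / (q.1.1 ^ 2 + q.1.2 ^ 2) : ℝ) : ℂ) * (q.1.2 : ℂ) * _ =
      (((1 / (q.1.1 ^ 2 + q.1.2 ^ 2) : ℝ) * q.1.1 * _
      - (1 / (q.1.1 ^ 2 + q.1.2 ^ 2) : ℝ) * q.1.2 * _ : ℝ) : ℂ)
    rw [dv, dv]; push_cast; ring
  have dv₂ : ∀ q : Ω, (d2 ℂ h0 (smoothMk (fun q => (V q : ℂ)) (contDiffOn_ofReal hV))).1 q =
      ((d2 ℝ h0 (smoothMk V hV)).1 q : ℂ) := by
    intro q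
    rw [d2_apply, d2_apply]
    change ((1 / (q.1.1 ^ 2 + q.1.2 ^ 2) : ℝ) : ℂ) * (q.1.2 : ℂ) * _
      + ((1 / (q.1.1 ^ 2 + q.1.2 ^ 2) : ℝ) : ℂ) * (q.1.1 : ℂ) * _ =
      (((1 / (q.1.1 ^ 2 + q.1.2 ^ 2) : ℝ) * q.1.2 * _
      + (1 / (q.1.1 ^ 2 + q.1.2 ^ 2) : ℝ) * q.1.1 * _ : ℝ) : ℂ)
    rw [dv, dv]; push_cast; ring
  -- `L` is only real linear; the real factors have to be recognized as real scalars before they can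
  -- be taken out.
  have key : ∀ (c e : ℝ) (x y : ℂ) (u w : ℝ), L (c * x * u + e * y * w) = c * L x * u + e * L y * w := by
    intro c e x y u w
    have : (c * x * u + e * y * w : ℂ) = (c * u) • x + (e * w) • y := by
      simp only [Complex.real_smul]; push_cast; ring
    rw [this, map_add, map_smul, map_smul, smul_eq_mul, smul_eq_mul]; ring
  set v₁ := d1 ℂ h0 (smoothMk (fun q => (V q : ℂ)) (contDiffOn_ofReal hV))
  set v₂ := d2 ℂ h0 (smoothMk (fun q => (V q : ℂ)) (contDiffOn_ofReal hV))
  have e₁ : realPart L (3 * g₁ * v₁ + g₂ * v₂) = 3 * realPart L g₁ * d1 ℝ h0 (smoothMk V hV)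
      + realPart L g₂ * d2 ℝ h0 (smoothMk V hV) := by
    refine smoothAlg_ext fun q => ?_
    have := key 3 1 (g₁.1 q) (g₂.1 q) ((d1 ℝ h0 (smoothMk V hV)).1 q)
      ((d2 ℝ h0 (smoothMk V hV)).1 q)
    rw [← dv₁, ← dv₂, Complex.ofReal_ofNat, Complex.ofReal_one, one_mul, one_mul] at this
    exact this
  have e₂ : realPart L (2 * (g₂ * v₁ + g₃ * v₂)) = 2 * (realPart L g₂ * d1 ℝ h0 (smoothMk V hV)
      + realPart L g₃ * d2 ℝ h0 (smoothMk V hV)) := by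
    refine smoothAlg_ext fun q => ?_
    have := key 2 2 (g₂.1 q) (g₃.1 q) ((d1 ℝ h0 (smoothMk V hV)).1 q)
      ((d2 ℝ h0 (smoothMk V hV)).1 q)
    rw [← dv₁, ← dv₂, Complex.ofReal_ofNat, mul_assoc, mul_assoc, ← mul_add, mul_assoc, mul_assoc,
      ← mul_add] at this
    exact this
  have e₃ : realPart L (g₃ * v₁ + 3 * g₄ * v₂) = realPart L g₃ * d1 ℝ h0 (smoothMk V hV)
      + 3 * realPart L g₄ * d2 ℝ h0 (smoothMk V hV) := by
    refine smoothAlg_ext fun q => ?_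
    have := key 1 3 (g₃.1 q) (g₄.1 q) ((d1 ℝ h0 (smoothMk V hV)).1 q)
      ((d2 ℝ h0 (smoothMk V hV)).1 q)
    rw [← dv₁, ← dv₂, Complex.ofReal_ofNat, Complex.ofReal_one, one_mul, one_mul] at this
    exact this
  rw [compatExpr, compatOp, map_add, map_sub, ← d1_realPart h0, ← d1_realPart h0, ← d1_realPart h0,
    ← d2_realPart h0, ← d2_realPart h0, ← d2_realPart h0, e₁, e₂, e₃]
  rfl

end Parabolic
end

/-! ### The determining equations of a quantum integral and their compatibility. -/

noncomputable section
namespace Parabolic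
open TopologicalSpace

/-- The coefficients of total degree four, three and two in the eigenvalues, each divided by `K`. -/
lemma commCoeff_equations {K : ℂ} (hK : K ≠ 0) {f fx fy fl : ℕ → ℕ → ℂ} {v₁ v₂ v₁₁ v₁₂ v₂₂ v₃ : ℂ}
    (h : ∀ i < 5, ∀ j < 5, commCoeff K f fx fy fl v₁ v₂ v₁₁ v₁₂ v₂₂ v₃ i j = 0) :
    (fx 3 0 = 0 ∧ fy 3 0 + fx 2 1 = 0 ∧ fy 2 1 + fx 1 2 = 0 ∧ fy 1 2 + fx 0 3 = 0 ∧ fy 0 3 = 0) ∧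
    (fx 2 0 = -K / 2 * fl 3 0 ∧ fy 2 0 + fx 1 1 = -K / 2 * fl 2 1 ∧
      fy 1 1 + fx 0 2 = -K / 2 * fl 1 2 ∧ fy 0 2 = -K / 2 * fl 0 3) ∧
    (3 * f 3 0 * v₁ + f 2 1 * v₂ = fx 1 0 + K / 2 * fl 2 0 ∧
      2 * (f 2 1 * v₁ + f 1 2 * v₂) = fy 1 0 + fx 0 1 + K / 2 * fl 1 1 ∧
      f 1 2 * v₁ + 3 * f 0 3 * v₂ = fy 0 1 + K / 2 * fl 0 2) := by
  refine ⟨⟨?_, ?_, ?_, ?_, ?_⟩, ⟨?_, ?_, ?_, ?_⟩, ?_, ?_, ?_⟩ <;> apply mul_left_cancel₀ hK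
  · have e := h 4 (by norm_num) 0 (by norm_num)
    simp only [commCoeff, Nat.reduceAdd, Nat.reduceSub, Nat.reduceLeDiff, and_true, and_false,
      if_true, if_false, true_and, false_and, Nat.cast_ofNat, Nat.cast_one, Nat.cast_zero] at e
    linear_combination e
  · have e := h 3 (by norm_num) 1 (by norm_num)
    simp only [commCoeff, Nat.reduceAdd, Nat.reduceSub, Nat.reduceLeDiff, and_true, and_false,
      if_true, if_false, true_and, false_and, Nat.cast_ofNat, Nat.cast_one, Nat.cast_zero] at e
    linear_combination e
  · have e := h 2 (by norm_num) 2 (by norm_num)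
    simp only [commCoeff, Nat.reduceAdd, Nat.reduceSub, Nat.reduceLeDiff, and_true, and_false,
      if_true, if_false, true_and, false_and, Nat.cast_ofNat, Nat.cast_one, Nat.cast_zero] at e
    linear_combination e
  · have e := h 1 (by norm_num) 3 (by norm_num)
    simp only [commCoeff, Nat.reduceAdd, Nat.reduceSub, Nat.reduceLeDiff, and_true, and_false,
      if_true, if_false, true_and, false_and, Nat.cast_ofNat, Nat.cast_one, Nat.cast_zero] at e
    linear_combination e
  · have e := h 0 (by norm_num) 4 (by norm_num)
    simp only [commCoeff, Nat.reduceAdd, Nat.reduceSub, Nat.reduceLeDiff, and_true, and_false,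
      if_true, if_false, true_and, false_and, Nat.cast_ofNat, Nat.cast_one, Nat.cast_zero] at e
    linear_combination e
  · have e := h 3 (by norm_num) 0 (by norm_num)
    simp only [commCoeff, Nat.reduceAdd, Nat.reduceSub, Nat.reduceLeDiff, and_true, and_false,
      if_true, if_false, true_and, false_and, Nat.cast_ofNat, Nat.cast_one, Nat.cast_zero] at e
    linear_combination e
  · have e := h 2 (by norm_num) 1 (by norm_num)
    simp only [commCoeff, Nat.reduceAdd, Nat.reduceSub, Nat.reduceLeDiff, and_true, and_false,
      if_true, if_false, true_and, false_and, Nat.cast_ofNat, Nat.cast_one, Nat.cast_zero] at e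
    linear_combination e
  · have e := h 1 (by norm_num) 2 (by norm_num)
    simp only [commCoeff, Nat.reduceAdd, Nat.reduceSub, Nat.reduceLeDiff, and_true, and_false,
      if_true, if_false, true_and, false_and, Nat.cast_ofNat, Nat.cast_one, Nat.cast_zero] at e
    linear_combination e
  · have e := h 0 (by norm_num) 3 (by norm_num)
    simp only [commCoeff, Nat.reduceAdd, Nat.reduceSub, Nat.reduceLeDiff, and_true, and_false,
      if_true, if_false, true_and, false_and, Nat.cast_ofNat, Nat.cast_one, Nat.cast_zero] at e
    linear_combination e
  · have e := h 2 (by norm_num) 0 (by norm_num)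
    simp only [commCoeff, Nat.reduceAdd, Nat.reduceSub, Nat.reduceLeDiff, and_true, and_false,
      if_true, if_false, true_and, false_and, Nat.cast_ofNat, Nat.cast_one, Nat.cast_zero] at e
    linear_combination -e
  · have e := h 1 (by norm_num) 1 (by norm_num)
    simp only [commCoeff, Nat.reduceAdd, Nat.reduceSub, Nat.reduceLeDiff, and_true, and_false,
      if_true, if_false, true_and, false_and, Nat.cast_ofNat, Nat.cast_one, Nat.cast_zero] at e
    linear_combination -e
  · have e := h 0 (by norm_num) 2 (by norm_num)
    simp only [commCoeff, Nat.reduceAdd, Nat.reduceSub, Nat.reduceLeDiff, and_true, and_false,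
      if_true, if_false, true_and, false_and, Nat.cast_ofNat, Nat.cast_one, Nat.cast_zero] at e
    linear_combination -e

variable {Ω : Opens (ℝ × ℝ)} (h0 : (0, 0) ∉ Ω)

lemma derivation_const_mul {R : Type*} [CommRing R] [Algebra ℂ R] (D : Derivation ℂ R R) (c : ℂ)
    (g : R) : D (algebraMap ℂ R c * g) = algebraMap ℂ R c * D g := by
  simp [Derivation.leibniz]

/-- Evaluation at a point. -/
def evalAt (q : Ω) : smoothAlg Ω ℂ →ₐ[ℂ] ℂ :=
  (Pi.evalAlgHom ℂ (fun _ : Ω => ℂ) q).comp (smoothAlg Ω ℂ).val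

lemma smoothAlg_ext_evalAt {f g : smoothAlg Ω ℂ} (h : ∀ q : Ω, evalAt q f = evalAt q g) : f = g :=
  smoothAlg_ext h

set_option maxHeartbeats 800000 in
include h0 in
/-- The determining equations of a quantum integral. -/
lemma HasQuantumIntegral.determining {ħ : ℝ} (hħ : 0 < ħ) {V : ℝ × ℝ → ℝ}
    (hV : ContDiffOn ℝ ∞ V Ω) (h : HasQuantumIntegral ħ Ω V) :
    ∃ g₁ g₂ g₃ g₄ s₁ s₂ s₃ u₁ u₂ : smoothAlg Ω ℂ, ∃ c : smoothAlg Ω ℂ,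
      (d1 ℂ h0 c = 0 ∧ d2 ℂ h0 c = 0) ∧
      ¬ (g₁ = 0 ∧ g₂ = 0 ∧ g₃ = 0 ∧ g₄ = 0) ∧
      IsKilling (d1 ℂ h0) (d2 ℂ h0) g₁ g₂ g₃ g₄ ∧
      (d1 ℂ h0 s₁ = c * (d1 ℂ h0 (d1 ℂ h0 g₁) + d2 ℂ h0 (d2 ℂ h0 g₁)) ∧
        d2 ℂ h0 s₁ + d1 ℂ h0 s₂ = c * (d1 ℂ h0 (d1 ℂ h0 g₂) + d2 ℂ h0 (d2 ℂ h0 g₂)) ∧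
        d2 ℂ h0 s₂ + d1 ℂ h0 s₃ = c * (d1 ℂ h0 (d1 ℂ h0 g₃) + d2 ℂ h0 (d2 ℂ h0 g₃)) ∧
        d2 ℂ h0 s₃ = c * (d1 ℂ h0 (d1 ℂ h0 g₄) + d2 ℂ h0 (d2 ℂ h0 g₄))) ∧
      (3 * g₁ * d1 ℂ h0 (smoothMk (fun q => (V q : ℂ)) (contDiffOn_ofReal hV))
        + g₂ * d2 ℂ h0 (smoothMk (fun q => (V q : ℂ)) (contDiffOn_ofReal hV)) =
          d1 ℂ h0 u₁ + (d1 ℂ h0 (d1 ℂ h0 s₁) + d2 ℂ h0 (d2 ℂ h0 s₁)) ∧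
        2 * (g₂ * d1 ℂ h0 (smoothMk (fun q => (V q : ℂ)) (contDiffOn_ofReal hV))
        + g₃ * d2 ℂ h0 (smoothMk (fun q => (V q : ℂ)) (contDiffOn_ofReal hV))) =
          d2 ℂ h0 u₁ + d1 ℂ h0 u₂ + (d1 ℂ h0 (d1 ℂ h0 s₂) + d2 ℂ h0 (d2 ℂ h0 s₂)) ∧
        g₃ * d1 ℂ h0 (smoothMk (fun q => (V q : ℂ)) (contDiffOn_ofReal hV))
        + 3 * g₄ * d2 ℂ h0 (smoothMk (fun q => (V q : ℂ)) (contDiffOn_ofReal hV)) =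
          d2 ℂ h0 u₂ + (d1 ℂ h0 (d1 ℂ h0 s₃) + d2 ℂ h0 (d2 ℂ h0 s₃))) := by
  obtain ⟨f, hf, ⟨j, k, hjk, q₀, hq₀, hne⟩, hP⟩ := h
  set κ : ℂ := -(Complex.I * ħ) with hκ
  have hκ0 : κ ≠ 0 := by
    simp [hκ, hħ.ne']
  obtain ⟨F, hF⟩ : ∃ F : ℕ → ℕ → smoothAlg Ω ℂ, ∀ j k, j + k ≤ 3 → IsRep (f j k) (F j k) := by
    refine ⟨fun j k => if h : j + k ≤ 3 then smoothMk (f j k) (hf j k h) else 0, fun j k h => ?_⟩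
    simp only [h, dif_pos]
    exact ⟨hf j k h, rfl⟩
  set v : smoothAlg Ω ℂ := smoothMk (fun q => (V q : ℂ)) (contDiffOn_ofReal hV) with hv
  have hvr : IsRep (fun q => (V q : ℂ)) v := ⟨_, rfl⟩
  have hcomm : ∀ ψ : smoothAlg Ω ℂ,
      hamiltonianOp (momentum κ (d1 ℂ h0)) (momentum κ (d2 ℂ h0)) v
        (cubicOp (momentum κ (d1 ℂ h0)) (momentum κ (d2 ℂ h0)) F ψ) =
      cubicOp (momentum κ (d1 ℂ h0)) (momentum κ (d2 ℂ h0)) F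
        (hamiltonianOp (momentum κ (d1 ℂ h0)) (momentum κ (d2 ℂ h0)) v ψ) := by
    intro ψ
    obtain ⟨Ψ, hΨ, rfl⟩ := exists_eq_smoothMk ψ
    have r : IsRep Ψ (smoothMk Ψ hΨ) := ⟨hΨ, rfl⟩
    refine smoothAlg_ext fun q => ?_
    rw [(IsRep.qH h0 ħ hvr (r.qX h0 ħ hF)).apply, ((IsRep.qH h0 ħ hvr r).qX h0 ħ hF).apply]
    exact hP Ψ hΨ q q.2
  -- The eigenfunctions vanish nowhere and can be cancelled at each point `q`, so all coefficients
  -- of the commutator vanish at `q`.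
  have key := fun q : Ω => commCoeff_equations hκ0 (commCoeff_eq_zero (κ := κ) (d1 ℂ h0) (d2 ℂ h0) v F
    (d1_d2_comm h0) (evalAt q) (fun m n => by
      obtain ⟨ψ, hne, h₁, h₂⟩ := exists_eigenfunction h0 hκ0 m n
      exact ⟨ψ, hne q, h₁, h₂, hcomm ψ⟩))
  -- Scaling the second order coefficients by `κ / 2` turns the Laplacian term of the degree two
  -- equations into `Δ sᵢ` and the constant of the degree three equations into `c = -κ² / 4`.
  refine ⟨F 3 0, F 2 1, F 1 2, F 0 3, algebraMap ℂ _ (κ / 2) * F 2 0,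
    algebraMap ℂ _ (κ / 2) * F 1 1, algebraMap ℂ _ (κ / 2) * F 0 2, F 1 0, F 0 1,
    algebraMap ℂ _ (-κ ^ 2 / 4), ⟨Derivation.map_algebraMap _ _, Derivation.map_algebraMap _ _⟩,
    ?_, ⟨?_, ?_, ?_, ?_, ?_⟩, ⟨?_, ?_, ?_, ?_⟩, ?_, ?_, ?_⟩
  · rintro ⟨z₁, z₂, z₃, z₄⟩
    have e₁ : f 3 0 q₀ = 0 := by rw [← (hF 3 0 le_rfl).apply ⟨q₀, hq₀⟩, z₁]; rfl
    have e₂ : f 2 1 q₀ = 0 := by rw [← (hF 2 1 le_rfl).apply ⟨q₀, hq₀⟩, z₂]; rfl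
    have e₃ : f 1 2 q₀ = 0 := by rw [← (hF 1 2 le_rfl).apply ⟨q₀, hq₀⟩, z₃]; rfl
    have e₄ : f 0 3 q₀ = 0 := by rw [← (hF 0 3 le_rfl).apply ⟨q₀, hq₀⟩, z₄]; rfl
    have hj : j ≤ 3 := by omega
    obtain rfl : k = 3 - j := by omega
    interval_cases j <;> contradiction
  · exact smoothAlg_ext_evalAt fun q => by simpa only [map_add (evalAt q), map_zero (evalAt q)] using (key q).1.1
  · exact smoothAlg_ext_evalAt fun q => by simpa only [map_add (evalAt q), map_zero (evalAt q)] using (key q).1.2.1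
  · exact smoothAlg_ext_evalAt fun q => by simpa only [map_add (evalAt q), map_zero (evalAt q)] using (key q).1.2.2.1
  · exact smoothAlg_ext_evalAt fun q => by simpa only [map_add (evalAt q), map_zero (evalAt q)] using (key q).1.2.2.2.1
  · exact smoothAlg_ext_evalAt fun q => by simpa only [map_add (evalAt q), map_zero (evalAt q)] using (key q).1.2.2.2.2
  · refine smoothAlg_ext_evalAt fun q => ?_
    simp only [derivation_const_mul, map_add (evalAt q), map_mul (evalAt q), map_ofNat (evalAt q),
      AlgHom.commutes, Algebra.algebraMap_self, RingHom.id_apply]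
    have e := (key q).2.1.1
    simp only [map_add (evalAt q)] at e
    linear_combination κ / 2 * e
  · refine smoothAlg_ext_evalAt fun q => ?_
    simp only [derivation_const_mul, map_add (evalAt q), map_mul (evalAt q), map_ofNat (evalAt q),
      AlgHom.commutes, Algebra.algebraMap_self, RingHom.id_apply]
    have e := (key q).2.1.2.1
    simp only [map_add (evalAt q)] at e
    linear_combination κ / 2 * e
  · refine smoothAlg_ext_evalAt fun q => ?_
    simp only [derivation_const_mul, map_add (evalAt q), map_mul (evalAt q), map_ofNat (evalAt q),
      AlgHom.commutes, Algebra.algebraMap_self, RingHom.id_apply]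
    have e := (key q).2.1.2.2.1
    simp only [map_add (evalAt q)] at e
    linear_combination κ / 2 * e
  · refine smoothAlg_ext_evalAt fun q => ?_
    simp only [derivation_const_mul, map_add (evalAt q), map_mul (evalAt q), map_ofNat (evalAt q),
      AlgHom.commutes, Algebra.algebraMap_self, RingHom.id_apply]
    have e := (key q).2.1.2.2.2
    simp only [map_add (evalAt q)] at e
    linear_combination κ / 2 * e
  · refine smoothAlg_ext_evalAt fun q => ?_
    simp only [derivation_const_mul, map_add (evalAt q), map_mul (evalAt q), map_ofNat (evalAt q),
      AlgHom.commutes, Algebra.algebraMap_self, RingHom.id_apply]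
    have e := (key q).2.2.1
    simp only [map_add (evalAt q)] at e
    linear_combination e
  · refine smoothAlg_ext_evalAt fun q => ?_
    simp only [derivation_const_mul, map_add (evalAt q), map_mul (evalAt q), map_ofNat (evalAt q),
      AlgHom.commutes, Algebra.algebraMap_self, RingHom.id_apply]
    have e := (key q).2.2.2.1
    simp only [map_add (evalAt q)] at e
    linear_combination e
  · refine smoothAlg_ext_evalAt fun q => ?_
    simp only [derivation_const_mul, map_add (evalAt q), map_mul (evalAt q), map_ofNat (evalAt q),
      AlgHom.commutes, Algebra.algebraMap_self, RingHom.id_apply]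
    have e := (key q).2.2.2.2
    simp only [map_add (evalAt q)] at e
    linear_combination e

include h0 in
/-- A quantum integral gives a solution of the compatibility condition. -/
lemma HasQuantumIntegral.solvesCompatibility (hc : IsPreconnected (Ω : Set (ℝ × ℝ)))
    {ħ : ℝ} (hħ : 0 < ħ) {V : ℝ × ℝ → ℝ}
    (hV : ContDiffOn ℝ ∞ V Ω) (h : HasQuantumIntegral ħ Ω V) : SolvesCompatibility Ω V := by
  obtain ⟨g₁, g₂, g₃, g₄, s₁, s₂, s₃, u₁, u₂, c, ⟨hc₁, hc₂⟩, hne, hg, ⟨h₁, h₂, h₃, h₄⟩,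
    e₁, e₂, e₃⟩ := h.determining h0 hħ hV
  let a : smoothAlg Ω ℂ →+ smoothAlg Ω ℂ := (d1 ℂ h0 : _ →ₗ[ℂ] _).toAddMonoidHom
  let b : smoothAlg Ω ℂ →+ smoothAlg Ω ℂ := (d2 ℂ h0 : _ →ₗ[ℂ] _).toAddMonoidHom
  have hab : ∀ f, a (b f) = b (a f) := fun f => d1_d2_comm h0 f
  have z₁ := compatOp_eq_zero hab u₁ u₂
  have z₂ := compatOp_laplace_eq_zero hab (AddMonoidHom.mulLeft c)
    (fun f => by
      change c * d1 ℂ h0 f = d1 ℂ h0 (c * f)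
      rw [Derivation.leibniz, hc₁]; simp)
    (fun f => by
      change c * d2 ℂ h0 f = d2 ℂ h0 (c * f)
      rw [Derivation.leibniz, hc₂]; simp) hg h₁ h₂ h₃ h₄
  -- By additivity the expression splits into the part coming from `u₁, u₂` and the Laplacian part;
  -- both are zero.
  have hC : compatExpr h0 g₁ g₂ g₃ g₄
      (smoothMk (fun q => (V q : ℂ)) (contDiffOn_ofReal hV)) = 0 := by
    rw [compatExpr, e₁, e₂, e₃]
    refine Eq.trans ?_ ((congrArg₂ (· + ·) z₁ z₂).trans (add_zero 0))
    change compatOp (d1 ℂ h0) (d2 ℂ h0) _ _ _ = d2 ℂ h0 (d2 ℂ h0 (d1 ℂ h0 u₁)) - d1 ℂ h0 (d2 ℂ h0 (d2 ℂ h0 u₁ + d1 ℂ h0 u₂))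
      + d1 ℂ h0 (d1 ℂ h0 (d2 ℂ h0 u₂)) + (d2 ℂ h0 (d2 ℂ h0 (d1 ℂ h0 (d1 ℂ h0 s₁) + d2 ℂ h0 (d2 ℂ h0 s₁)))
      - d1 ℂ h0 (d2 ℂ h0 (d1 ℂ h0 (d1 ℂ h0 s₂) + d2 ℂ h0 (d2 ℂ h0 s₂)))
      + d1 ℂ h0 (d1 ℂ h0 (d1 ℂ h0 (d1 ℂ h0 s₃) + d2 ℂ h0 (d2 ℂ h0 s₃))))
    simp only [compatOp, map_add]
    ring
  -- The real and the imaginary parts of the leading coefficients both solve the equations, and at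
  -- least one of the two is nonzero.
  have hL : ∀ L : ℂ →L[ℝ] ℝ, ¬ (realPart L g₁ = 0 ∧ realPart L g₂ = 0 ∧ realPart L g₃ = 0 ∧
      realPart L g₄ = 0) → SolvesCompatibility Ω V := fun L hn =>
    solvesCompatibility_of_isKilling h0 hc hV (hg.realPart h0 L) hn
      (by rw [← realPart_compatExpr, hC, map_zero])
  by_contra hS
  have t₁ := not_not.1 (mt (hL Complex.reCLM) hS)
  have t₂ := not_not.1 (mt (hL Complex.imCLM) hS)
  have ext : ∀ g : smoothAlg Ω ℂ, realPart Complex.reCLM g = 0 → realPart Complex.imCLM g = 0 →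
      g = 0 := fun g hr hi => smoothAlg_ext fun q =>
    Complex.ext (congrFun (congrArg Subtype.val hr) q) (congrFun (congrArg Subtype.val hi) q)
  exact hne ⟨ext _ t₁.1 t₂.1, ext _ t₁.2.1 t₂.2.1, ext _ t₁.2.2.1 t₂.2.2.1,
    ext _ t₁.2.2.2 t₂.2.2.2⟩

end Parabolic
end

/-! ### The compatibility condition in parabolic coordinates: numerators and jets. -/

noncomputable section
namespace Parabolic
open TopologicalSpace

/-- The contribution of one of the constants to `compatPoly`. -/
def compatTerm300 {R : Type*} [CommRing R] (x y : R) (w : ℕ → R) : R :=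
  (x ^ 2 + y ^ 2) ^ 6 * ((-45 * y) * w 1
    + (-27 * x * y) * w 2
    + (-3 * x ^ 2 * y) * w 3)

/-- The contribution of one of the constants to `compatPoly`. -/
def compatTerm210 {R : Type*} [CommRing R] (x y : R) (w : ℕ → R) : R :=
  (x ^ 2 + y ^ 2) ^ 4 * ((6 * x ^ 3 - 18 * x * y ^ 2) * w 1
    + (10 * x ^ 4 + 18 * x ^ 2 * y ^ 2 + 16 * y ^ 4) * w 2
    + (2 * x ^ 5 + 6 * x ^ 3 * y ^ 2 + 4 * x * y ^ 4) * w 3)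

/-- The contribution of one of the constants to `compatPoly`. -/
def compatTerm201 {R : Type*} [CommRing R] (x y : R) (w : ℕ → R) : R :=
  (x ^ 2 + y ^ 2) ^ 4 * ((18 * x ^ 2 * y - 6 * y ^ 3) * w 1
    + (-2 * x ^ 3 * y - 10 * x * y ^ 3) * w 2
    + (-2 * x ^ 4 * y - 2 * x ^ 2 * y ^ 3) * w 3)

/-- The contribution of one of the constants to `compatPoly`. -/
def compatTerm120 {R : Type*} [CommRing R] (x y : R) (w : ℕ → R) : R :=
  (x ^ 2 + y ^ 2) ^ 2 * ((-60 * x ^ 4 * y + 120 * x ^ 2 * y ^ 3 - 12 * y ^ 5) * w 1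
    + (44 * x ^ 5 * y + 40 * x ^ 3 * y ^ 3 - 4 * x * y ^ 5) * w 2
    + (-8 * x ^ 6 * y - 20 * x ^ 4 * y ^ 3 - 16 * x ^ 2 * y ^ 5 - 4 * y ^ 7) * w 3)

/-- The contribution of one of the constants to `compatPoly`. -/
def compatTerm111 {R : Type*} [CommRing R] (x y : R) (w : ℕ → R) : R :=
  (x ^ 2 + y ^ 2) ^ 2 * ((12 * x ^ 5 - 120 * x ^ 3 * y ^ 2 + 60 * x * y ^ 4) * w 1
    + (-12 * x ^ 6 + 24 * x ^ 4 * y ^ 2 + 36 * x ^ 2 * y ^ 4) * w 2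
    + (4 * x ^ 7 + 8 * x ^ 5 * y ^ 2 + 4 * x ^ 3 * y ^ 4) * w 3)

/-- The contribution of one of the constants to `compatPoly`. -/
def compatTerm102 {R : Type*} [CommRing R] (x y : R) (w : ℕ → R) : R :=
  (x ^ 2 + y ^ 2) ^ 2 * ((60 * x ^ 4 * y - 120 * x ^ 2 * y ^ 3 + 12 * y ^ 5) * w 1
    + (-28 * x ^ 5 * y - 8 * x ^ 3 * y ^ 3 + 20 * x * y ^ 5) * w 2
    + (4 * x ^ 6 * y + 8 * x ^ 4 * y ^ 3 + 4 * x ^ 2 * y ^ 5) * w 3)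

/-- The contribution of one of the constants to `compatPoly`. -/
def compatTerm030 {R : Type*} [CommRing R] (x y : R) (w : ℕ → R) : R :=
  ((576 * x ^ 6 - 10944 * x ^ 4 * y ^ 2 + 10944 * x ^ 2 * y ^ 4 - 576 * y ^ 6) * w 0
    + (-216 * x ^ 7 + 3384 * x ^ 5 * y ^ 2 + 1656 * x ^ 3 * y ^ 4 - 1944 * x * y ^ 6) * w 1
    + (24 * x ^ 8 - 408 * x ^ 6 * y ^ 2 - 792 * x ^ 4 * y ^ 4 - 264 * x ^ 2 * y ^ 6 + 96 * y ^ 8) * w 2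
    + (24 * x ^ 7 * y ^ 2 + 72 * x ^ 5 * y ^ 4 + 72 * x ^ 3 * y ^ 6 + 24 * x * y ^ 8) * w 3)

/-- The contribution of one of the constants to `compatPoly`. -/
def compatTerm021 {R : Type*} [CommRing R] (x y : R) (w : ℕ → R) : R :=
  ((4224 * x ^ 5 * y - 14592 * x ^ 3 * y ^ 3 + 4224 * x * y ^ 5) * w 0
    + (-1704 * x ^ 6 * y + 1992 * x ^ 4 * y ^ 3 + 3336 * x ^ 2 * y ^ 5 - 360 * y ^ 7) * w 1
    + (264 * x ^ 7 * y + 216 * x ^ 5 * y ^ 3 - 360 * x ^ 3 * y ^ 5 - 312 * x * y ^ 7) * w 2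
    + (-16 * x ^ 8 * y - 40 * x ^ 6 * y ^ 3 - 24 * x ^ 4 * y ^ 5 + 8 * x ^ 2 * y ^ 7 + 8 * y ^ 9) * w 3)

/-- The contribution of one of the constants to `compatPoly`. -/
def compatTerm012 {R : Type*} [CommRing R] (x y : R) (w : ℕ → R) : R :=
  ((-768 * x ^ 6 + 10752 * x ^ 4 * y ^ 2 - 10752 * x ^ 2 * y ^ 4 + 768 * y ^ 6) * w 0
    + (408 * x ^ 7 - 3192 * x ^ 5 * y ^ 2 - 1848 * x ^ 3 * y ^ 4 + 1752 * x * y ^ 6) * w 1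
    + (-88 * x ^ 8 + 248 * x ^ 6 * y ^ 2 + 696 * x ^ 4 * y ^ 4 + 296 * x ^ 2 * y ^ 6 - 64 * y ^ 8) * w 2
    + (8 * x ^ 9 + 8 * x ^ 7 * y ^ 2 - 24 * x ^ 5 * y ^ 4 - 40 * x ^ 3 * y ^ 6 - 16 * x * y ^ 8) * w 3)

/-- The contribution of one of the constants to `compatPoly`. -/
def compatTerm003 {R : Type*} [CommRing R] (x y : R) (w : ℕ → R) : R :=
  ((-4608 * x ^ 5 * y + 13824 * x ^ 3 * y ^ 3 - 4608 * x * y ^ 5) * w 0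
    + (2088 * x ^ 6 * y - 1224 * x ^ 4 * y ^ 3 - 2952 * x ^ 2 * y ^ 5 + 360 * y ^ 7) * w 1
    + (-360 * x ^ 7 * y - 504 * x ^ 5 * y ^ 3 + 72 * x ^ 3 * y ^ 5 + 216 * x * y ^ 7) * w 2
    + (24 * x ^ 8 * y + 72 * x ^ 6 * y ^ 3 + 72 * x ^ 4 * y ^ 5 + 24 * x ^ 2 * y ^ 7) * w 3)

/-- The part of the compatibility condition that is linear in one of the two functions of one
variable, with denominators cleared. -/
def compatPoly {R : Type*} [CommRing R] (A : ℕ → ℕ → ℕ → R) (x y : R) (w : ℕ → R) : R :=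
  A 3 0 0 * compatTerm300 x y w + A 2 1 0 * compatTerm210 x y w
    + A 2 0 1 * compatTerm201 x y w + A 1 2 0 * compatTerm120 x y w
    + A 1 1 1 * compatTerm111 x y w + A 1 0 2 * compatTerm102 x y w
    + A 0 3 0 * compatTerm030 x y w + A 0 2 1 * compatTerm021 x y w
    + A 0 1 2 * compatTerm012 x y w + A 0 0 3 * compatTerm003 x y w

/-- The effect of the reflection exchanging the coordinates `ξ` and `η`. -/
def reflectCoeff {R : Type*} [CommRing R] (A : ℕ → ℕ → ℕ → R) (j k l : ℕ) : R :=
  (-1) ^ (j + k) * A j k l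

section Jets

variable {R : Type*} [CommRing R] [Algebra ℝ R]

/-- The derivation rules for parabolic coordinates `X`, `Y`, `r = 1 / (X² + Y²)` and jets `u`, `v`
of functions of one coordinate. -/
structure IsParabolic (a b : Derivation ℝ R R) (X Y r : R) (u v : ℕ → R) : Prop where
  comm : ∀ f, a (b f) = b (a f)
  aX : a X = r * X
  aY : a Y = -(r * Y)
  bX : b X = r * Y
  bY : b Y = r * X
  ar : a r = -(2 * r ^ 3 * (X ^ 2 - Y ^ 2))
  br : b r = -(4 * r ^ 3 * (X * Y))
  au : ∀ k, a (u k) = r * X * u (k + 1)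
  av : ∀ k, a (v k) = -(r * Y * v (k + 1))
  bu : ∀ k, b (u k) = r * Y * u (k + 1)
  bv : ∀ k, b (v k) = r * X * v (k + 1)

/-- The coefficients of the derivatives of `V` separate from those derivatives. The explicit
polynomials on the left of `compatTerm300_eq` and its companions are these coefficients for a single
nonzero constant. -/
lemma compatOp_expand {a b : Derivation ℝ R R} (hab : ∀ f, a (b f) = b (a f))
    (g₁ g₂ g₃ g₄ V : R) :
    compatOp a b (3 * g₁ * a V + g₂ * b V) (2 * (g₂ * a V + g₃ * b V)) (g₃ * a V + 3 * g₄ * b V) =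
      g₃ * a (a (a V)) + (3 * g₄ - 2 * g₂) * b (a (a V)) + (3 * g₁ - 2 * g₃) * b (b (a V))
      + g₂ * b (b (b V)) + (2 * a g₃ - 2 * b g₂) * a (a V)
      + (6 * b g₁ - 2 * a g₂ - 2 * b g₃ + 6 * a g₄) * b (a V) + (2 * b g₂ - 2 * a g₃) * b (b V)
      + (3 * b (b g₁) - 2 * b (a g₂) + a (a g₃)) * a V
      + (b (b g₂) - 2 * b (a g₃) + 3 * a (a g₄)) * b V := by
  obtain ⟨a2, a3⟩ := derivation_two_three a
  obtain ⟨b2, b3⟩ := derivation_two_three b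
  simp only [compatOp, map_add, Derivation.leibniz, smul_eq_mul, a2, a3, b2, b3, hab, mul_zero,
    add_zero]
  ring

variable {a b : Derivation ℝ R R} {X Y r : R} {u v : ℕ → R}

/-- Numerator of a derivative of the potential. -/
def jetNum1 {R : Type*} [CommRing R] (X Y : R) (u v : ℕ → R) : R :=
  (-2 * X ^ 2 + 2 * Y ^ 2) * u 0
        + (X ^ 3 + X * Y ^ 2) * u 1
        + (-2 * X ^ 2 + 2 * Y ^ 2) * v 0
        + (-X ^ 2 * Y - Y ^ 3) * v 1

/-- Numerator of a derivative of the potential. -/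
def jetNum2 {R : Type*} [CommRing R] (X Y : R) (u v : ℕ → R) : R :=
  (-4 * X * Y) * u 0
        + (X ^ 2 * Y + Y ^ 3) * u 1
        + (-4 * X * Y) * v 0
        + (X ^ 3 + X * Y ^ 2) * v 1

/-- Numerator of a derivative of the potential. -/
def jetNum11 {R : Type*} [CommRing R] (X Y : R) (u v : ℕ → R) : R :=
  (8 * X ^ 4 - 32 * X ^ 2 * Y ^ 2 + 8 * Y ^ 4) * u 0
        + (-5 * X ^ 5 + 2 * X ^ 3 * Y ^ 2 + 7 * X * Y ^ 4) * u 1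
        + (X ^ 6 + 2 * X ^ 4 * Y ^ 2 + X ^ 2 * Y ^ 4) * u 2
        + (8 * X ^ 4 - 32 * X ^ 2 * Y ^ 2 + 8 * Y ^ 4) * v 0
        + (7 * X ^ 4 * Y + 2 * X ^ 2 * Y ^ 3 - 5 * Y ^ 5) * v 1
        + (X ^ 4 * Y ^ 2 + 2 * X ^ 2 * Y ^ 4 + Y ^ 6) * v 2

/-- Numerator of a derivative of the potential. -/
def jetNum12 {R : Type*} [CommRing R] (X Y : R) (u v : ℕ → R) : R :=
  (24 * X ^ 3 * Y - 24 * X * Y ^ 3) * u 0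
        + (-9 * X ^ 4 * Y - 6 * X ^ 2 * Y ^ 3 + 3 * Y ^ 5) * u 1
        + (X ^ 5 * Y + 2 * X ^ 3 * Y ^ 3 + X * Y ^ 5) * u 2
        + (24 * X ^ 3 * Y - 24 * X * Y ^ 3) * v 0
        + (-3 * X ^ 5 + 6 * X ^ 3 * Y ^ 2 + 9 * X * Y ^ 4) * v 1
        + (-X ^ 5 * Y - 2 * X ^ 3 * Y ^ 3 - X * Y ^ 5) * v 2

/-- Numerator of a derivative of the potential. -/
def jetNum22 {R : Type*} [CommRing R] (X Y : R) (u v : ℕ → R) : R :=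
  (-4 * X ^ 4 + 40 * X ^ 2 * Y ^ 2 - 4 * Y ^ 4) * u 0
        + (X ^ 5 - 10 * X ^ 3 * Y ^ 2 - 11 * X * Y ^ 4) * u 1
        + (X ^ 4 * Y ^ 2 + 2 * X ^ 2 * Y ^ 4 + Y ^ 6) * u 2
        + (-4 * X ^ 4 + 40 * X ^ 2 * Y ^ 2 - 4 * Y ^ 4) * v 0
        + (-11 * X ^ 4 * Y - 10 * X ^ 2 * Y ^ 3 + Y ^ 5) * v 1
        + (X ^ 6 + 2 * X ^ 4 * Y ^ 2 + X ^ 2 * Y ^ 4) * v 2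

/-- Numerator of a derivative of the potential. -/
def jetNum111 {R : Type*} [CommRing R] (X Y : R) (u v : ℕ → R) : R :=
  (-48 * X ^ 6 + 432 * X ^ 4 * Y ^ 2 - 432 * X ^ 2 * Y ^ 4 + 48 * Y ^ 6) * u 0
        + (33 * X ^ 7 - 117 * X ^ 5 * Y ^ 2 - 93 * X ^ 3 * Y ^ 4 + 57 * X * Y ^ 6) * u 1
        + (-9 * X ^ 8 - 3 * X ^ 6 * Y ^ 2 + 21 * X ^ 4 * Y ^ 4 + 15 * X ^ 2 * Y ^ 6) * u 2
        + (X ^ 9 + 3 * X ^ 7 * Y ^ 2 + 3 * X ^ 5 * Y ^ 4 + X ^ 3 * Y ^ 6) * u 3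
        + (-48 * X ^ 6 + 432 * X ^ 4 * Y ^ 2 - 432 * X ^ 2 * Y ^ 4 + 48 * Y ^ 6) * v 0
        + (-57 * X ^ 6 * Y + 93 * X ^ 4 * Y ^ 3 + 117 * X ^ 2 * Y ^ 5 - 33 * Y ^ 7) * v 1
        + (-15 * X ^ 6 * Y ^ 2 - 21 * X ^ 4 * Y ^ 4 + 3 * X ^ 2 * Y ^ 6 + 9 * Y ^ 8) * v 2
        + (-X ^ 6 * Y ^ 3 - 3 * X ^ 4 * Y ^ 5 - 3 * X ^ 2 * Y ^ 7 - Y ^ 9) * v 3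

/-- Numerator of a derivative of the potential. -/
def jetNum112 {R : Type*} [CommRing R] (X Y : R) (u v : ℕ → R) : R :=
  (-192 * X ^ 5 * Y + 576 * X ^ 3 * Y ^ 3 - 192 * X * Y ^ 5) * u 0
        + (87 * X ^ 6 * Y - 51 * X ^ 4 * Y ^ 3 - 123 * X ^ 2 * Y ^ 5 + 15 * Y ^ 7) * u 1
        + (-15 * X ^ 7 * Y - 21 * X ^ 5 * Y ^ 3 + 3 * X ^ 3 * Y ^ 5 + 9 * X * Y ^ 7) * u 2
        + (X ^ 8 * Y + 3 * X ^ 6 * Y ^ 3 + 3 * X ^ 4 * Y ^ 5 + X ^ 2 * Y ^ 7) * u 3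
        + (-192 * X ^ 5 * Y + 576 * X ^ 3 * Y ^ 3 - 192 * X * Y ^ 5) * v 0
        + (15 * X ^ 7 - 123 * X ^ 5 * Y ^ 2 - 51 * X ^ 3 * Y ^ 4 + 87 * X * Y ^ 6) * v 1
        + (9 * X ^ 7 * Y + 3 * X ^ 5 * Y ^ 3 - 21 * X ^ 3 * Y ^ 5 - 15 * X * Y ^ 7) * v 2
        + (X ^ 7 * Y ^ 2 + 3 * X ^ 5 * Y ^ 4 + 3 * X ^ 3 * Y ^ 6 + X * Y ^ 8) * v 3

/-- Numerator of a derivative of the potential. -/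
def jetNum122 {R : Type*} [CommRing R] (X Y : R) (u v : ℕ → R) : R :=
  (24 * X ^ 6 - 456 * X ^ 4 * Y ^ 2 + 456 * X ^ 2 * Y ^ 4 - 24 * Y ^ 6) * u 0
        + (-9 * X ^ 7 + 141 * X ^ 5 * Y ^ 2 + 69 * X ^ 3 * Y ^ 4 - 81 * X * Y ^ 6) * u 1
        + (X ^ 8 - 17 * X ^ 6 * Y ^ 2 - 33 * X ^ 4 * Y ^ 4 - 11 * X ^ 2 * Y ^ 6 + 4 * Y ^ 8) * u 2
        + (X ^ 7 * Y ^ 2 + 3 * X ^ 5 * Y ^ 4 + 3 * X ^ 3 * Y ^ 6 + X * Y ^ 8) * u 3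
        + (24 * X ^ 6 - 456 * X ^ 4 * Y ^ 2 + 456 * X ^ 2 * Y ^ 4 - 24 * Y ^ 6) * v 0
        + (81 * X ^ 6 * Y - 69 * X ^ 4 * Y ^ 3 - 141 * X ^ 2 * Y ^ 5 + 9 * Y ^ 7) * v 1
        + (-4 * X ^ 8 + 11 * X ^ 6 * Y ^ 2 + 33 * X ^ 4 * Y ^ 4 + 17 * X ^ 2 * Y ^ 6 - Y ^ 8) * v 2
        + (-X ^ 8 * Y - 3 * X ^ 6 * Y ^ 3 - 3 * X ^ 4 * Y ^ 5 - X ^ 2 * Y ^ 7) * v 3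

/-- Numerator of a derivative of the potential. -/
def jetNum222 {R : Type*} [CommRing R] (X Y : R) (u v : ℕ → R) : R :=
  (144 * X ^ 5 * Y - 672 * X ^ 3 * Y ^ 3 + 144 * X * Y ^ 5) * u 0
        + (-39 * X ^ 6 * Y + 147 * X ^ 4 * Y ^ 3 + 171 * X ^ 2 * Y ^ 5 - 15 * Y ^ 7) * u 1
        + (3 * X ^ 7 * Y - 15 * X ^ 5 * Y ^ 3 - 39 * X ^ 3 * Y ^ 5 - 21 * X * Y ^ 7) * u 2
        + (X ^ 6 * Y ^ 3 + 3 * X ^ 4 * Y ^ 5 + 3 * X ^ 2 * Y ^ 7 + Y ^ 9) * u 3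
        + (144 * X ^ 5 * Y - 672 * X ^ 3 * Y ^ 3 + 144 * X * Y ^ 5) * v 0
        + (-15 * X ^ 7 + 171 * X ^ 5 * Y ^ 2 + 147 * X ^ 3 * Y ^ 4 - 39 * X * Y ^ 6) * v 1
        + (-21 * X ^ 7 * Y - 39 * X ^ 5 * Y ^ 3 - 15 * X ^ 3 * Y ^ 5 + 3 * X * Y ^ 7) * v 2
        + (X ^ 9 + 3 * X ^ 7 * Y ^ 2 + 3 * X ^ 5 * Y ^ 4 + X ^ 3 * Y ^ 6) * v 3

/-- Each Cartesian derivative costs two factors of `ξ² + η²`: one from its own prefactor and one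
from differentiating the denominator. Hence the exponents 3, 5 and 7 for orders one, two and three
in this and the following lemmas. -/
lemma IsParabolic.jet1 (h : IsParabolic a b X Y r u v) (φ : R →+* ℝ)
    (hr : φ r * (φ X ^ 2 + φ Y ^ 2) = 1) :
    (φ X ^ 2 + φ Y ^ 2) ^ 3 * φ (a (r * (u 0 + v 0))) =
      jetNum1 (φ X) (φ Y) (fun i => φ (u i)) (fun i => φ (v i)) := by
  obtain ⟨a2, a3⟩ := derivation_two_three a
  obtain ⟨b2, b3⟩ := derivation_two_three b
  have a4 : a 4 = 0 := by simpa using a.map_natCast 4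
  have b4 : b 4 = 0 := by simpa using b.map_natCast 4
  simp only [h.comm, h.aX, h.aY, h.bX, h.bY, h.ar, h.br, h.au, h.av, h.bu, h.bv, map_add, map_sub, map_neg,
    Derivation.leibniz, Derivation.leibniz_pow, smul_eq_mul, nsmul_eq_mul, a2, b2, a3, b3, a4, b4,
    Nat.cast_ofNat, Derivation.map_natCast, mul_zero,
    add_zero, Nat.reduceSub, Nat.reduceAdd, map_mul, map_pow, map_ofNat, map_natCast, jetNum1]
  have hne : φ X ^ 2 + φ Y ^ 2 ≠ 0 := right_ne_zero_of_mul_eq_one hr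
  rw [eq_one_div_of_mul_eq_one_left hr]
  field_simp
  ring

lemma IsParabolic.jet2 (h : IsParabolic a b X Y r u v) (φ : R →+* ℝ)
    (hr : φ r * (φ X ^ 2 + φ Y ^ 2) = 1) :
    (φ X ^ 2 + φ Y ^ 2) ^ 3 * φ (b (r * (u 0 + v 0))) =
      jetNum2 (φ X) (φ Y) (fun i => φ (u i)) (fun i => φ (v i)) := by
  obtain ⟨a2, a3⟩ := derivation_two_three a
  obtain ⟨b2, b3⟩ := derivation_two_three b
  have a4 : a 4 = 0 := by simpa using a.map_natCast 4
  have b4 : b 4 = 0 := by simpa using b.map_natCast 4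
  simp only [h.comm, h.aX, h.aY, h.bX, h.bY, h.ar, h.br, h.au, h.av, h.bu, h.bv, map_add, map_sub, map_neg,
    Derivation.leibniz, Derivation.leibniz_pow, smul_eq_mul, nsmul_eq_mul, a2, b2, a3, b3, a4, b4,
    Nat.cast_ofNat, Derivation.map_natCast, mul_zero,
    add_zero, Nat.reduceSub, Nat.reduceAdd, map_mul, map_pow, map_ofNat, map_natCast, jetNum2]
  have hne : φ X ^ 2 + φ Y ^ 2 ≠ 0 := right_ne_zero_of_mul_eq_one hr
  rw [eq_one_div_of_mul_eq_one_left hr]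
  field_simp
  ring

lemma IsParabolic.jet11 (h : IsParabolic a b X Y r u v) (φ : R →+* ℝ)
    (hr : φ r * (φ X ^ 2 + φ Y ^ 2) = 1) :
    (φ X ^ 2 + φ Y ^ 2) ^ 5 * φ (a (a (r * (u 0 + v 0)))) =
      jetNum11 (φ X) (φ Y) (fun i => φ (u i)) (fun i => φ (v i)) := by
  obtain ⟨a2, a3⟩ := derivation_two_three a
  obtain ⟨b2, b3⟩ := derivation_two_three b
  have a4 : a 4 = 0 := by simpa using a.map_natCast 4
  have b4 : b 4 = 0 := by simpa using b.map_natCast 4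
  simp only [h.comm, h.aX, h.aY, h.bX, h.bY, h.ar, h.br, h.au, h.av, h.bu, h.bv, map_add, map_sub, map_neg,
    Derivation.leibniz, Derivation.leibniz_pow, smul_eq_mul, nsmul_eq_mul, a2, b2, a3, b3, a4, b4,
    Nat.cast_ofNat, Derivation.map_natCast, mul_zero,
    add_zero, Nat.reduceSub, Nat.reduceAdd, map_mul, map_pow, map_ofNat, map_natCast, jetNum11]
  have hne : φ X ^ 2 + φ Y ^ 2 ≠ 0 := right_ne_zero_of_mul_eq_one hr
  rw [eq_one_div_of_mul_eq_one_left hr]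
  field_simp
  ring

lemma IsParabolic.jet12 (h : IsParabolic a b X Y r u v) (φ : R →+* ℝ)
    (hr : φ r * (φ X ^ 2 + φ Y ^ 2) = 1) :
    (φ X ^ 2 + φ Y ^ 2) ^ 5 * φ (b (a (r * (u 0 + v 0)))) =
      jetNum12 (φ X) (φ Y) (fun i => φ (u i)) (fun i => φ (v i)) := by
  obtain ⟨a2, a3⟩ := derivation_two_three a
  obtain ⟨b2, b3⟩ := derivation_two_three b
  have a4 : a 4 = 0 := by simpa using a.map_natCast 4
  have b4 : b 4 = 0 := by simpa using b.map_natCast 4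
  simp only [h.comm, h.aX, h.aY, h.bX, h.bY, h.ar, h.br, h.au, h.av, h.bu, h.bv, map_add, map_sub, map_neg,
    Derivation.leibniz, Derivation.leibniz_pow, smul_eq_mul, nsmul_eq_mul, a2, b2, a3, b3, a4, b4,
    Nat.cast_ofNat, Derivation.map_natCast, mul_zero,
    add_zero, Nat.reduceSub, Nat.reduceAdd, map_mul, map_pow, map_ofNat, map_natCast, jetNum12]
  have hne : φ X ^ 2 + φ Y ^ 2 ≠ 0 := right_ne_zero_of_mul_eq_one hr
  rw [eq_one_div_of_mul_eq_one_left hr]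
  field_simp
  ring

lemma IsParabolic.jet22 (h : IsParabolic a b X Y r u v) (φ : R →+* ℝ)
    (hr : φ r * (φ X ^ 2 + φ Y ^ 2) = 1) :
    (φ X ^ 2 + φ Y ^ 2) ^ 5 * φ (b (b (r * (u 0 + v 0)))) =
      jetNum22 (φ X) (φ Y) (fun i => φ (u i)) (fun i => φ (v i)) := by
  obtain ⟨a2, a3⟩ := derivation_two_three a
  obtain ⟨b2, b3⟩ := derivation_two_three b
  have a4 : a 4 = 0 := by simpa using a.map_natCast 4
  have b4 : b 4 = 0 := by simpa using b.map_natCast 4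
  simp only [h.comm, h.aX, h.aY, h.bX, h.bY, h.ar, h.br, h.au, h.av, h.bu, h.bv, map_add, map_sub, map_neg,
    Derivation.leibniz, Derivation.leibniz_pow, smul_eq_mul, nsmul_eq_mul, a2, b2, a3, b3, a4, b4,
    Nat.cast_ofNat, Derivation.map_natCast, mul_zero,
    add_zero, Nat.reduceSub, Nat.reduceAdd, map_mul, map_pow, map_ofNat, map_natCast, jetNum22]
  have hne : φ X ^ 2 + φ Y ^ 2 ≠ 0 := right_ne_zero_of_mul_eq_one hr
  rw [eq_one_div_of_mul_eq_one_left hr]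
  field_simp
  ring

lemma IsParabolic.jet111 (h : IsParabolic a b X Y r u v) (φ : R →+* ℝ)
    (hr : φ r * (φ X ^ 2 + φ Y ^ 2) = 1) :
    (φ X ^ 2 + φ Y ^ 2) ^ 7 * φ (a (a (a (r * (u 0 + v 0))))) =
      jetNum111 (φ X) (φ Y) (fun i => φ (u i)) (fun i => φ (v i)) := by
  obtain ⟨a2, a3⟩ := derivation_two_three a
  obtain ⟨b2, b3⟩ := derivation_two_three b
  have a4 : a 4 = 0 := by simpa using a.map_natCast 4
  have b4 : b 4 = 0 := by simpa using b.map_natCast 4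
  simp only [h.comm, h.aX, h.aY, h.bX, h.bY, h.ar, h.br, h.au, h.av, h.bu, h.bv, map_add, map_sub, map_neg,
    Derivation.leibniz, Derivation.leibniz_pow, smul_eq_mul, nsmul_eq_mul, a2, b2, a3, b3, a4, b4,
    Nat.cast_ofNat, Derivation.map_natCast, mul_zero,
    add_zero, Nat.reduceSub, Nat.reduceAdd, map_mul, map_pow, map_ofNat, map_natCast, jetNum111]
  have hne : φ X ^ 2 + φ Y ^ 2 ≠ 0 := right_ne_zero_of_mul_eq_one hr
  rw [eq_one_div_of_mul_eq_one_left hr]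
  field_simp
  ring

lemma IsParabolic.jet112 (h : IsParabolic a b X Y r u v) (φ : R →+* ℝ)
    (hr : φ r * (φ X ^ 2 + φ Y ^ 2) = 1) :
    (φ X ^ 2 + φ Y ^ 2) ^ 7 * φ (b (a (a (r * (u 0 + v 0))))) =
      jetNum112 (φ X) (φ Y) (fun i => φ (u i)) (fun i => φ (v i)) := by
  obtain ⟨a2, a3⟩ := derivation_two_three a
  obtain ⟨b2, b3⟩ := derivation_two_three b
  have a4 : a 4 = 0 := by simpa using a.map_natCast 4
  have b4 : b 4 = 0 := by simpa using b.map_natCast 4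
  simp only [h.comm, h.aX, h.aY, h.bX, h.bY, h.ar, h.br, h.au, h.av, h.bu, h.bv, map_add, map_sub, map_neg,
    Derivation.leibniz, Derivation.leibniz_pow, smul_eq_mul, nsmul_eq_mul, a2, b2, a3, b3, a4, b4,
    Nat.cast_ofNat, Derivation.map_natCast, mul_zero,
    add_zero, Nat.reduceSub, Nat.reduceAdd, map_mul, map_pow, map_ofNat, map_natCast, jetNum112]
  have hne : φ X ^ 2 + φ Y ^ 2 ≠ 0 := right_ne_zero_of_mul_eq_one hr
  rw [eq_one_div_of_mul_eq_one_left hr]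
  field_simp
  ring

lemma IsParabolic.jet122 (h : IsParabolic a b X Y r u v) (φ : R →+* ℝ)
    (hr : φ r * (φ X ^ 2 + φ Y ^ 2) = 1) :
    (φ X ^ 2 + φ Y ^ 2) ^ 7 * φ (b (b (a (r * (u 0 + v 0))))) =
      jetNum122 (φ X) (φ Y) (fun i => φ (u i)) (fun i => φ (v i)) := by
  obtain ⟨a2, a3⟩ := derivation_two_three a
  obtain ⟨b2, b3⟩ := derivation_two_three b
  have a4 : a 4 = 0 := by simpa using a.map_natCast 4
  have b4 : b 4 = 0 := by simpa using b.map_natCast 4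
  simp only [h.comm, h.aX, h.aY, h.bX, h.bY, h.ar, h.br, h.au, h.av, h.bu, h.bv, map_add, map_sub, map_neg,
    Derivation.leibniz, Derivation.leibniz_pow, smul_eq_mul, nsmul_eq_mul, a2, b2, a3, b3, a4, b4,
    Nat.cast_ofNat, Derivation.map_natCast, mul_zero,
    add_zero, Nat.reduceSub, Nat.reduceAdd, map_mul, map_pow, map_ofNat, map_natCast, jetNum122]
  have hne : φ X ^ 2 + φ Y ^ 2 ≠ 0 := right_ne_zero_of_mul_eq_one hr
  rw [eq_one_div_of_mul_eq_one_left hr]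
  field_simp
  ring

lemma IsParabolic.jet222 (h : IsParabolic a b X Y r u v) (φ : R →+* ℝ)
    (hr : φ r * (φ X ^ 2 + φ Y ^ 2) = 1) :
    (φ X ^ 2 + φ Y ^ 2) ^ 7 * φ (b (b (b (r * (u 0 + v 0))))) =
      jetNum222 (φ X) (φ Y) (fun i => φ (u i)) (fun i => φ (v i)) := by
  obtain ⟨a2, a3⟩ := derivation_two_three a
  obtain ⟨b2, b3⟩ := derivation_two_three b
  have a4 : a 4 = 0 := by simpa using a.map_natCast 4
  have b4 : b 4 = 0 := by simpa using b.map_natCast 4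
  simp only [h.comm, h.aX, h.aY, h.bX, h.bY, h.ar, h.br, h.au, h.av, h.bu, h.bv, map_add, map_sub, map_neg,
    Derivation.leibniz, Derivation.leibniz_pow, smul_eq_mul, nsmul_eq_mul, a2, b2, a3, b3, a4, b4,
    Nat.cast_ofNat, Derivation.map_natCast, mul_zero,
    add_zero, Nat.reduceSub, Nat.reduceAdd, map_mul, map_pow, map_ofNat, map_natCast, jetNum222]
  have hne : φ X ^ 2 + φ Y ^ 2 ≠ 0 := right_ne_zero_of_mul_eq_one hr
  rw [eq_one_div_of_mul_eq_one_left hr]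
  field_simp
  ring

end Jets

end Parabolic
end

/-! ### Assembling the numerators into an identity between the two functions. -/

noncomputable section
namespace Parabolic
open TopologicalSpace

/-- The factor 8 clears the powers of `1 / 2` in `x₁`. Exchanging the coordinates maps `x₁` to
`-x₁`, thus `p₁` and the angular momentum to their negatives; this is why the two halves differ only
by a swap of arguments and a sign, here and for the other nine constants. -/
lemma compatTerm300_eq (X Y : ℝ) (u v : ℕ → ℝ) :
    8 * ((-3 * ((X ^ 2 - Y ^ 2) / 2) ^ 2 * (X * Y)) * jetNum111 X Y u v
      + (3 * ((X ^ 2 - Y ^ 2) / 2) ^ 3 - 6 * ((X ^ 2 - Y ^ 2) / 2) * (X * Y) ^ 2) * jetNum112 X Y u v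
      + (6 * ((X ^ 2 - Y ^ 2) / 2) ^ 2 * (X * Y) - 3 * (X * Y) ^ 3) * jetNum122 X Y u v
      + (3 * ((X ^ 2 - Y ^ 2) / 2) * (X * Y) ^ 2) * jetNum222 X Y u v
      + (X ^ 2 + Y ^ 2) ^ 2 * (-24 * ((X ^ 2 - Y ^ 2) / 2) * (X * Y)) * jetNum11 X Y u v
      + (X ^ 2 + Y ^ 2) ^ 2 * (24 * ((X ^ 2 - Y ^ 2) / 2) ^ 2 - 24 * (X * Y) ^ 2) * jetNum12 X Y u v
      + (X ^ 2 + Y ^ 2) ^ 2 * (24 * ((X ^ 2 - Y ^ 2) / 2) * (X * Y)) * jetNum22 X Y u v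
      + (X ^ 2 + Y ^ 2) ^ 4 * (-36 * (X * Y)) * jetNum1 X Y u v
      + (X ^ 2 + Y ^ 2) ^ 4 * (36 * ((X ^ 2 - Y ^ 2) / 2)) * jetNum2 X Y u v) =
      compatTerm300 X Y u - compatTerm300 Y X v := by
  simp only [compatTerm300, jetNum111, jetNum112, jetNum122, jetNum222, jetNum11, jetNum12, jetNum22, jetNum1, jetNum2]
  ring

lemma compatTerm210_eq (X Y : ℝ) (u v : ℕ → ℝ) :
    8 * ((((X ^ 2 - Y ^ 2) / 2) ^ 2) * jetNum111 X Y u v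
      + (4 * ((X ^ 2 - Y ^ 2) / 2) * (X * Y)) * jetNum112 X Y u v
      + (-2 * ((X ^ 2 - Y ^ 2) / 2) ^ 2 + 3 * (X * Y) ^ 2) * jetNum122 X Y u v
      + (-2 * ((X ^ 2 - Y ^ 2) / 2) * (X * Y)) * jetNum222 X Y u v
      + (X ^ 2 + Y ^ 2) ^ 2 * (8 * ((X ^ 2 - Y ^ 2) / 2)) * jetNum11 X Y u v
      + (X ^ 2 + Y ^ 2) ^ 2 * (16 * (X * Y)) * jetNum12 X Y u v
      + (X ^ 2 + Y ^ 2) ^ 2 * (-8 * ((X ^ 2 - Y ^ 2) / 2)) * jetNum22 X Y u v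
      + (X ^ 2 + Y ^ 2) ^ 4 * (12) * jetNum1 X Y u v) =
      compatTerm210 X Y u - compatTerm210 Y X v := by
  simp only [compatTerm210, jetNum111, jetNum112, jetNum122, jetNum222, jetNum11, jetNum12, jetNum22, jetNum1]
  ring

lemma compatTerm201_eq (X Y : ℝ) (u v : ℕ → ℝ) :
    8 * ((-2 * ((X ^ 2 - Y ^ 2) / 2) * (X * Y)) * jetNum111 X Y u v
      + (3 * ((X ^ 2 - Y ^ 2) / 2) ^ 2 - 2 * (X * Y) ^ 2) * jetNum112 X Y u v
      + (4 * ((X ^ 2 - Y ^ 2) / 2) * (X * Y)) * jetNum122 X Y u v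
      + ((X * Y) ^ 2) * jetNum222 X Y u v
      + (X ^ 2 + Y ^ 2) ^ 2 * (-8 * (X * Y)) * jetNum11 X Y u v
      + (X ^ 2 + Y ^ 2) ^ 2 * (16 * ((X ^ 2 - Y ^ 2) / 2)) * jetNum12 X Y u v
      + (X ^ 2 + Y ^ 2) ^ 2 * (8 * (X * Y)) * jetNum22 X Y u v
      + (X ^ 2 + Y ^ 2) ^ 4 * (12) * jetNum2 X Y u v) =
      compatTerm201 X Y u + compatTerm201 Y X v := by
  simp only [compatTerm201, jetNum111, jetNum112, jetNum122, jetNum222, jetNum11, jetNum12, jetNum22, jetNum2]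
  ring

lemma compatTerm120_eq (X Y : ℝ) (u v : ℕ → ℝ) :
    8 * ((-2 * ((X ^ 2 - Y ^ 2) / 2)) * jetNum112 X Y u v
      + (-3 * (X * Y)) * jetNum122 X Y u v
      + (((X ^ 2 - Y ^ 2) / 2)) * jetNum222 X Y u v
      + (X ^ 2 + Y ^ 2) ^ 2 * (-8) * jetNum12 X Y u v) =
      compatTerm120 X Y u - compatTerm120 Y X v := by
  simp only [compatTerm120, jetNum112, jetNum122, jetNum222, jetNum12]
  ring

lemma compatTerm111_eq (X Y : ℝ) (u v : ℕ → ℝ) :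
    8 * ((((X ^ 2 - Y ^ 2) / 2)) * jetNum111 X Y u v
      + (2 * (X * Y)) * jetNum112 X Y u v
      + (-2 * ((X ^ 2 - Y ^ 2) / 2)) * jetNum122 X Y u v
      + (-(X * Y)) * jetNum222 X Y u v
      + (X ^ 2 + Y ^ 2) ^ 2 * (4) * jetNum11 X Y u v
      + (X ^ 2 + Y ^ 2) ^ 2 * (-4) * jetNum22 X Y u v) =
      compatTerm111 X Y u + compatTerm111 Y X v := by
  simp only [compatTerm111, jetNum111, jetNum112, jetNum122, jetNum222, jetNum11, jetNum22]
  ring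

lemma compatTerm102_eq (X Y : ℝ) (u v : ℕ → ℝ) :
    8 * ((-(X * Y)) * jetNum111 X Y u v
      + (3 * ((X ^ 2 - Y ^ 2) / 2)) * jetNum112 X Y u v
      + (2 * (X * Y)) * jetNum122 X Y u v
      + (X ^ 2 + Y ^ 2) ^ 2 * (8) * jetNum12 X Y u v) =
      compatTerm102 X Y u - compatTerm102 Y X v := by
  simp only [compatTerm102, jetNum111, jetNum112, jetNum122, jetNum12]
  ring

lemma compatTerm030_eq (X Y : ℝ) (u v : ℕ → ℝ) :
    8 * ((3) * jetNum122 X Y u v) =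
      compatTerm030 X Y u - compatTerm030 Y X v := by
  simp only [compatTerm030, jetNum122]
  ring

lemma compatTerm021_eq (X Y : ℝ) (u v : ℕ → ℝ) :
    8 * ((-2) * jetNum112 X Y u v
      + (1) * jetNum222 X Y u v) =
      compatTerm021 X Y u + compatTerm021 Y X v := by
  simp only [compatTerm021, jetNum112, jetNum222]
  ring

lemma compatTerm012_eq (X Y : ℝ) (u v : ℕ → ℝ) :
    8 * ((1) * jetNum111 X Y u v
      + (-2) * jetNum122 X Y u v) =
      compatTerm012 X Y u - compatTerm012 Y X v := by
  simp only [compatTerm012, jetNum111, jetNum122]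
  ring

lemma compatTerm003_eq (X Y : ℝ) (u v : ℕ → ℝ) :
    8 * ((3) * jetNum112 X Y u v) =
      compatTerm003 X Y u + compatTerm003 Y X v := by
  simp only [compatTerm003, jetNum112]
  ring


section

variable {R : Type*} [CommRing R] [Algebra ℝ R] {a b : Derivation ℝ R R} {X Y r : R} {u v : ℕ → R}

/-- The compatibility condition as an identity between the jets of the two functions. -/
lemma IsParabolic.compat (h : IsParabolic a b X Y r u v) (φ : R →+* ℝ)
    (hr : φ r * (φ X ^ 2 + φ Y ^ 2) = 1) (hφ : ∀ c, φ (algebraMap ℝ R c) = c) {x y : R}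
    (hx : φ x = (φ X ^ 2 - φ Y ^ 2) / 2) (hy : φ y = φ X * φ Y) (ax : a x = 1) (ay : a y = 0)
    (bx : b x = 0) (by' : b y = 1) (A : ℕ → ℕ → ℕ → ℝ) {g₁ g₂ g₃ g₄ : R}
    (e₁ : g₁ = -algebraMap ℝ R (A 3 0 0) * y ^ 3 + algebraMap ℝ R (A 2 1 0) * y ^ 2
      - algebraMap ℝ R (A 1 2 0) * y + algebraMap ℝ R (A 0 3 0))
    (e₂ : g₂ = 3 * algebraMap ℝ R (A 3 0 0) * x * y ^ 2 - 2 * algebraMap ℝ R (A 2 1 0) * x * y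
        + algebraMap ℝ R (A 2 0 1) * y ^ 2 + algebraMap ℝ R (A 1 2 0) * x
        - algebraMap ℝ R (A 1 1 1) * y + algebraMap ℝ R (A 0 2 1))
    (e₃ : g₃ = -3 * algebraMap ℝ R (A 3 0 0) * x ^ 2 * y + algebraMap ℝ R (A 2 1 0) * x ^ 2
        - 2 * algebraMap ℝ R (A 2 0 1) * x * y + algebraMap ℝ R (A 1 1 1) * x
        - algebraMap ℝ R (A 1 0 2) * y + algebraMap ℝ R (A 0 1 2))
    (e₄ : g₄ = algebraMap ℝ R (A 3 0 0) * x ^ 3 + algebraMap ℝ R (A 2 0 1) * x ^ 2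
        + algebraMap ℝ R (A 1 0 2) * x + algebraMap ℝ R (A 0 0 3))
    (hC : compatOp a b (3 * g₁ * a (r * (u 0 + v 0)) + g₂ * b (r * (u 0 + v 0)))
      (2 * (g₂ * a (r * (u 0 + v 0)) + g₃ * b (r * (u 0 + v 0))))
      (g₃ * a (r * (u 0 + v 0)) + 3 * g₄ * b (r * (u 0 + v 0))) = 0) :
    compatPoly A (φ X) (φ Y) (fun i => φ (u i))
      + compatPoly (reflectCoeff A) (φ Y) (φ X) (fun i => φ (v i)) = 0 := by
  rw [compatOp_expand h.comm] at hC
  obtain ⟨a2, a3⟩ := derivation_two_three a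
  obtain ⟨b2, b3⟩ := derivation_two_three b
  have hC' := congrArg φ hC
  have j111 := h.jet111 φ hr
  have j112 := h.jet112 φ hr
  have j122 := h.jet122 φ hr
  have j222 := h.jet222 φ hr
  have j11 := h.jet11 φ hr
  have j12 := h.jet12 φ hr
  have j22 := h.jet22 φ hr
  have j1 := h.jet1 φ hr
  have j2 := h.jet2 φ hr
  -- The derivatives of the potential become atoms; their expansions enter only through the nine jet
  -- identities.
  generalize r * (u 0 + v 0) = V at hC' j111 j112 j122 j222 j11 j12 j22 j1 j2
  simp only [e₁, e₂, e₃, e₄, map_add, map_sub, map_neg, Derivation.leibniz, Derivation.leibniz_pow,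
    Derivation.map_algebraMap, smul_eq_mul, nsmul_eq_mul, ax, ay, bx, by', a2, a3, b2, b3,
    Derivation.map_natCast, Nat.cast_ofNat, map_zero, mul_zero, add_zero, zero_add, sub_zero,
    zero_sub, neg_zero, mul_one, map_mul, map_pow, map_ofNat, map_natCast, map_one, hφ, hx, hy,
    Nat.reduceSub, pow_one, Derivation.map_one_eq_zero] at hC'
  have t300 := compatTerm300_eq (φ X) (φ Y) (fun i => φ (u i)) (fun i => φ (v i))
  have t210 := compatTerm210_eq (φ X) (φ Y) (fun i => φ (u i)) (fun i => φ (v i))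
  have t201 := compatTerm201_eq (φ X) (φ Y) (fun i => φ (u i)) (fun i => φ (v i))
  have t120 := compatTerm120_eq (φ X) (φ Y) (fun i => φ (u i)) (fun i => φ (v i))
  have t111 := compatTerm111_eq (φ X) (φ Y) (fun i => φ (u i)) (fun i => φ (v i))
  have t102 := compatTerm102_eq (φ X) (φ Y) (fun i => φ (u i)) (fun i => φ (v i))
  have t030 := compatTerm030_eq (φ X) (φ Y) (fun i => φ (u i)) (fun i => φ (v i))
  have t021 := compatTerm021_eq (φ X) (φ Y) (fun i => φ (u i)) (fun i => φ (v i))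
  have t012 := compatTerm012_eq (φ X) (φ Y) (fun i => φ (u i)) (fun i => φ (v i))
  have t003 := compatTerm003_eq (φ X) (φ Y) (fun i => φ (u i)) (fun i => φ (v i))
  rw [← j111] at t300 t210 t201 t111 t102 t012
  rw [← j112] at t300 t210 t201 t120 t111 t102 t021 t003
  rw [← j122] at t300 t210 t201 t120 t111 t102 t030 t012
  rw [← j222] at t300 t210 t201 t120 t111 t021
  rw [← j11] at t300 t210 t201 t111
  rw [← j12] at t300 t210 t201 t120 t102
  rw [← j22] at t300 t210 t201 t111
  rw [← j1] at t300 t210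
  rw [← j2] at t300 t201
  simp only [compatPoly, reflectCoeff]
  linear_combination - A 3 0 0 * t300 - A 2 1 0 * t210 - A 2 0 1 * t201 - A 1 2 0 * t120 - A 1 1 1 * t111 - A 1 0 2 * t102 - A 0 3 0 * t030 - A 0 2 1 * t021 - A 0 1 2 * t012 - A 0 0 3 * t003 + 8 * (φ X ^ 2 + φ Y ^ 2) ^ 7 * hC'

end

end Parabolic
end

/-! ### From the compatibility condition for the separable potential to `compatPoly`. -/

noncomputable section
namespace Parabolic
open TopologicalSpace

/-- On `I` every member of the sequence of functions is the derivative of the preceding one. -/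
def IsJet (I : Set ℝ) (w : ℕ → ℝ → ℝ) : Prop := ∀ k, ∀ t ∈ I, HasDerivAt (w k) (w (k + 1) t) t

lemma contDiffOn_iterate_deriv {I : Set ℝ} (hI : IsOpen I) {W : ℝ → ℝ} (hW : ContDiffOn ℝ ∞ W I)
    (k : ℕ) : ContDiffOn ℝ ∞ (deriv^[k] W) I := by
  induction k with
  | zero => exact hW
  | succ k ih =>
    rw [Function.iterate_succ_apply']
    exact ih.deriv_of_isOpen hI (by norm_num)

lemma isJet_iterate_deriv {I : Set ℝ} (hI : IsOpen I) {W : ℝ → ℝ} (hW : ContDiffOn ℝ ∞ W I) :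
    IsJet I (fun k => deriv^[k] W) := by
  intro k t ht
  have h := ((contDiffOn_iterate_deriv hI hW k).contDiffAt (hI.mem_nhds ht)).differentiableAt
    (by norm_num)
  simp only [Function.iterate_succ_apply']
  exact h.hasDerivAt

variable {Ω : Opens (ℝ × ℝ)}

lemma dirDeriv_smoothMk_fst (v : ℝ × ℝ) {f f' : ℝ → ℝ}
    (hf : ContDiffOn ℝ ∞ (fun q : ℝ × ℝ => f q.1) Ω)
    (hf' : ContDiffOn ℝ ∞ (fun q : ℝ × ℝ => f' q.1) Ω)
    (h : ∀ t ∈ Prod.fst '' (Ω : Set (ℝ × ℝ)), HasDerivAt f (f' t) t) :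
    dirDeriv Ω ℝ v (smoothMk _ hf) = algebraMap ℝ _ v.1 * smoothMk _ hf' := by
  rw [dirDeriv_mk]
  apply smoothAlg_ext
  intro q
  have := (h q.1.1 (mem_image_of_mem _ q.2)).hasFDerivAt.comp q.1
    (hasFDerivAt_fst (𝕜 := ℝ) (E := ℝ) (F := ℝ))
  change fderiv ℝ (f ∘ Prod.fst) q.1 v = v.1 * f' q.1.1
  rw [this.fderiv]
  simp

lemma dirDeriv_smoothMk_snd (v : ℝ × ℝ) {f f' : ℝ → ℝ}
    (hf : ContDiffOn ℝ ∞ (fun q : ℝ × ℝ => f q.2) Ω)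
    (hf' : ContDiffOn ℝ ∞ (fun q : ℝ × ℝ => f' q.2) Ω)
    (h : ∀ t ∈ Prod.snd '' (Ω : Set (ℝ × ℝ)), HasDerivAt f (f' t) t) :
    dirDeriv Ω ℝ v (smoothMk _ hf) = algebraMap ℝ _ v.2 * smoothMk _ hf' := by
  rw [dirDeriv_mk]
  apply smoothAlg_ext
  intro q
  have := (h q.1.2 (mem_image_of_mem _ q.2)).hasFDerivAt.comp q.1
    (hasFDerivAt_snd (𝕜 := ℝ) (E := ℝ) (F := ℝ))
  change fderiv ℝ (f ∘ Prod.snd) q.1 v = v.2 * f' q.1.2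
  rw [this.fderiv]
  simp

lemma isParabolic_smoothMk (h0 : (0, 0) ∉ Ω) {w₁ w₂ : ℕ → ℝ → ℝ}
    (hw₁ : ∀ k, ContDiffOn ℝ ∞ (fun q : ℝ × ℝ => w₁ k q.1) Ω)
    (hw₂ : ∀ k, ContDiffOn ℝ ∞ (fun q : ℝ × ℝ => w₂ k q.2) Ω)
    (j₁ : IsJet (Prod.fst '' (Ω : Set (ℝ × ℝ))) w₁)
    (j₂ : IsJet (Prod.snd '' (Ω : Set (ℝ × ℝ))) w₂) :
    IsParabolic (d1 ℝ h0) (d2 ℝ h0) (xiFn Ω ℝ) (etaFn Ω ℝ) (invRho ℝ h0)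
      (fun k => smoothMk _ (hw₁ k)) (fun k => smoothMk _ (hw₂ k)) := by
  have e₁ v k := dirDeriv_smoothMk_fst v (hw₁ k) (hw₁ (k + 1)) (j₁ k)
  have e₂ v k := dirDeriv_smoothMk_snd v (hw₂ k) (hw₂ (k + 1)) (j₂ k)
  constructor
  case comm => exact d1_d2_comm h0
  all_goals intros
  all_goals
    simp only [d1_apply, d2_apply, dirDeriv_xiFn, dirDeriv_etaFn, dirDeriv_invRho, e₁, e₂,
      RCLike.ofReal_one, RCLike.ofReal_zero, map_one, map_zero]
    ring

lemma contDiffOn_comp_fst {f : ℝ → ℝ} (hf : ContDiffOn ℝ ∞ f (Prod.fst '' (Ω : Set (ℝ × ℝ)))) :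
    ContDiffOn ℝ ∞ (fun q : ℝ × ℝ => f q.1) Ω :=
  hf.comp contDiffOn_fst fun _ hq => mem_image_of_mem _ hq

lemma contDiffOn_comp_snd {f : ℝ → ℝ} (hf : ContDiffOn ℝ ∞ f (Prod.snd '' (Ω : Set (ℝ × ℝ)))) :
    ContDiffOn ℝ ∞ (fun q : ℝ × ℝ => f q.2) Ω :=
  hf.comp contDiffOn_snd fun _ hq => mem_image_of_mem _ hq

lemma contDiffOn_potential (h0 : (0, 0) ∉ Ω) {W₁ W₂ : ℝ → ℝ}
    (hW₁ : ContDiffOn ℝ ∞ W₁ (Prod.fst '' (Ω : Set (ℝ × ℝ))))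
    (hW₂ : ContDiffOn ℝ ∞ W₂ (Prod.snd '' (Ω : Set (ℝ × ℝ)))) :
    ContDiffOn ℝ ∞ (potential W₁ W₂) Ω :=
  ((contDiffOn_comp_fst hW₁).add (contDiffOn_comp_snd hW₂)).div (by fun_prop)
    fun _ hq => sq_add_sq_ne_of_mem h0 hq

/-- The compatibility condition for a separable potential, with denominators cleared. -/
lemma SolvesCompatibility.compatPoly (h0 : (0, 0) ∉ Ω) {W₁ W₂ : ℝ → ℝ}
    (hW₁ : ContDiffOn ℝ ∞ W₁ (Prod.fst '' (Ω : Set (ℝ × ℝ))))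
    (hW₂ : ContDiffOn ℝ ∞ W₂ (Prod.snd '' (Ω : Set (ℝ × ℝ))))
    (h : SolvesCompatibility Ω (potential W₁ W₂)) :
    ∃ A : ℕ → ℕ → ℕ → ℝ, (∃ j k l, j + k + l = 3 ∧ A j k l ≠ 0) ∧ ∀ q ∈ Ω,
      Parabolic.compatPoly A q.1 q.2 (fun k => deriv^[k] W₁ q.1)
        + Parabolic.compatPoly (reflectCoeff A) q.2 q.1 (fun k => deriv^[k] W₂ q.2) = 0 := by
  obtain ⟨A, hA, h⟩ := h
  refine ⟨A, hA, fun q hq => ?_⟩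
  have o₁ : IsOpen (Prod.fst '' (Ω : Set (ℝ × ℝ))) := isOpenMap_fst _ Ω.2
  have o₂ : IsOpen (Prod.snd '' (Ω : Set (ℝ × ℝ))) := isOpenMap_snd _ Ω.2
  obtain ⟨s₁, s₂, s₃, s₄⟩ := contDiff_F A
  have hV := contDiffOn_potential h0 hW₁ hW₂
  have hC : compatExpr h0 (smoothMk _ s₁.contDiffOn) (smoothMk _ s₂.contDiffOn)
      (smoothMk _ s₃.contDiffOn) (smoothMk _ s₄.contDiffOn) (smoothMk _ hV) = 0 :=
    smoothAlg_ext fun q => (compatExpr_mk_apply h0 _ _ _ _ hV q).trans (h q q.2)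
  have par := isParabolic_smoothMk h0
    (fun k => contDiffOn_comp_fst (contDiffOn_iterate_deriv o₁ hW₁ k))
    (fun k => contDiffOn_comp_snd (contDiffOn_iterate_deriv o₂ hW₂ k))
    (isJet_iterate_deriv o₁ hW₁) (isJet_iterate_deriv o₂ hW₂)
  have eV : smoothMk _ hV = invRho ℝ h0 * (smoothMk _ (contDiffOn_comp_fst
      (contDiffOn_iterate_deriv o₁ hW₁ 0)) + smoothMk _ (contDiffOn_comp_snd
      (contDiffOn_iterate_deriv o₂ hW₂ 0))) := by
    apply smoothAlg_ext
    intro q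
    change (W₁ q.1.1 + W₂ q.1.2) / (q.1.1 ^ 2 + q.1.2 ^ 2)
      = 1 / (q.1.1 ^ 2 + q.1.2 ^ 2) * (W₁ q.1.1 + W₂ q.1.2)
    ring
  rw [compatExpr, eV] at hC
  obtain ⟨φ, hφ, hx, hy, hφc⟩ := smoothAlg_eval ⟨q, hq⟩
  have hr : φ (invRho ℝ h0) * (φ (xiFn Ω ℝ) ^ 2 + φ (etaFn Ω ℝ) ^ 2) = 1 := by
    rw [← map_pow, ← map_pow, ← map_add, ← map_mul, invRho_mul, map_one]
  have hX : φ (xiFn Ω ℝ) = q.1 := hφ _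
  have hY : φ (etaFn Ω ℝ) = q.2 := hφ _
  have key := par.compat φ hr hφc (x := x1Fn Ω ℝ) (y := x2Fn Ω ℝ) (by rw [hx, hX, hY]; rfl)
    (by rw [hy, hX, hY]; rfl) (d1_x1Fn h0) (d1_x2Fn h0) (d2_x1Fn h0) (d2_x2Fn h0) A
    ?_ ?_ ?_ ?_ hC
  · simp only [hφ, smoothMk_apply, hX, hY] at key
    exact key
  all_goals
    apply smoothAlg_ext
    intro q
    obtain ⟨φ, hφ, hx, hy, hφc⟩ := smoothAlg_eval q
    simp only [← hφ]
    simp [hx, hy, hφc, map_ofNat φ 2, map_ofNat φ 3]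
    simp [hφ, F1, F2, F3, F4]

end Parabolic
end

/-! ### Constancy lemmas, membership in the family, and standard jets. -/

noncomputable section
namespace Parabolic

variable {I : Set ℝ}

lemma exists_const_of_hasDerivAt_zero (hI : IsOpen I) (hc : IsPreconnected I) {f f' : ℝ → ℝ}
    (hf : ∀ t ∈ I, HasDerivAt f (f' t) t) (h : ∀ t ∈ I, f' t = 0) : ∃ c, ∀ t ∈ I, f t = c :=
  hI.exists_is_const_of_deriv_eq_zero hc (fun t ht => (hf t ht).differentiableAt.differentiableWithinAt)
    fun t ht => (hf t ht).deriv.trans (h t ht)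

/-- A continuous function with vanishing derivative outside of a countable set is constant. -/
lemma exists_const_of_hasDerivAt_zero_off_countable {E : Type*} [NormedAddCommGroup E]
    [NormedSpace ℝ E] [CompleteSpace E] (hc : IsPreconnected I) {f : ℝ → E} {s : Set ℝ}
    (hs : s.Countable) (hf : ContinuousOn f I) (h : ∀ t ∈ I, t ∉ s → HasDerivAt f 0 t) :
    ∃ c, ∀ t ∈ I, f t = c := by
  rcases I.eq_empty_or_nonempty with rfl | ⟨a, ha⟩
  · exact ⟨0, fun t ht => ht.elim⟩
  refine ⟨f a, fun t ht => ?_⟩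
  have hsub : uIcc a t ⊆ I := hc.ordConnected.uIcc_subset ha ht
  have := MeasureTheory.integral_eq_of_hasDerivAt_off_countable f (fun _ => 0) hs
    (hf.mono hsub) (fun x hx => h x (hsub (Ioo_subset_Icc_self hx.1)) hx.2) (by simp)
  rw [intervalIntegral.integral_zero] at this
  exact sub_eq_zero.1 this.symm

lemma eq_zero_of_punctured (hI : IsOpen I) {f : ℝ → ℝ} (hf : ∀ t ∈ I, ContinuousAt f t)
    (h : ∀ t ∈ I, t ≠ 0 → f t = 0) : ∀ t ∈ I, f t = 0 := by
  intro t ht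
  by_cases h0 : t = 0
  · subst h0
    have h1 : Filter.Tendsto f (nhdsWithin 0 {0}ᶜ) (nhds (f 0)) := (hf 0 ht).tendsto.mono_left
      nhdsWithin_le_nhds
    have h2 : f =ᶠ[nhdsWithin 0 {0}ᶜ] fun _ => 0 := by
      filter_upwards [self_mem_nhdsWithin, nhdsWithin_le_nhds (hI.mem_nhds ht)] with x hx hx'
      exact h x hx' hx
    exact tendsto_nhds_unique (h1.congr' h2) tendsto_const_nhds |>.symm ▸ rfl
  · exact h t ht h0

/-- Taken with `α₁ = α₂ = 0` and `B = 0`, so that `t = 0` is the only excluded point. -/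
lemma inFamily_of_laurent {W : ℝ → ℝ} {I : Set ℝ} (q : Polynomial ℝ) (hq : q.natDegree ≤ 16)
    (c₂ c₄ c₆ : ℝ) (h : ∀ t ∈ I, t ≠ 0 → W t = q.eval t + c₂ / t ^ 2 + c₄ / t ^ 4 + c₆ / t ^ 6) :
    InFamily W I := by
  refine ⟨q.coeff, c₂, c₄, c₆, 0, 1, 0, 0, Or.inl rfl, fun t ht h0 _ => ?_⟩
  rw [h t ht h0, Polynomial.eval_eq_sum_range' (n := 17) (by omega)]
  simp [irrationalTerm]

lemma InFamily.add_laurent {W W' : ℝ → ℝ} (hW : InFamily W I) (q : Polynomial ℝ)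
    (hq : q.natDegree ≤ 16) (c₂ c₄ c₆ : ℝ)
    (h : ∀ t ∈ I, t ≠ 0 → W' t = W t + (q.eval t + c₂ / t ^ 2 + c₄ / t ^ 4 + c₆ / t ^ 6)) :
    InFamily W' I := by
  obtain ⟨c, a₂, a₄, a₆, B, σ, α₁, α₂, hσ, hc⟩ := hW
  refine ⟨fun j => c j + q.coeff j, a₂ + c₂, a₄ + c₄, a₆ + c₆, B, σ, α₁, α₂, hσ,
    fun t ht h0 hB => ?_⟩
  rw [h t ht h0, Complex.ofReal_add, hc t ht h0 hB,
    Polynomial.eval_eq_sum_range' (n := 17) (by omega)]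
  simp only [add_mul, Finset.sum_add_distrib, add_div]
  push_cast
  ring

lemma InFamily.add_polynomial {W W' : ℝ → ℝ} (hW : InFamily W I) (q : Polynomial ℝ)
    (hq : q.natDegree ≤ 16) (h : ∀ t ∈ I, W' t = W t + q.eval t) : InFamily W' I :=
  hW.add_laurent q hq 0 0 0 fun t ht _ => by simp [h t ht]

/-- For `B = 0` and `t > 0` the square root is `t` and the logarithm is `log (2 t)`; the constant
`α₂` removes `log 2`. -/
lemma irrationalTerm_zero_one (κ : ℝ) {t : ℝ} (ht : 0 < t) :
    irrationalTerm 0 1 κ (-(κ * Real.log 2 : ℝ)) t = (κ * Real.log t : ℝ) := by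
  have hs : Complex.sqrt ((t ^ 2 + 0 : ℝ) : ℂ) = t := by
    rw [Complex.sqrt_of_nonneg (by rw [add_zero]; exact_mod_cast sq_nonneg t)]
    rw [Complex.ofReal_re, add_zero, Real.sqrt_sq ht.le]
  have hne : (t : ℂ) ≠ 0 := by exact_mod_cast ht.ne'
  have hl : Complex.log (t + 1 * t) = ((Real.log 2 + Real.log t : ℝ) : ℂ) := by
    rw [← Real.log_mul two_ne_zero ht.ne', Complex.ofReal_log (by positivity)]
    push_cast; ring_nf
  rw [irrationalTerm, hs, hl]
  field_simp
  push_cast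
  ring

/-- For `t < 0` the principal root gives `t + √(t²) = 0`, so the other sign is needed. The argument
of the logarithm is then `2 t`, and `α₂` also removes the contribution `π i`. -/
lemma irrationalTerm_zero_neg_one (κ : ℝ) {t : ℝ} (ht : t < 0) :
    irrationalTerm 0 (-1) κ (-((κ * Real.log 2 : ℝ) + κ * Real.pi * Complex.I)) t
      = (κ * Real.log t : ℝ) := by
  have hs : Complex.sqrt ((t ^ 2 + 0 : ℝ) : ℂ) = -t := by
    rw [Complex.sqrt_of_nonneg (by rw [add_zero]; exact_mod_cast sq_nonneg t)]
    rw [Complex.ofReal_re, add_zero, Real.sqrt_sq_eq_abs, abs_of_neg ht, Complex.ofReal_neg]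
  have hne : (t : ℂ) ≠ 0 := by exact_mod_cast ht.ne
  have hl : Complex.log (t + -1 * -t) =
      ((Real.log 2 + Real.log t : ℝ) : ℂ) + Real.pi * Complex.I := by
    have e : (t : ℂ) + -1 * -t = ((2 * t : ℝ) : ℂ) := by push_cast; ring
    rw [← Real.log_mul two_ne_zero ht.ne, e, Complex.log, Complex.arg_ofReal_of_neg (by linarith),
      Complex.norm_real, Real.norm_eq_abs, Real.log_abs]
  rw [irrationalTerm, hs, hl]
  field_simp
  push_cast
  ring

lemma inFamily_const_mul_log (hc : IsPreconnected I) (h0 : (0 : ℝ) ∉ I) (κ : ℝ) :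
    InFamily (fun t => κ * Real.log t) I := by
  by_cases hp : ∀ t ∈ I, 0 < t
  · refine ⟨0, 0, 0, 0, 0, 1, κ, -(κ * Real.log 2 : ℝ), Or.inl rfl, fun t ht _ _ => ?_⟩
    rw [irrationalTerm_zero_one κ (hp t ht)]
    simp
  · push Not at hp
    obtain ⟨a, ha, ha0⟩ := hp
    have hn : ∀ t ∈ I, t < 0 := by
      intro t ht
      by_contra! h
      exact h0 (hc.ordConnected.out ha ht ⟨ha0, h⟩)
    refine ⟨0, 0, 0, 0, 0, -1, κ, -((κ * Real.log 2 : ℝ) + κ * Real.pi * Complex.I), Or.inr rfl, fun t ht _ _ => ?_⟩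
    rw [irrationalTerm_zero_neg_one κ (hn t ht)]
    simp

section Jets

variable {w : ℕ → ℝ → ℝ}

lemma IsJet.sub (hw : IsJet I w) {v : ℕ → ℝ → ℝ} (hv : IsJet I v) :
    IsJet I (fun k t => w k t - v k t) := fun k t ht => (hw k t ht).sub (hv k t ht)

lemma IsJet.const_mul (hw : IsJet I w) (c : ℝ) : IsJet I (fun k t => c * w k t) :=
  fun k t ht => (hw k t ht).const_mul c

lemma isJet_polynomial (q : Polynomial ℝ) :
    IsJet I (fun k t => (Polynomial.derivative^[k] q).eval t) := by
  intro k t _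
  simp only [Function.iterate_succ_apply']
  exact Polynomial.hasDerivAt _ t

lemma hasDerivAt_prod_mul_zpow (a : ℤ) (k : ℕ) {t : ℝ} (ht : t ≠ 0) :
    HasDerivAt (fun t : ℝ => (∏ i ∈ Finset.range k, ((a : ℝ) - i)) * t ^ (a - k))
      ((∏ i ∈ Finset.range (k + 1), ((a : ℝ) - i)) * t ^ (a - (k + 1 : ℕ))) t := by
  refine ((hasDerivAt_zpow (a - k) t (Or.inl ht)).const_mul
    (∏ i ∈ Finset.range k, ((a : ℝ) - i))).congr_deriv ?_
  rw [Finset.prod_range_succ, Nat.cast_succ, ← sub_sub]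
  push_cast
  ring

lemma exists_isJet_log (h0 : (0 : ℝ) ∉ I) : ∃ v, IsJet I v ∧ v 0 = Real.log ∧
    ∀ t ∈ I, v 1 t = t⁻¹ ∧ v 2 t = -(t ^ 2)⁻¹ ∧ v 3 t = 2 * (t ^ 3)⁻¹ := by
  have hne : ∀ t ∈ I, t ≠ 0 := fun t ht h => h0 (h ▸ ht)
  refine ⟨fun k => k.casesOn Real.log fun k t =>
    (∏ i ∈ Finset.range k, (((-1 : ℤ) : ℝ) - i)) * t ^ ((-1 : ℤ) - k), ?_, rfl, fun t ht => ?_⟩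
  · rintro (_ | k) t ht
    · simpa using Real.hasDerivAt_log (hne t ht)
    · exact hasDerivAt_prod_mul_zpow (-1) k (hne t ht)
  · refine ⟨?_, ?_, ?_⟩
    · change (∏ i ∈ Finset.range 0, (((-1 : ℤ) : ℝ) - i)) * t ^ ((-1 : ℤ) - (0 : ℕ)) = _
      norm_num
    · change (∏ i ∈ Finset.range 1, (((-1 : ℤ) : ℝ) - i)) * t ^ ((-1 : ℤ) - (1 : ℕ)) = _
      norm_num [zpow_neg]
    · change (∏ i ∈ Finset.range 2, (((-1 : ℤ) : ℝ) - i)) * t ^ ((-1 : ℤ) - (2 : ℕ)) = _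
      norm_num [Finset.prod_range_succ, zpow_neg]

lemma exists_isJet_inv_sq (h0 : (0 : ℝ) ∉ I) : ∃ v, IsJet I v ∧
    ∀ t ∈ I, v 0 t = (t ^ 2)⁻¹ ∧ v 1 t = -2 * (t ^ 3)⁻¹ ∧ v 2 t = 6 * (t ^ 4)⁻¹ := by
  refine ⟨fun k t => (∏ i ∈ Finset.range k, (((-2 : ℤ) : ℝ) - i)) * t ^ ((-2 : ℤ) - k),
    fun k t ht => hasDerivAt_prod_mul_zpow (-2) k fun h => h0 (h ▸ ht), fun t ht => ?_⟩
  norm_num [Finset.prod_range_succ, zpow_neg]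

end Jets
end Parabolic
end

/-! ### Homogeneous Euler equations. -/

noncomputable section
namespace Parabolic

section Solve

variable {I : Set ℝ} {w : ℕ → ℝ → ℝ}

/-- Solutions of `t³ y''' + 15 t² y'' + 57 t y' + 48 y = 0`. -/
lemma inFamily_of_euler_two_four_six (hI : IsOpen I) (hc : IsPreconnected I) (hw : IsJet I w)
    (h : ∀ t ∈ I, t ^ 3 * w 3 t + 15 * t ^ 2 * w 2 t + 57 * t * w 1 t + 48 * w 0 t = 0) :
    InFamily (w 0) I := by
  have p := hasDerivAt_pow (𝕜 := ℝ)
  -- Three first integrals, from the integrating factors `t`, `t³`, `t⁵`. Each annihilates two of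
  -- the solutions `t⁻²`, `t⁻⁴`, `t⁻⁶` and takes the value 8, -4 or 8 on the third. They involve no
  -- division by `t`, so the same constants hold on both sides of 0.
  obtain ⟨a, ha⟩ := exists_const_of_hasDerivAt_zero hI hc
    (f := fun t => t ^ 4 * w 2 t + 11 * (t ^ 3 * w 1 t) + 24 * (t ^ 2 * w 0 t))
    (fun t ht => (((p 4 t).mul (hw 2 t ht)).add (((p 3 t).mul (hw 1 t ht)).const_mul 11)).add
      (((p 2 t).mul (hw 0 t ht)).const_mul 24))
    (fun t ht => by linear_combination (t) * h t ht)
  obtain ⟨b, hb⟩ := exists_const_of_hasDerivAt_zero hI hc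
    (f := fun t => t ^ 6 * w 2 t + 9 * (t ^ 5 * w 1 t) + 12 * (t ^ 4 * w 0 t))
    (fun t ht => (((p 6 t).mul (hw 2 t ht)).add (((p 5 t).mul (hw 1 t ht)).const_mul 9)).add
      (((p 4 t).mul (hw 0 t ht)).const_mul 12))
    (fun t ht => by linear_combination (t ^ 3) * h t ht)
  obtain ⟨c, hc⟩ := exists_const_of_hasDerivAt_zero hI hc
    (f := fun t => t ^ 8 * w 2 t + 7 * (t ^ 7 * w 1 t) + 8 * (t ^ 6 * w 0 t))
    (fun t ht => (((p 8 t).mul (hw 2 t ht)).add (((p 7 t).mul (hw 1 t ht)).const_mul 7)).add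
      (((p 6 t).mul (hw 0 t ht)).const_mul 8))
    (fun t ht => by linear_combination (t ^ 5) * h t ht)
  refine inFamily_of_laurent 0 (by simp) (a / 8) (-b / 4) (c / 8) fun t ht h0 => ?_
  rw [Polynomial.eval_zero]
  field_simp
  linear_combination 4 * (t ^ 4 * ha t ht - 2 * t ^ 2 * hb t ht + hc t ht)

/-- Solutions of `t² y''' + 9 t y'' + 15 y' = 0`. -/
lemma exists_of_euler_zero_two_four (hI : IsOpen I) (hc : IsPreconnected I) (hw : IsJet I w)
    (h : ∀ t ∈ I, t ^ 2 * w 3 t + 9 * t * w 2 t + 15 * w 1 t = 0) :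
    ∃ a b c : ℝ, ∀ t ∈ I, t ≠ 0 → w 0 t = a + b / t ^ 2 + c / t ^ 4 := by
  have p := hasDerivAt_pow (𝕜 := ℝ)
  -- This first integral annihilates `t⁻²` and `t⁻⁴` and is 8 on constants. The next two separate
  -- the coefficients of `t⁻²` and `t⁻⁴`, again without dividing by `t`.
  obtain ⟨d, hd⟩ := exists_const_of_hasDerivAt_zero hI hc
    (f := fun t => t ^ 2 * w 2 t + 7 * (t ^ 1 * w 1 t) + 8 * w 0 t)
    (fun t ht => (((p 2 t).mul (hw 2 t ht)).add (((p 1 t).mul (hw 1 t ht)).const_mul 7)).add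
      ((hw 0 t ht).const_mul 8))
    (fun t ht => by linear_combination h t ht)
  obtain ⟨a, ha⟩ := exists_const_of_hasDerivAt_zero hI hc
    (f := fun t => t ^ 3 * w 1 t + 4 * (t ^ 2 * w 0 t) - d / 2 * t ^ 2)
    (fun t ht => (((p 3 t).mul (hw 1 t ht)).add (((p 2 t).mul (hw 0 t ht)).const_mul 4)).sub
      ((p 2 t).const_mul (d / 2)))
    (fun t ht => by linear_combination t * hd t ht)
  obtain ⟨b, hb⟩ := exists_const_of_hasDerivAt_zero hI hc
    (f := fun t => t ^ 5 * w 1 t + 2 * (t ^ 4 * w 0 t) - d / 4 * t ^ 4)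
    (fun t ht => (((p 5 t).mul (hw 1 t ht)).add (((p 4 t).mul (hw 0 t ht)).const_mul 2)).sub
      ((p 4 t).const_mul (d / 4)))
    (fun t ht => by linear_combination t ^ 3 * hd t ht)
  refine ⟨d / 8, a / 2, -b / 2, fun t ht h0 => ?_⟩
  field_simp
  linear_combination 8 * t ^ 2 * ha t ht - 8 * hb t ht

lemma inFamily_of_exists_laurent {W : ℝ → ℝ}
    (h : ∃ a b c : ℝ, ∀ t ∈ I, t ≠ 0 → W t = a + b / t ^ 2 + c / t ^ 4) : InFamily W I := by
  obtain ⟨a, b, c, h⟩ := h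
  exact inFamily_of_laurent (Polynomial.C a) (by simp) b c 0 fun t ht h0 => by
    simp [h t ht h0]

/-- Solutions of `t y''' + 4 y'' = 0`. -/
lemma inFamily_of_euler_neg_one_zero_two (hI : IsOpen I) (hc : IsPreconnected I) (hw : IsJet I w)
    (h : ∀ t ∈ I, t * w 3 t + 4 * w 2 t = 0) : InFamily (w 0) I := by
  have p := hasDerivAt_pow (𝕜 := ℝ)
  obtain ⟨a, ha⟩ := exists_const_of_hasDerivAt_zero hI hc
    (f := fun t => t ^ 1 * w 2 t + 3 * w 1 t)
    (fun t ht => ((p 1 t).mul (hw 2 t ht)).add ((hw 1 t ht).const_mul 3))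
    (fun t ht => by linear_combination h t ht)
  obtain ⟨b, hb⟩ := exists_const_of_hasDerivAt_zero hI hc
    (f := fun t => t ^ 1 * w 1 t + 2 * w 0 t - a * t ^ 1)
    (fun t ht => (((p 1 t).mul (hw 1 t ht)).add ((hw 0 t ht).const_mul 2)).sub
      ((p 1 t).const_mul a))
    (fun t ht => by linear_combination ha t ht)
  obtain ⟨c, hc⟩ := exists_const_of_hasDerivAt_zero hI hc
    (f := fun t => t ^ 2 * w 0 t - a / 3 * t ^ 3 - b / 2 * t ^ 2)
    (fun t ht => (((p 2 t).mul (hw 0 t ht)).sub ((p 3 t).const_mul (a / 3))).sub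
      ((p 2 t).const_mul (b / 2)))
    (fun t ht => by linear_combination t * hb t ht)
  refine inFamily_of_laurent (.C (a / 3) * .X + .C (b / 2)) (by compute_degree!) c 0 0
    fun t ht h0 => ?_
  simp only [Polynomial.eval_add, Polynomial.eval_mul, Polynomial.eval_C, Polynomial.eval_X,
    zero_div, add_zero]
  field_simp
  linear_combination 6 * hc t ht

/-- Solutions of `y''' = 0`. -/
lemma inFamily_of_third_deriv_zero (hI : IsOpen I) (hc : IsPreconnected I) (hw : IsJet I w)
    (h : ∀ t ∈ I, w 3 t = 0) : InFamily (w 0) I := by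
  have p := hasDerivAt_pow (𝕜 := ℝ)
  obtain ⟨a, ha⟩ := exists_const_of_hasDerivAt_zero hI hc (hw 2) h
  obtain ⟨b, hb⟩ := exists_const_of_hasDerivAt_zero hI hc
    (f := fun t => w 1 t - a * t ^ 1)
    (fun t ht => (hw 1 t ht).sub ((p 1 t).const_mul a))
    (fun t ht => by linear_combination ha t ht)
  obtain ⟨c, hc⟩ := exists_const_of_hasDerivAt_zero hI hc
    (f := fun t => w 0 t - a / 2 * t ^ 2 - b * t ^ 1)
    (fun t ht => ((hw 0 t ht).sub ((p 2 t).const_mul (a / 2))).sub ((p 1 t).const_mul b))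
    (fun t ht => by linear_combination hb t ht)
  refine inFamily_of_laurent (.C (a / 2) * .X ^ 2 + .C b * .X + .C c)
    (by compute_degree!) 0 0 0 fun t ht h0 => ?_
  simp only [Polynomial.eval_add, Polynomial.eval_mul, Polynomial.eval_C, Polynomial.eval_X,
    Polynomial.eval_pow]
  linear_combination hc t ht

end Solve
end Parabolic
end

/-! ### Equations with the coefficient `t² + B`: square roots and logarithms. -/

noncomputable section
namespace Parabolic

/-- At least one of the two real roots vanishes. This form shows that the principal root is
continuous along the real line and has nonnegative imaginary part there. -/
lemma complex_sqrt_ofReal (y : ℝ) : Complex.sqrt (y : ℂ) = √y + Complex.I * √(-y) := by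
  rcases le_total 0 y with h | h
  · rw [Complex.sqrt_of_nonneg (by exact_mod_cast h), Real.sqrt_eq_zero_of_nonpos (x := -y) (by linarith)]
    simp
  · have e : (y : ℂ) = -((-y : ℝ) : ℂ) := by push_cast; ring
    rw [e, Complex.sqrt_neg_of_nonneg (by exact_mod_cast neg_nonneg.2 h),
      Real.sqrt_eq_zero_of_nonpos h, Complex.sqrt_of_nonneg (by exact_mod_cast neg_nonneg.2 h)]
    simp

lemma sqrt_sq_complex (y : ℝ) : ((√y + Complex.I * √(-y) : ℂ)) ^ 2 = y := by
  rcases le_total 0 y with h | h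
  · rw [Real.sqrt_eq_zero_of_nonpos (x := -y) (by linarith)]
    simp only [Complex.ofReal_zero, mul_zero, add_zero]
    exact_mod_cast Real.sq_sqrt h
  · rw [Real.sqrt_eq_zero_of_nonpos h, Complex.ofReal_zero, zero_add, mul_pow, Complex.I_sq]
    have : (√(-y)) ^ 2 = -y := Real.sq_sqrt (by linarith)
    have : ((√(-y) : ℝ) : ℂ) ^ 2 = -y := by exact_mod_cast this
    rw [this]; ring

lemma hasDerivAt_complex_sqrt {B t : ℝ} (h : t ^ 2 + B ≠ 0) :
    HasDerivAt (fun t : ℝ => (√(t ^ 2 + B) + Complex.I * √(-(t ^ 2 + B)) : ℂ))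
      (t / (√(t ^ 2 + B) + Complex.I * √(-(t ^ 2 + B)))) t := by
  have h1 : HasDerivAt (fun t : ℝ => t ^ 2 + B) (2 * t) t := by
    simpa using (hasDerivAt_pow 2 t).add_const B
  have hn : HasDerivAt (fun t : ℝ => -(t ^ 2 + B)) (-(2 * t)) t := h1.neg
  refine ((h1.sqrt h).ofReal_comp.add
    ((hn.sqrt (neg_ne_zero.2 h)).ofReal_comp.const_mul Complex.I)).congr_deriv ?_
  rcases lt_or_gt_of_ne h with h | h
  · have hp : (√(-(t ^ 2 + B)) : ℂ) ≠ 0 := by exact_mod_cast (Real.sqrt_pos.2 (by linarith)).ne'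
    rw [Real.sqrt_eq_zero_of_nonpos h.le]
    push_cast
    generalize (√(-(t ^ 2 + B)) : ℂ) = r at hp ⊢
    have := Complex.I_ne_zero
    simp only [mul_zero, div_zero, zero_add]
    field_simp
    simp [Complex.I_sq]
  · have hp : (√(t ^ 2 + B) : ℂ) ≠ 0 := by exact_mod_cast (Real.sqrt_pos.2 h).ne'
    rw [Real.sqrt_eq_zero_of_nonpos (x := -(t ^ 2 + B)) (by linarith)]
    push_cast
    simp only [mul_zero, div_zero, add_zero]
    field_simp

/-- Multiplication by `-i` carries the closed upper half plane without 0 into the slit plane, where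
the logarithm is differentiable; the price is a constant. -/
lemma log_eq_of_im_nonneg {z : ℂ} (hz : z ≠ 0) (him : 0 ≤ z.im) :
    Complex.log z = Complex.log (-Complex.I * z) + Real.pi / 2 * Complex.I := by
  have h : Complex.log (Complex.I * (-Complex.I * z)) = Complex.log Complex.I + Complex.log (-Complex.I * z) := by
    rw [Complex.log_mul_eq_add_log_iff Complex.I_ne_zero (mul_ne_zero (neg_ne_zero.2 Complex.I_ne_zero) hz)]
    rw [Complex.arg_I]
    have : |Complex.arg (-Complex.I * z)| ≤ Real.pi / 2 :=
      Complex.abs_arg_le_pi_div_two_iff.2 (by simpa using him)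
    rw [abs_le] at this
    constructor <;> linarith [this.1, this.2, Real.pi_pos]
  rw [← mul_assoc, mul_neg, Complex.I_mul_I, neg_neg, one_mul, Complex.log_I] at h
  rw [h]; ring

lemma neg_I_mul_mem_slitPlane {z : ℂ} (hz : z ≠ 0) (him : 0 ≤ z.im) :
    -Complex.I * z ∈ Complex.slitPlane := by
  rw [Complex.mem_slitPlane_iff]
  rcases him.lt_or_eq with h | h
  · left; simpa using h
  · right
    intro h'
    apply hz
    apply Complex.ext
    · simpa using h'
    · exact h.symm

section Solve

variable {I : Set ℝ} {w : ℕ → ℝ → ℝ}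

/-- With `U = (t² + B) y' - k t / 2` and `s² = t² + B`, both `y - t U / B` and `s U / B - (k / 2)
log (t + s)` are constant. Eliminating `U` gives `y`. -/
lemma inFamily_of_irrational (hI : IsOpen I) (hc : IsPreconnected I) (hw : IsJet I w) {B k : ℝ}
    (hB : B ≠ 0) (h : ∀ t ∈ I, (t ^ 2 + B) * w 2 t + 3 * t * w 1 t = k) : InFamily (w 0) I := by
  have p := hasDerivAt_pow (𝕜 := ℝ)
  have hU : ∀ t ∈ I, HasDerivAt (fun t => (t ^ 2 + B) * w 1 t - k / 2 * t) (k / 2 - t * w 1 t) t :=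
    fun t ht => ((((p 2 t).add_const B).mul (hw 1 t ht)).sub
      ((hasDerivAt_id t).const_mul (k / 2))).congr_deriv (by
        simp only [Nat.cast_ofNat, mul_one]
        linear_combination h t ht)
  set U : ℝ → ℝ := fun t => (t ^ 2 + B) * w 1 t - k / 2 * t with hUdef
  obtain ⟨c, hcc⟩ := exists_const_of_hasDerivAt_zero hI hc (f := fun t => w 0 t - 1 / B * (t * U t))
    (fun t ht => (hw 0 t ht).sub (((hasDerivAt_id t).mul (hU t ht)).const_mul (1 / B)))
    (fun t ht => by
      simp only [hUdef, id]
      field_simp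
      ring)
  set s : ℝ → ℂ := fun t => √(t ^ 2 + B) + Complex.I * √(-(t ^ 2 + B)) with hs
  have s2 (t : ℝ) : s t ^ 2 = t ^ 2 + B := by
    rw [hs]; simp only; rw [sqrt_sq_complex]; push_cast; ring
  have hBc : (B : ℂ) ≠ 0 := by exact_mod_cast hB
  -- `(s + t) (s - t) = B ≠ 0`.
  have hne (t : ℝ) : (t + s t : ℂ) ≠ 0 := by
    intro h0
    apply hBc
    linear_combination (s t - t) * h0 - s2 t
  have him (t : ℝ) : 0 ≤ (t + s t : ℂ).im := by
    simp [hs, Real.sqrt_nonneg]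
  have hscont : Continuous s := by fun_prop
  have hs0 {t : ℝ} (h : t ^ 2 + B ≠ 0) : s t ≠ 0 := by
    intro h0
    apply h
    have := s2 t
    rw [h0] at this
    have : (t : ℂ) ^ 2 + B = 0 := by rw [← this]; ring
    exact_mod_cast this
  -- The root is not differentiable where `t² + B = 0`, but the function stays continuous there, so
  -- one constant `a` serves on both sides of the branch points.
  obtain ⟨a, ha⟩ := exists_const_of_hasDerivAt_zero_off_countable hc
    (f := fun t => 1 / B * (s t * U t) - k / 2 * Complex.log (-Complex.I * (t + s t)))
    (s := {t | t ^ 2 + B = 0}) (by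
      apply Set.Finite.countable
      refine (Set.toFinite {√(-B), -√(-B)}).subset fun t ht => ?_
      have : t ^ 2 = √(-B) ^ 2 := by
        have ht : t ^ 2 + B = 0 := ht
        rw [Real.sq_sqrt (by nlinarith [sq_nonneg t])]; linarith
      simpa using sq_eq_sq_iff_eq_or_eq_neg.1 this)
    (by
      have hUc : ContinuousOn U I := fun t ht => (hU t ht).continuousAt.continuousWithinAt
      refine ContinuousOn.sub (continuousOn_const.mul (hscont.continuousOn.mul
        (Complex.continuous_ofReal.comp_continuousOn hUc))) (continuousOn_const.mul ?_)
      exact ContinuousOn.clog (by fun_prop) fun t _ => neg_I_mul_mem_slitPlane (hne t) (him t))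
    (fun t ht hy => by
      have ds := hasDerivAt_complex_sqrt hy
      have dl := ((((hasDerivAt_id t).ofReal_comp.add ds).const_mul (-Complex.I)).clog_real
        (neg_I_mul_mem_slitPlane (hne t) (him t))).const_mul (k / 2 : ℂ)
      refine (((ds.mul (hU t ht).ofReal_comp).const_mul (1 / B : ℂ)).sub dl).congr_deriv ?_
      change (1 / B * ((t / s t) * (U t : ℂ) + s t * ((k / 2 - t * w 1 t : ℝ) : ℂ))
        - k / 2 * (-Complex.I * (((1 : ℝ) : ℂ) + t / s t) / (-Complex.I * (t + s t))) : ℂ) = 0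
      have h1 := hs0 hy
      have h2 := hne t
      have h3 := Complex.I_ne_zero
      have e : (U t : ℂ) = s t ^ 2 * w 1 t - k / 2 * t := by
        rw [s2, hUdef]; push_cast; ring
      rw [e]
      push_cast
      field_simp
      linear_combination (k * (t + s t) : ℂ) * s2 t)
  -- The constant `a` is corrected by `-(k / 2) (π i / 2)` to return from `log (-i (t + s))` to `log
  -- (t + s)`.
  refine ⟨fun j => if j = 0 then c else 0, 0, 0, 0, B, 1, k / 2,
    a - k / 2 * (Real.pi / 2 * Complex.I), Or.inl rfl, fun t ht _ hy => ?_⟩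
  have h1 := hs0 hy
  have hlog := log_eq_of_im_nonneg (hne t) (him t)
  have e1 := ha t ht
  have e2 : (w 0 t : ℂ) - 1 / B * (t * U t) = c := by exact_mod_cast hcc t ht
  rw [irrationalTerm, complex_sqrt_ofReal, one_mul]
  change _ = _ + (k / 2 * t * Complex.log (t + s t) + _) / s t
  rw [hlog]
  simp only [ite_mul, zero_mul, Finset.sum_ite_eq', Finset.mem_range, zero_div, add_zero]
  simp only [Nat.ofNat_pos, if_true, pow_zero, mul_one]
  have e3 : (t : ℂ) / B * U t = (k / 2 * t * (Complex.log (-Complex.I * (t + s t))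
      + Real.pi / 2 * Complex.I) + (a - k / 2 * (Real.pi / 2 * Complex.I)) * t) / s t := by
    rw [← e1]
    field_simp
    ring
  rw [← e3]
  linear_combination e2

/-- Solutions of `(t² + B) y'' + 3 t y' = k`. -/
lemma inFamily_of_quadratic_second_order (hI : IsOpen I) (hc : IsPreconnected I) (hw : IsJet I w)
    {B k : ℝ} (h : ∀ t ∈ I, (t ^ 2 + B) * w 2 t + 3 * t * w 1 t = k) : InFamily (w 0) I := by
  by_cases hB : B = 0
  swap
  · exact inFamily_of_irrational hI hc hw hB h
  subst hB
  have p := hasDerivAt_pow (𝕜 := ℝ)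
  obtain ⟨m, hm⟩ := exists_const_of_hasDerivAt_zero hI hc
    (f := fun t => t ^ 3 * w 1 t - k / 2 * t ^ 2)
    (fun t ht => ((p 3 t).mul (hw 1 t ht)).sub ((p 2 t).const_mul (k / 2)))
    (fun t ht => by linear_combination t * h t ht)
  by_cases h0 : (0 : ℝ) ∈ I
  · have hk : k = 0 := by rw [← h 0 h0]; ring
    have hm0 : m = 0 := by rw [← hm 0 h0]; ring
    have h1 : ∀ t ∈ I, w 1 t = 0 := eq_zero_of_punctured hI
      (fun t ht => (hw 1 t ht).continuousAt) fun t ht ht0 => by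
        have := hm t ht
        rw [hk, hm0] at this
        have h3 : t ^ 3 ≠ 0 := pow_ne_zero 3 ht0
        apply mul_left_cancel₀ h3
        linear_combination this
    obtain ⟨c, hcc⟩ := exists_const_of_hasDerivAt_zero hI hc (hw 0) h1
    exact inFamily_of_exists_laurent ⟨c, 0, 0, fun t ht _ => by simp [hcc t ht]⟩
  · have hne : ∀ t ∈ I, t ≠ 0 := fun t ht h => h0 (h ▸ ht)
    obtain ⟨v, hv, hv0, hv1⟩ := exists_isJet_log h0
    obtain ⟨u, hu, hu0⟩ := exists_isJet_inv_sq h0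
    obtain ⟨c, hcc⟩ := exists_const_of_hasDerivAt_zero hI hc
      (f := fun t => w 0 t - k / 2 * v 0 t + m / 2 * u 0 t)
      (fun t ht => ((hw 0 t ht).sub ((hv 0 t ht).const_mul (k / 2))).add
        ((hu 0 t ht).const_mul (m / 2)))
      (fun t ht => by
        have := hne t ht
        rw [(hv1 t ht).1, (hu0 t ht).2.1]
        field_simp
        linear_combination 2 * hm t ht)
    refine (inFamily_const_mul_log hc h0 (k / 2)).add_laurent (.C c) (by simp) (-m / 2) 0 0
      fun t ht _ => ?_
    have := hcc t ht
    simp only [hv0, (hu0 t ht).1] at this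
    rw [Polynomial.eval_C]
    linear_combination this

/-- Solutions of `(t² + B) y''' + 5 t y'' + 3 y' = 0`. -/
lemma inFamily_of_quadratic_third_order (hI : IsOpen I) (hc : IsPreconnected I) (hw : IsJet I w)
    {B : ℝ} (h : ∀ t ∈ I, (t ^ 2 + B) * w 3 t + 5 * t * w 2 t + 3 * w 1 t = 0) :
    InFamily (w 0) I := by
  have p := hasDerivAt_pow (𝕜 := ℝ)
  obtain ⟨k, hk⟩ := exists_const_of_hasDerivAt_zero hI hc
    (f := fun t => (t ^ 2 + B) * w 2 t + 3 * (t ^ 1 * w 1 t))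
    (fun t ht => (((p 2 t).add_const B).mul (hw 2 t ht)).add
      (((p 1 t).mul (hw 1 t ht)).const_mul 3))
    (fun t ht => by linear_combination h t ht)
  exact inFamily_of_quadratic_second_order hI hc hw (B := B) (k := k) fun t ht => by
    linear_combination hk t ht

/-- Solutions of `t (t² + B) y''' + (9 t² + 4 B) y'' + 15 t y' = c`. -/
lemma inFamily_of_cubic_third_order (hI : IsOpen I) (hc : IsPreconnected I) (hw : IsJet I w)
    {B c : ℝ} (h : ∀ t ∈ I,
      t * (t ^ 2 + B) * w 3 t + (9 * t ^ 2 + 4 * B) * w 2 t + 15 * t * w 1 t = c) :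
    InFamily (w 0) I := by
  have p := hasDerivAt_pow (𝕜 := ℝ)
  by_cases hB : B = 0
  · subst hB
    by_cases h0 : (0 : ℝ) ∈ I
    · have hc0 : c = 0 := by rw [← h 0 h0]; ring
      apply inFamily_of_exists_laurent
      apply exists_of_euler_zero_two_four hI hc hw
      refine eq_zero_of_punctured hI (fun t ht => ?_) fun t ht ht0 => ?_
      · have := fun k => (hw k t ht).continuousAt
        have h1 := this 1
        have h2 := this 2
        have h3 := this 3
        fun_prop
      · apply mul_left_cancel₀ ht0
        linear_combination h t ht + hc0
    · have hne : ∀ t ∈ I, t ≠ 0 := fun t ht h => h0 (h ▸ ht)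
      obtain ⟨v, hv, hv0, hv1⟩ := exists_isJet_log h0
      -- The left hand side of the equation takes the value 8 on `log t` when `B = 0`, so `(c / 8)
      -- log t` is a particular solution.
      obtain ⟨a, b, d, hl⟩ := exists_of_euler_zero_two_four hI hc (hw.sub (hv.const_mul (c / 8)))
        fun t ht => by
          obtain ⟨e1, e2, e3⟩ := hv1 t ht
          have ht0 := hne t ht
          simp only [e1, e2, e3]
          field_simp
          linear_combination 8 * h t ht
      refine (inFamily_const_mul_log hc h0 (c / 8)).add_laurent (.C a) (by simp) b d 0
        fun t ht ht0 => ?_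
      have := hl t ht ht0
      simp only [hv0] at this
      rw [Polynomial.eval_C]
      linear_combination this
  -- With `G = (t² + B) y'' + 3 t y' - c / 4` the equation reads `t G' + 4 G = 0`, so `t⁴ G` is
  -- constant.
  obtain ⟨κ, hκ⟩ := exists_const_of_hasDerivAt_zero hI hc
    (f := fun t => t ^ 4 * ((t ^ 2 + B) * w 2 t + 3 * (t ^ 1 * w 1 t) - c / 4))
    (fun t ht => (p 4 t).mul (((((p 2 t).add_const B).mul (hw 2 t ht)).add
      (((p 1 t).mul (hw 1 t ht)).const_mul 3)).sub_const (c / 4)))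
    (fun t ht => by
      simp only [Pi.add_apply, Pi.mul_apply]
      linear_combination t ^ 3 * h t ht)
  by_cases h0 : (0 : ℝ) ∈ I
  · have hκ0 : κ = 0 := by rw [← hκ 0 h0]; ring
    have := eq_zero_of_punctured hI
      (f := fun t => (t ^ 2 + B) * w 2 t + 3 * (t ^ 1 * w 1 t) - c / 4) (fun t ht => by
        have := fun k => (hw k t ht).continuousAt
        have h1 := this 1
        have h2 := this 2
        fun_prop) fun t ht ht0 => by
        apply mul_left_cancel₀ (pow_ne_zero 4 ht0)
        linear_combination hκ t ht + hκ0
    exact inFamily_of_quadratic_second_order hI hc hw (B := B) (k := c / 4) fun t ht => by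
      linear_combination this t ht
  · obtain ⟨u, hu, hu0⟩ := exists_isJet_inv_sq h0
    -- `(t² + B) y'' + 3 t y'` sends `t⁻²` to `6 B t⁻⁴`; subtracting `κ / (6 B)` times `t⁻²` removes
    -- the term `κ t⁻⁴`.
    refine (inFamily_of_quadratic_second_order hI hc (hw.sub (hu.const_mul (κ / (6 * B))))
      (B := B) (k := c / 4) fun t ht => ?_).add_laurent 0 (by simp) (κ / (6 * B)) 0 0
      fun t ht ht0 => ?_
    · obtain ⟨e0, e1, e2⟩ := hu0 t ht
      have ht0 : t ≠ 0 := fun h => h0 (h ▸ ht)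
      simp only [e1, e2]
      field_simp
      linear_combination 24 * B * hκ t ht
    · simp only [(hu0 t ht).1, Polynomial.eval_zero]
      field_simp
      ring

end Solve
end Parabolic
end

/-! ### Polynomial right hand sides. -/

noncomputable section
namespace Parabolic

open Polynomial in
/-- The differential operator `P₁ y' + P₂ y'' + P₃ y''' + P₀ y` on polynomials. -/
def polyOp (P₀ P₁ P₂ P₃ : ℝ[X]) : ℝ[X] →ₗ[ℝ] ℝ[X] where
  toFun q := P₀ * q + P₁ * derivative q + P₂ * derivative (derivative q)
    + P₃ * derivative (derivative (derivative q))
  map_add' p q := by simp only [derivative_add]; ring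
  map_smul' c q := by
    simp only [derivative_smul, RingHom.id_apply, mul_smul_comm, smul_add]

open Polynomial

variable {P₀ P₁ P₂ P₃ : ℝ[X]}

lemma polyOp_X_pow (P₀ P₁ P₂ P₃ : ℝ[X]) (n : ℕ) : polyOp P₀ P₁ P₂ P₃ (X ^ (n + 3)) =
    P₀ * X ^ (n + 3) + C ((n : ℝ) + 3) * P₁ * X ^ (n + 2)
      + C (((n : ℝ) + 3) * (n + 2)) * P₂ * X ^ (n + 1)
      + C (((n : ℝ) + 3) * (n + 2) * (n + 1)) * P₃ * X ^ n := by
  simp only [polyOp, LinearMap.coe_mk, AddHom.coe_mk, derivative_X_pow, derivative_mul, derivative_C, zero_mul, zero_add,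
    Nat.add_sub_cancel]
  simp only [C_mul, C_add, Nat.cast_add, Nat.cast_ofNat, show n + 3 - 1 = n + 2 from rfl,
    show n + 2 - 1 = n + 1 from rfl, show n + 1 - 1 = n from rfl, Nat.cast_one]
  ring

lemma polyOp_X_sq (P₀ P₁ P₂ P₃ : ℝ[X]) :
    polyOp P₀ P₁ P₂ P₃ (X ^ 2) = P₀ * X ^ 2 + 2 * P₁ * X + 2 * P₂ := by
  simp [polyOp, derivative_X_pow]
  ring

lemma polyOp_X (P₀ P₁ P₂ P₃ : ℝ[X]) : polyOp P₀ P₁ P₂ P₃ X = P₀ * X + P₁ := by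
  simp [polyOp]

lemma polyOp_one (P₀ P₁ P₂ P₃ : ℝ[X]) : polyOp P₀ P₁ P₂ P₃ 1 = P₀ := by
  simp [polyOp]

/-- Particular solutions for monomials give particular solutions for polynomials. -/
lemma exists_particular_of_monomial {L : ℝ[X] →ₗ[ℝ] ℝ[X]} {S : Submodule ℝ ℝ[X]}
    (h : ∀ m ≤ 13, ∃ q, q.natDegree ≤ 16 ∧ X ^ m - L q ∈ S) (p : ℝ[X])
    (hp : p.natDegree ≤ 13) : ∃ q, q.natDegree ≤ 16 ∧ p - L q ∈ S := by
  choose! q hq hL using h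
  refine ⟨∑ m ∈ Finset.range 14, p.coeff m • q m, ?_, ?_⟩
  · refine natDegree_sum_le_of_forall_le _ _ fun m hm => ?_
    exact (natDegree_smul_le _ _).trans (hq m (by simp at hm; omega))
  · have e : p - L (∑ m ∈ Finset.range 14, p.coeff m • q m)
        = ∑ m ∈ Finset.range 14, p.coeff m • (X ^ m - L (q m)) := by
      simp only [map_sum, map_smul, smul_sub, Finset.sum_sub_distrib]
      simp only [smul_eq_C_mul]
      rw [← p.as_sum_range_C_mul_X_pow' (n := 14) (by omega)]
    rw [e]
    exact S.sum_mem fun m hm => S.smul_mem _ (hL m (by simp at hm; omega))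

section Solve

variable {I : Set ℝ} {w : ℕ → ℝ → ℝ}

/-- Reduction of an equation with polynomial right hand side. -/
lemma inFamily_of_particular {c : ℝ} (hw : IsJet I w) {p : ℝ[X]}
    (hp : ∃ q, q.natDegree ≤ 16 ∧ p - polyOp P₀ P₁ P₂ P₃ q = C c)
    (H : ∀ y : ℕ → ℝ → ℝ, IsJet I y → (∀ t ∈ I, P₀.eval t * y 0 t + P₁.eval t * y 1 t
      + P₂.eval t * y 2 t + P₃.eval t * y 3 t = c) → InFamily (y 0) I)
    (h : ∀ t ∈ I, P₀.eval t * w 0 t + P₁.eval t * w 1 t + P₂.eval t * w 2 t + P₃.eval t * w 3 t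
      = p.eval t) : InFamily (w 0) I := by
  obtain ⟨q, hq, hL⟩ := hp
  refine (H _ (hw.sub (isJet_polynomial q)) fun t ht => ?_).add_polynomial q hq fun t ht => ?_
  · have e := congrArg (eval t) hL
    simp only [polyOp, LinearMap.coe_mk, AddHom.coe_mk, eval_sub, eval_add, eval_mul, eval_C] at e
    simp only [Function.iterate_succ_apply, Function.iterate_zero, id]
    linear_combination h t ht + e
  · simp

lemma mem_bot_iff_C_zero {p q : ℝ[X]} : p - q ∈ (⊥ : Submodule ℝ ℝ[X]) ↔ p - q = C 0 := by simp

lemma inFamily_of_particular_monomial (hw : IsJet I w) {p : ℝ[X]} (hp : p.natDegree ≤ 13)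
    (hm : ∀ m ≤ 13, ∃ q, q.natDegree ≤ 16 ∧ polyOp P₀ P₁ P₂ P₃ q = X ^ m)
    (H : ∀ y : ℕ → ℝ → ℝ, IsJet I y → (∀ t ∈ I, P₀.eval t * y 0 t + P₁.eval t * y 1 t
      + P₂.eval t * y 2 t + P₃.eval t * y 3 t = 0) → InFamily (y 0) I)
    (h : ∀ t ∈ I, P₀.eval t * w 0 t + P₁.eval t * w 1 t + P₂.eval t * w 2 t + P₃.eval t * w 3 t
      = p.eval t) : InFamily (w 0) I := by
  obtain ⟨q, hq, hL⟩ := exists_particular_of_monomial (S := ⊥) (L := polyOp P₀ P₁ P₂ P₃)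
    (fun m hm' => by
      obtain ⟨q, hq, e⟩ := hm m hm'
      exact ⟨q, hq, by simp [e]⟩) p hp
  exact inFamily_of_particular hw ⟨q, hq, mem_bot_iff_C_zero.1 hL⟩ H h

lemma exists_preimage_of_smul {L : ℝ[X] →ₗ[ℝ] ℝ[X]} {q r : ℝ[X]} {a : ℝ} {n : ℕ} (ha : a ≠ 0)
    (hq : q.natDegree ≤ n) (h : L q = C a * r) : ∃ q, q.natDegree ≤ n ∧ L q = r :=
  ⟨a⁻¹ • q, (natDegree_smul_le _ _).trans hq, by
    rw [map_smul, h, ← smul_eq_C_mul, smul_smul, inv_mul_cancel₀ ha, one_smul]⟩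

/-- `y''' = p`. -/
lemma inFamily_third_deriv (hI : IsOpen I) (hc : IsPreconnected I) (hw : IsJet I w) {p : ℝ[X]}
    (hp : p.natDegree ≤ 13) (h : ∀ t ∈ I, w 3 t = p.eval t) : InFamily (w 0) I := by
  refine inFamily_of_particular_monomial (P₀ := 0) (P₁ := 0) (P₂ := 0) (P₃ := 1) hw hp
    (fun m hm => ?_) (fun y hy e => inFamily_of_third_deriv_zero hI hc hy (by simpa using e))
    (by simpa using h)
  -- Three integrations raise the degree from 13 to 16, which accounts for the top power in the
  -- family.
  refine exists_preimage_of_smul (a := ((m : ℝ) + 3) * (m + 2) * (m + 1)) (by positivity)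
    ((natDegree_X_pow_le (m + 3)).trans (by omega)) ?_
  rw [polyOp_X_pow]
  ring

/-- `t y''' + 4 y'' = p`. -/
lemma inFamily_euler_neg_one_zero_two (hI : IsOpen I) (hc : IsPreconnected I) (hw : IsJet I w)
    {p : ℝ[X]} (hp : p.natDegree ≤ 13) (h : ∀ t ∈ I, t * w 3 t + 4 * w 2 t = p.eval t) :
    InFamily (w 0) I := by
  refine inFamily_of_particular_monomial (P₀ := 0) (P₁ := 0) (P₂ := 4) (P₃ := X) hw hp
    (fun m hm => ?_) (fun y hy e => inFamily_of_euler_neg_one_zero_two hI hc hy fun t ht => ?_)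
    (fun t ht => by simp only [eval_zero, eval_ofNat, eval_X]; linear_combination h t ht)
  · rcases m with _ | m
    · refine exists_preimage_of_smul (a := 8) (by norm_num)
        ((natDegree_X_pow_le 2).trans (by omega)) ?_
      rw [polyOp_X_sq, map_ofNat]
      ring
    refine exists_preimage_of_smul (a := ((m : ℝ) + 3) * (m + 2) * (m + 5)) (by positivity)
      ((natDegree_X_pow_le (m + 3)).trans (by omega)) ?_
    rw [polyOp_X_pow]
    simp only [C_mul, C_add, map_ofNat, map_one]
    ring
  · have := e t ht
    simp only [eval_zero, eval_ofNat, eval_X] at this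
    linear_combination this

/-- `t² y''' + 9 t y'' + 15 y' = p`. -/
lemma inFamily_euler_zero_two_four (hI : IsOpen I) (hc : IsPreconnected I) (hw : IsJet I w)
    {p : ℝ[X]} (hp : p.natDegree ≤ 13)
    (h : ∀ t ∈ I, t ^ 2 * w 3 t + 9 * t * w 2 t + 15 * w 1 t = p.eval t) :
    InFamily (w 0) I := by
  refine inFamily_of_particular_monomial (P₀ := 0) (P₁ := 15) (P₂ := 9 * X) (P₃ := X ^ 2) hw hp
    (fun m hm => ?_) (fun y hy e => inFamily_of_exists_laurent
      (exists_of_euler_zero_two_four hI hc hy fun t ht => ?_))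
    (fun t ht => by
      simp only [eval_zero, eval_ofNat, eval_X, eval_mul, eval_pow]; linear_combination h t ht)
  · rcases m with _ | _ | m
    · refine exists_preimage_of_smul (a := 15) (by norm_num)
        (natDegree_X_le.trans (by omega)) ?_
      rw [polyOp_X, map_ofNat]
      ring
    · refine exists_preimage_of_smul (a := 48) (by norm_num)
        ((natDegree_X_pow_le 2).trans (by omega)) ?_
      rw [polyOp_X_sq, map_ofNat]
      ring
    refine exists_preimage_of_smul (a := ((m : ℝ) + 3) * (m + 5) * (m + 7)) (by positivity)
      ((natDegree_X_pow_le (m + 3)).trans (by omega)) ?_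
    rw [polyOp_X_pow]
    simp only [C_mul, C_add, map_ofNat, map_one]
    ring
  · have := e t ht
    simp only [eval_zero, eval_ofNat, eval_X, eval_mul, eval_pow] at this
    linear_combination this

/-- `t³ y''' + 15 t² y'' + 57 t y' + 48 y = p`. -/
lemma inFamily_euler_two_four_six (hI : IsOpen I) (hc : IsPreconnected I) (hw : IsJet I w)
    {p : ℝ[X]} (hp : p.natDegree ≤ 13)
    (h : ∀ t ∈ I, t ^ 3 * w 3 t + 15 * t ^ 2 * w 2 t + 57 * t * w 1 t + 48 * w 0 t = p.eval t) :
    InFamily (w 0) I := by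
  refine inFamily_of_particular_monomial (P₀ := 48) (P₁ := 57 * X) (P₂ := 15 * X ^ 2)
    (P₃ := X ^ 3) hw hp
    (fun m hm => ?_) (fun y hy e => inFamily_of_euler_two_four_six hI hc hy fun t ht => ?_)
    (fun t ht => by
      simp only [eval_ofNat, eval_X, eval_mul, eval_pow]; linear_combination h t ht)
  · rcases m with _ | _ | _ | m
    · refine exists_preimage_of_smul (a := 48) (by norm_num)
        (natDegree_one.le.trans (by omega)) ?_
      rw [polyOp_one, map_ofNat]
      ring
    · refine exists_preimage_of_smul (a := 105) (by norm_num)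
        (natDegree_X_le.trans (by omega)) ?_
      rw [polyOp_X, map_ofNat]
      ring
    · refine exists_preimage_of_smul (a := 192) (by norm_num)
        ((natDegree_X_pow_le 2).trans (by omega)) ?_
      rw [polyOp_X_sq, map_ofNat]
      ring
    refine exists_preimage_of_smul (a := ((m : ℝ) + 5) * (m + 7) * (m + 9)) (by positivity)
      ((natDegree_X_pow_le (m + 3)).trans (by omega)) ?_
    rw [polyOp_X_pow]
    simp only [C_mul, C_add, map_ofNat, map_one]
    ring
  · have := e t ht
    simp only [eval_ofNat, eval_X, eval_mul, eval_pow] at this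
    linear_combination this

/-- The operator maps `X^(m+3)` to a nonzero multiple of `X^(m+2)` plus a multiple of `X^m`; the
latter is removed by the preimage of `X^m`, whence the induction in steps of two. -/
lemma exists_polyOp_quadratic_eq_X_pow (B : ℝ) (m : ℕ) :
    ∃ q, q.natDegree ≤ m + 1 ∧ polyOp 0 3 (5 * X) (X ^ 2 + C B) q = X ^ m := by
  induction m using Nat.twoStepInduction with
  | zero =>
    refine exists_preimage_of_smul (a := 3) (by norm_num) natDegree_X_le ?_
    rw [polyOp_X, map_ofNat]
    ring
  | one =>
    refine exists_preimage_of_smul (a := 16) (by norm_num) (natDegree_X_pow_le 2) ?_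
    rw [polyOp_X_sq, map_ofNat]
    ring
  | more m ih _ =>
    obtain ⟨q, hq, e⟩ := ih
    refine exists_preimage_of_smul (a := ((m : ℝ) + 3) * (m + 3) * (m + 5)) (by positivity)
      (q := X ^ (m + 3) - (B * ((m : ℝ) + 3) * (m + 2) * (m + 1)) • q)
      ((natDegree_sub_le _ _).trans (max_le (natDegree_X_pow_le _)
        ((natDegree_smul_le _ _).trans (hq.trans (by omega))))) ?_
    rw [map_sub, map_smul, e, polyOp_X_pow, smul_eq_C_mul]
    simp only [C_mul, C_add, map_ofNat, map_one]
    ring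

/-- `(t² + B) y''' + 5 t y'' + 3 y' = p`. -/
lemma inFamily_quadratic_third_order (hI : IsOpen I) (hc : IsPreconnected I) (hw : IsJet I w)
    {B : ℝ} {p : ℝ[X]} (hp : p.natDegree ≤ 13)
    (h : ∀ t ∈ I, (t ^ 2 + B) * w 3 t + 5 * t * w 2 t + 3 * w 1 t = p.eval t) :
    InFamily (w 0) I := by
  refine inFamily_of_particular_monomial (P₀ := 0) (P₁ := 3) (P₂ := 5 * X) (P₃ := X ^ 2 + C B)
    hw hp (fun m hm => ?_)
    (fun y hy e => inFamily_of_quadratic_third_order (B := B) hI hc hy fun t ht => ?_)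
    (fun t ht => by
      simp only [eval_zero, eval_ofNat, eval_X, eval_mul, eval_pow, eval_add, eval_C]
      linear_combination h t ht)
  · obtain ⟨q, hq, e⟩ := exists_polyOp_quadratic_eq_X_pow B m
    exact ⟨q, hq.trans (by omega), e⟩
  · have := e t ht
    simp only [eval_zero, eval_ofNat, eval_X, eval_mul, eval_pow, eval_add, eval_C] at this
    linear_combination this

/-- The same recursion in steps of two, with leading term of unchanged degree. The factor of `X^0`
there would be zero, so monomials are reached only modulo constants, and a constant stays on the
right hand side. -/
lemma exists_polyOp_cubic_eq_X_pow_sub (B : ℝ) (m : ℕ) : ∃ q, q.natDegree ≤ m ∧ ∃ c : ℝ,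
    polyOp 0 (15 * X) (9 * X ^ 2 + 4 * C B) (X * (X ^ 2 + C B)) q = X ^ m - C c := by
  suffices h : ∀ m : ℕ, (∃ q, q.natDegree ≤ m + 1 ∧ ∃ c : ℝ,
      polyOp 0 (15 * X) (9 * X ^ 2 + 4 * C B) (X * (X ^ 2 + C B)) q = X ^ (m + 1) - C c) by
    rcases m with _ | m
    · exact ⟨0, by simp, 1, by simp⟩
    · exact h m
  intro m
  suffices h : ∃ c : ℝ, ∃ q, q.natDegree ≤ m + 1 ∧
      polyOp 0 (15 * X) (9 * X ^ 2 + 4 * C B) (X * (X ^ 2 + C B)) q = X ^ (m + 1) - C c by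
    obtain ⟨c, q, hq, e⟩ := h
    exact ⟨q, hq, c, e⟩
  induction m using Nat.twoStepInduction with
  | zero =>
    refine ⟨0, exists_preimage_of_smul (a := 15) (by norm_num) natDegree_X_le ?_⟩
    rw [polyOp_X, map_ofNat, C_0]
    ring
  | one =>
    refine ⟨-B / 6, exists_preimage_of_smul (a := 48) (by norm_num) (natDegree_X_pow_le 2) ?_⟩
    have : C B = 6 * C (B / 6) := by
      rw [← map_ofNat C, ← C_mul]; congr 1; ring
    rw [polyOp_X_sq, map_ofNat, neg_div, C_neg, this]
    ring
  | more m ih _ =>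
    obtain ⟨c, q, hq, e⟩ := ih
    have ha : ((m : ℝ) + 3) * (m + 5) * (m + 7) ≠ 0 := by positivity
    refine ⟨-(c * B * ((m : ℝ) + 3) * (m + 2) * (m + 5)) / (((m : ℝ) + 3) * (m + 5) * (m + 7)),
      exists_preimage_of_smul ha
      (q := X ^ (m + 3) - (B * ((m : ℝ) + 3) * (m + 2) * (m + 5)) • q)
      ((natDegree_sub_le _ _).trans (max_le (natDegree_X_pow_le _)
        ((natDegree_smul_le _ _).trans (hq.trans (by omega))))) ?_⟩
    rw [map_sub, map_smul, e, polyOp_X_pow, smul_eq_C_mul, mul_sub, mul_sub, ← C_mul,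
      ← C_mul (a := ((m : ℝ) + 3) * (m + 5) * (m + 7)), mul_div_cancel₀ _ ha]
    simp only [C_mul, C_add, C_neg, map_ofNat, map_one]
    ring

/-- `t (t² + B) y''' + (9 t² + 4 B) y'' + 15 t y' = p`. -/
lemma inFamily_cubic_third_order (hI : IsOpen I) (hc : IsPreconnected I) (hw : IsJet I w)
    {B : ℝ} {p : ℝ[X]} (hp : p.natDegree ≤ 13) (h : ∀ t ∈ I,
      t * (t ^ 2 + B) * w 3 t + (9 * t ^ 2 + 4 * B) * w 2 t + 15 * t * w 1 t = p.eval t) :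
    InFamily (w 0) I := by
  -- The submodule of constants absorbs what the operator does not reach.
  obtain ⟨q, hq, hL⟩ := exists_particular_of_monomial (S := LinearMap.range (monomial (R := ℝ) 0))
    (L := polyOp 0 (15 * X) (9 * X ^ 2 + 4 * C B) (X * (X ^ 2 + C B)))
    (fun m hm' => by
      obtain ⟨q, hq, c, e⟩ := exists_polyOp_cubic_eq_X_pow_sub B m
      exact ⟨q, hq.trans (by omega), c, by rw [e, monomial_zero_left]; ring⟩) p hp
  obtain ⟨c, hc'⟩ := hL
  rw [monomial_zero_left] at hc'
  refine inFamily_of_particular hw ⟨q, hq, hc'.symm⟩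
    (fun y hy e => inFamily_of_cubic_third_order (B := B) (c := c) hI hc hy fun t ht => ?_)
    (fun t ht => by
      simp only [eval_zero, eval_ofNat, eval_X, eval_mul, eval_pow, eval_add, eval_C]
      linear_combination h t ht)
  have := e t ht
  simp only [eval_zero, eval_ofNat, eval_X, eval_mul, eval_pow, eval_add, eval_C] at this
  linear_combination this

end Solve
end Parabolic
end

/-! ### Coefficients in the second variable. -/

noncomputable section
namespace Parabolic

open Polynomial

lemma natDegree_compatTerm300 (x : ℝ) (w : ℕ → ℝ) :
    (compatTerm300 (C x) X fun k => C (w k)).natDegree ≤ 13 := by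
  unfold compatTerm300
  compute_degree

lemma coeff_compatTerm300 (x : ℝ) (w : ℕ → ℝ) :
    (compatTerm300 (C x) X fun k => C (w k)).coeff 13 =
      -45 * w 1 - 27 * x * w 2 - 3 * x ^ 2 * w 3 := by
  unfold compatTerm300
  compute_degree
  all_goals first | ring1 | simp

lemma natDegree_compatTerm210 (x : ℝ) (w : ℕ → ℝ) :
    (compatTerm210 (C x) X fun k => C (w k)).natDegree ≤ 12 := by
  unfold compatTerm210
  compute_degree

lemma coeff_compatTerm210 (x : ℝ) (w : ℕ → ℝ) :
    (compatTerm210 (C x) X fun k => C (w k)).coeff 12 =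
      16 * w 2 + 4 * x * w 3 := by
  unfold compatTerm210
  compute_degree
  all_goals first | ring1 | simp

lemma natDegree_compatTerm201 (x : ℝ) (w : ℕ → ℝ) :
    (compatTerm201 (C x) X fun k => C (w k)).natDegree ≤ 11 := by
  unfold compatTerm201
  compute_degree

lemma coeff_compatTerm201 (x : ℝ) (w : ℕ → ℝ) :
    (compatTerm201 (C x) X fun k => C (w k)).coeff 11 =
      -6 * w 1 - 10 * x * w 2 - 2 * x ^ 2 * w 3 := by
  unfold compatTerm201
  compute_degree
  all_goals first | ring1 | simp

lemma natDegree_compatTerm120 (x : ℝ) (w : ℕ → ℝ) :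
    (compatTerm120 (C x) X fun k => C (w k)).natDegree ≤ 11 := by
  unfold compatTerm120
  compute_degree

lemma coeff_compatTerm120 (x : ℝ) (w : ℕ → ℝ) :
    (compatTerm120 (C x) X fun k => C (w k)).coeff 11 =
      -4 * w 3 := by
  unfold compatTerm120
  compute_degree
  all_goals first | ring1 | simp

lemma natDegree_compatTerm111 (x : ℝ) (w : ℕ → ℝ) :
    (compatTerm111 (C x) X fun k => C (w k)).natDegree ≤ 8 := by
  unfold compatTerm111
  compute_degree

lemma coeff_compatTerm111 (x : ℝ) (w : ℕ → ℝ) :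
    (compatTerm111 (C x) X fun k => C (w k)).coeff 8 =
      60 * x * w 1 + 36 * x ^ 2 * w 2 + 4 * x ^ 3 * w 3 := by
  unfold compatTerm111
  compute_degree
  all_goals first | ring1 | simp

lemma natDegree_compatTerm102 (x : ℝ) (w : ℕ → ℝ) :
    (compatTerm102 (C x) X fun k => C (w k)).natDegree ≤ 9 := by
  unfold compatTerm102
  compute_degree

lemma coeff_compatTerm102 (x : ℝ) (w : ℕ → ℝ) :
    (compatTerm102 (C x) X fun k => C (w k)).coeff 9 =
      12 * w 1 + 20 * x * w 2 + 4 * x ^ 2 * w 3 := by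
  unfold compatTerm102
  compute_degree
  all_goals first | ring1 | simp

lemma natDegree_compatTerm030 (x : ℝ) (w : ℕ → ℝ) :
    (compatTerm030 (C x) X fun k => C (w k)).natDegree ≤ 8 := by
  unfold compatTerm030
  compute_degree

lemma coeff_compatTerm030 (x : ℝ) (w : ℕ → ℝ) :
    (compatTerm030 (C x) X fun k => C (w k)).coeff 8 =
      96 * w 2 + 24 * x * w 3 := by
  unfold compatTerm030
  compute_degree
  all_goals first | ring1 | simp

lemma natDegree_compatTerm021 (x : ℝ) (w : ℕ → ℝ) :
    (compatTerm021 (C x) X fun k => C (w k)).natDegree ≤ 9 := by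
  unfold compatTerm021
  compute_degree

lemma coeff_compatTerm021 (x : ℝ) (w : ℕ → ℝ) :
    (compatTerm021 (C x) X fun k => C (w k)).coeff 9 =
      8 * w 3 := by
  unfold compatTerm021
  compute_degree
  all_goals first | ring1 | simp

lemma natDegree_compatTerm012 (x : ℝ) (w : ℕ → ℝ) :
    (compatTerm012 (C x) X fun k => C (w k)).natDegree ≤ 8 := by
  unfold compatTerm012
  compute_degree

lemma coeff_compatTerm012 (x : ℝ) (w : ℕ → ℝ) :
    (compatTerm012 (C x) X fun k => C (w k)).coeff 8 =
      -64 * w 2 - 16 * x * w 3 := by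
  unfold compatTerm012
  compute_degree
  all_goals first | ring1 | simp

lemma natDegree_compatTerm003 (x : ℝ) (w : ℕ → ℝ) :
    (compatTerm003 (C x) X fun k => C (w k)).natDegree ≤ 7 := by
  unfold compatTerm003
  compute_degree

lemma coeff_compatTerm003 (x : ℝ) (w : ℕ → ℝ) :
    (compatTerm003 (C x) X fun k => C (w k)).coeff 7 =
      360 * w 1 + 216 * x * w 2 + 24 * x ^ 2 * w 3 := by
  unfold compatTerm003
  compute_degree
  all_goals first | ring1 | simp

/-- The combination of `compatTerm012` and `compatTerm030` in which the top degrees cancel. -/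
def compatTermMixed {R : Type*} [CommRing R] (x y : R) (w : ℕ → R) : R :=
  ((-1152 * x ^ 6 + 10368 * x ^ 4 * y ^ 2 - 10368 * x ^ 2 * y ^ 4 + 1152 * y ^ 6) * w 0
    + (792 * x ^ 7 - 2808 * x ^ 5 * y ^ 2 - 2232 * x ^ 3 * y ^ 4 + 1368 * x * y ^ 6) * w 1
    + (-216 * x ^ 8 - 72 * x ^ 6 * y ^ 2 + 504 * x ^ 4 * y ^ 4 + 360 * x ^ 2 * y ^ 6) * w 2
    + (24 * x ^ 9 + 72 * x ^ 7 * y ^ 2 + 72 * x ^ 5 * y ^ 4 + 24 * x ^ 3 * y ^ 6) * w 3)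

lemma compatTermMixed_eq {R : Type*} [CommRing R] (x y : R) (w : ℕ → R) :
    compatTermMixed x y w = 3 * compatTerm012 x y w + 2 * compatTerm030 x y w := by
  unfold compatTermMixed compatTerm012 compatTerm030
  ring

lemma natDegree_compatTermMixed (x : ℝ) (w : ℕ → ℝ) :
    (compatTermMixed (C x) X fun k => C (w k)).natDegree ≤ 6 := by
  unfold compatTermMixed
  compute_degree

/-- When `A 0 1 2 = 3 / 2 * A 0 3 0`, the two contributions lose their degrees seven and eight; this
coefficient then carries the Euler operator with exponents -2, -4, -6. -/
lemma coeff_compatTermMixed (x : ℝ) (w : ℕ → ℝ) :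
    (compatTermMixed (C x) X fun k => C (w k)).coeff 6 =
      24 * (x ^ 3 * w 3 + 15 * x ^ 2 * w 2 + 57 * x * w 1 + 48 * w 0) := by
  unfold compatTermMixed
  compute_degree
  all_goals first | ring1 | simp

/-- `compatPoly` as a polynomial in its second variable. -/
def compatPolynomial (A : ℕ → ℕ → ℕ → ℝ) (x : ℝ) (w : ℕ → ℝ) : ℝ[X] :=
  compatPoly (fun j k l => C (A j k l)) (C x) X fun k => C (w k)

lemma map_compatPoly {R S : Type*} [CommRing R] [CommRing S] (φ : R →+* S) (A : ℕ → ℕ → ℕ → R)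
    (x y : R) (w : ℕ → R) : φ (compatPoly A x y w) =
      compatPoly (fun j k l => φ (A j k l)) (φ x) (φ y) fun k => φ (w k) := by
  simp only [compatPoly, compatTerm300, compatTerm210, compatTerm201, compatTerm120,
    compatTerm111, compatTerm102, compatTerm030, compatTerm021, compatTerm012, compatTerm003,
    map_add, map_sub, map_mul, map_pow, map_neg, map_ofNat]

lemma eval_compatPolynomial (A : ℕ → ℕ → ℕ → ℝ) (x y : ℝ) (w : ℕ → ℝ) :
    (compatPolynomial A x w).eval y = compatPoly A x y w := by
  have := map_compatPoly (evalRingHom y) (fun j k l => C (A j k l)) (C x) X fun k => C (w k)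
  simpa [compatPolynomial] using this

lemma natDegree_C_mul_le_of_le {p : ℝ[X]} {m n : ℕ} (c : ℝ) (hp : p.natDegree ≤ m) (h : m ≤ n) :
    (C c * p).natDegree ≤ n :=
  (natDegree_C_mul_le _ _).trans (hp.trans h)

lemma natDegree_compatPolynomial (A : ℕ → ℕ → ℕ → ℝ) (x : ℝ) (w : ℕ → ℝ) :
    (compatPolynomial A x w).natDegree ≤ 13 := by
  unfold compatPolynomial compatPoly
  refine natDegree_add_le_of_degree_le (natDegree_add_le_of_degree_le
    (natDegree_add_le_of_degree_le (natDegree_add_le_of_degree_le (natDegree_add_le_of_degree_le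
    (natDegree_add_le_of_degree_le (natDegree_add_le_of_degree_le (natDegree_add_le_of_degree_le
    (natDegree_add_le_of_degree_le ?_ ?_) ?_) ?_) ?_) ?_) ?_) ?_) ?_) ?_
  · exact natDegree_C_mul_le_of_le _ (natDegree_compatTerm300 x w) (by norm_num)
  · exact natDegree_C_mul_le_of_le _ (natDegree_compatTerm210 x w) (by norm_num)
  · exact natDegree_C_mul_le_of_le _ (natDegree_compatTerm201 x w) (by norm_num)
  · exact natDegree_C_mul_le_of_le _ (natDegree_compatTerm120 x w) (by norm_num)
  · exact natDegree_C_mul_le_of_le _ (natDegree_compatTerm111 x w) (by norm_num)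
  · exact natDegree_C_mul_le_of_le _ (natDegree_compatTerm102 x w) (by norm_num)
  · exact natDegree_C_mul_le_of_le _ (natDegree_compatTerm030 x w) (by norm_num)
  · exact natDegree_C_mul_le_of_le _ (natDegree_compatTerm021 x w) (by norm_num)
  · exact natDegree_C_mul_le_of_le _ (natDegree_compatTerm012 x w) (by norm_num)
  · exact natDegree_C_mul_le_of_le _ (natDegree_compatTerm003 x w) (by norm_num)

/-- The coefficients of a polynomial are fixed linear combinations of sufficiently many values. -/
lemma coeff_eq_sum_eval (s : Finset ℝ) {p : ℝ[X]} (hp : p.natDegree < s.card) (m : ℕ) :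
    p.coeff m = ∑ y ∈ s, p.eval y * (Lagrange.basis s id y).coeff m := by
  have hd : p.degree < s.card := lt_of_le_of_lt degree_le_natDegree (by exact_mod_cast hp)
  conv_lhs => rw [Lagrange.eq_interpolate (s := s) (v := id) Function.injective_id.injOn hd,
    Lagrange.interpolate_apply, finsetSum_coeff]
  simp [coeff_C_mul]

lemma eq_of_eventually_eval_eq {p q : ℝ[X]} {t : ℝ}
    (h : ∀ᶠ x in nhds t, p.eval x = q.eval x) : p = q :=
  eq_of_infinite_eval_eq p q (infinite_of_mem_nhds t h)

/-- A function on a connected set that is locally polynomial is polynomial. -/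
lemma exists_polynomial_of_locally {I : Set ℝ} (hc : IsPreconnected I) {g : ℝ → ℝ} {n : ℕ}
    (h : ∀ t ∈ I, ∃ p : ℝ[X], p.natDegree ≤ n ∧ ∀ᶠ x in nhds t, g x = p.eval x) :
    ∃ p : ℝ[X], p.natDegree ≤ n ∧ ∀ t ∈ I, g t = p.eval t := by
  rcases I.eq_empty_or_nonempty with rfl | ⟨a, ha⟩
  · exact ⟨0, by simp, fun t ht => ht.elim⟩
  obtain ⟨p, hp, hpa⟩ := h a ha
  refine ⟨p, hp, fun t ht => ?_⟩
  -- The set where `g` coincides locally with `p` is open. It is also relatively closed, because two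
  -- polynomials that agree on a nonempty open set are equal.
  have hsub : I ⊆ {t | ∀ᶠ x in nhds t, g x = p.eval x} := by
    refine hc.subset_of_closure_inter_subset isOpen_setOfPred_eventually_nhds ⟨a, ha, hpa⟩ ?_
    rintro t ⟨htc, ht⟩
    obtain ⟨q, _, hq⟩ := h t ht
    obtain ⟨x, hx, hxp⟩ := mem_closure_iff_nhds.1 htc _ (eventually_eventually_nhds.2 hq)
    have : p = q := eq_of_eventually_eval_eq (t := x) (by
      filter_upwards [hx, hxp] with y h1 h2 using h2.symm.trans h1)
    rw [this]
    exact hq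
  exact (hsub ht).self_of_nhds

/-- At a fixed second coordinate `z` the condition equates the value of `compatPolynomial A t` at
`z` with minus a polynomial in `t` of degree at most 13. Every coefficient is a fixed linear
combination of 14 such values, hence itself polynomial in `t`. Since `Ω` need not be a product, this
is done in a small rectangle and then globalized. -/
lemma exists_coeff_compatPolynomial {Ω : Set (ℝ × ℝ)} (hΩ : IsOpen Ω) (hc : IsPreconnected Ω)
    {A A' : ℕ → ℕ → ℕ → ℝ} {w v : ℕ → ℝ → ℝ}
    (h : ∀ q ∈ Ω, compatPoly A q.1 q.2 (fun k => w k q.1)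
      + compatPoly A' q.2 q.1 (fun k => v k q.2) = 0) (m : ℕ) :
    ∃ p : ℝ[X], p.natDegree ≤ 13 ∧ ∀ t ∈ Prod.fst '' Ω,
      (compatPolynomial A t fun k => w k t).coeff m = p.eval t := by
  refine exists_polynomial_of_locally
    (g := fun t => (compatPolynomial A t fun k => w k t).coeff m)
    (hc.image _ continuous_fst.continuousOn) ?_
  rintro _ ⟨⟨t, y⟩, hq, rfl⟩
  obtain ⟨U, V, hU, hV, htU, hyV, hUV⟩ := isOpen_prod_iff.1 hΩ t y hq
  -- Fourteen nodes, one more than the degree bound 13.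
  obtain ⟨s, hsV, hs⟩ := (infinite_of_mem_nhds y (hV.mem_nhds hyV)).exists_subset_card_eq 14
  refine ⟨∑ z ∈ s, (-(Lagrange.basis s id z).coeff m) • compatPolynomial A' z (fun k => v k z),
    natDegree_sum_le_of_forall_le _ _ fun z _ =>
      (natDegree_smul_le _ _).trans (natDegree_compatPolynomial _ _ _), ?_⟩
  filter_upwards [hU.mem_nhds htU] with x hx
  rw [coeff_eq_sum_eval s (by rw [hs]; exact Nat.lt_succ_of_le (natDegree_compatPolynomial _ _ _)),
    eval_finsetSum]
  refine Finset.sum_congr rfl fun z hz => ?_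
  rw [eval_smul, eval_compatPolynomial, eval_compatPolynomial, smul_eq_mul]
  have := h (x, z) (hUV ⟨hx, hsV hz⟩)
  linear_combination (Lagrange.basis s id z).coeff m * this

lemma coeff_compatPolynomial (A : ℕ → ℕ → ℕ → ℝ) (x : ℝ) (w : ℕ → ℝ) (m : ℕ) :
    (compatPolynomial A x w).coeff m =
      A 3 0 0 * (compatTerm300 (C x) X fun k => C (w k)).coeff m
      + A 2 1 0 * (compatTerm210 (C x) X fun k => C (w k)).coeff m
      + A 2 0 1 * (compatTerm201 (C x) X fun k => C (w k)).coeff m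
      + A 1 2 0 * (compatTerm120 (C x) X fun k => C (w k)).coeff m
      + A 1 1 1 * (compatTerm111 (C x) X fun k => C (w k)).coeff m
      + A 1 0 2 * (compatTerm102 (C x) X fun k => C (w k)).coeff m
      + A 0 3 0 * (compatTerm030 (C x) X fun k => C (w k)).coeff m
      + A 0 2 1 * (compatTerm021 (C x) X fun k => C (w k)).coeff m
      + A 0 1 2 * (compatTerm012 (C x) X fun k => C (w k)).coeff m
      + A 0 0 3 * (compatTerm003 (C x) X fun k => C (w k)).coeff m := by
  simp only [compatPolynomial, compatPoly, coeff_add, coeff_C_mul]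

end Parabolic
end

/-! ### The case distinction on the leading constants. -/

noncomputable section
namespace Parabolic

open Polynomial

/-- The compatibility condition determines the form of the first of the two functions. -/
lemma inFamily_of_compatPoly {Ω : Set (ℝ × ℝ)} (hΩ : IsOpen Ω) (hconn : IsPreconnected Ω)
    {A A' : ℕ → ℕ → ℕ → ℝ} (hA : ∃ j k l, j + k + l = 3 ∧ A j k l ≠ 0) {w v : ℕ → ℝ → ℝ}
    (hw : IsJet (Prod.fst '' Ω) w)
    (h : ∀ q ∈ Ω, compatPoly A q.1 q.2 (fun k => w k q.1)
      + compatPoly A' q.2 q.1 (fun k => v k q.2) = 0) : InFamily (w 0) (Prod.fst '' Ω) := by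
  have hI : IsOpen (Prod.fst '' Ω) := isOpenMap_fst _ hΩ
  have hc : IsPreconnected (Prod.fst '' Ω) := hconn.image _ continuous_fst.continuousOn
  have key := exists_coeff_compatPolynomial hΩ hconn h
  simp only [coeff_compatPolynomial] at key
  have hdeg {p : ℝ[X]} {c : ℝ} (hp : p.natDegree ≤ 13) : (C c * p).natDegree ≤ 13 :=
    natDegree_C_mul_le_of_le c hp le_rfl
  have z {p : ℝ[X]} {m n : ℕ} (hp : p.natDegree ≤ m) (hm : m < n) : p.coeff n = 0 :=
    coeff_eq_zero_of_natDegree_lt (hp.trans_lt hm)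
  have z210 x w n := z (n := n) (natDegree_compatTerm210 x w)
  have z201 x w n := z (n := n) (natDegree_compatTerm201 x w)
  have z120 x w n := z (n := n) (natDegree_compatTerm120 x w)
  have z111 x w n := z (n := n) (natDegree_compatTerm111 x w)
  have z102 x w n := z (n := n) (natDegree_compatTerm102 x w)
  have z030 x w n := z (n := n) (natDegree_compatTerm030 x w)
  have z021 x w n := z (n := n) (natDegree_compatTerm021 x w)
  have z012 x w n := z (n := n) (natDegree_compatTerm012 x w)
  have z003 x w n := z (n := n) (natDegree_compatTerm003 x w)
  -- The cases go down the powers 13, 12, 11, 9, 8, 7, 6 of the second variable. In each, the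
  -- constants of higher cases are zero and those of lower degree do not contribute, so the
  -- coefficient is a single operator applied to `w 0`.
  by_cases h300 : A 3 0 0 = 0
  swap
  · obtain ⟨p, hp, e⟩ := key 13
    refine inFamily_euler_zero_two_four hI hc hw (hdeg (c := -1 / (3 * A 3 0 0)) hp)
      fun t ht => ?_
    have := e t ht
    rw [coeff_compatTerm300, z210, z201, z120, z111, z102, z030, z021, z012, z003] at this
    · rw [eval_mul, eval_C, ← this]
      field_simp
      ring
    all_goals norm_num
  by_cases h210 : A 2 1 0 = 0
  swap
  · obtain ⟨p, hp, e⟩ := key 12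
    refine inFamily_euler_neg_one_zero_two hI hc hw (hdeg (c := 1 / (4 * A 2 1 0)) hp)
      fun t ht => ?_
    have := e t ht
    rw [h300, coeff_compatTerm210, z201, z120, z111, z102, z030, z021, z012, z003] at this
    · rw [eval_mul, eval_C, ← this]
      field_simp
      ring
    all_goals norm_num
  by_cases h201 : A 2 0 1 = 0
  swap
  · obtain ⟨p, hp, e⟩ := key 11
    -- In degree 11 the constant `A 1 2 0` adds a multiple of `y'''`, which shifts `t²` to `t² + B`.
    -- In degree 9 `A 0 2 1` does the same.
    refine inFamily_quadratic_third_order hI hc hw (B := 2 * A 1 2 0 / A 2 0 1)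
      (hdeg (c := -1 / (2 * A 2 0 1)) hp) fun t ht => ?_
    have := e t ht
    rw [h300, h210, coeff_compatTerm201, coeff_compatTerm120, z111, z102, z030, z021, z012, z003]
      at this
    · rw [eval_mul, eval_C, ← this]
      field_simp
      ring
    all_goals norm_num
  by_cases h120 : A 1 2 0 = 0
  swap
  · obtain ⟨p, hp, e⟩ := key 11
    refine inFamily_third_deriv hI hc hw (hdeg (c := -1 / (4 * A 1 2 0)) hp) fun t ht => ?_
    have := e t ht
    rw [h300, h210, h201, coeff_compatTerm120, z111, z102, z030, z021, z012, z003] at this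
    · rw [eval_mul, eval_C, ← this]
      field_simp
      ring
    all_goals norm_num
  by_cases h102 : A 1 0 2 = 0
  swap
  · obtain ⟨p, hp, e⟩ := key 9
    refine inFamily_quadratic_third_order hI hc hw (B := 2 * A 0 2 1 / A 1 0 2)
      (hdeg (c := 1 / (4 * A 1 0 2)) hp) fun t ht => ?_
    have := e t ht
    rw [h300, h210, h201, h120, coeff_compatTerm102, coeff_compatTerm021, z111, z030, z012, z003]
      at this
    · rw [eval_mul, eval_C, ← this]
      field_simp
      ring
    all_goals norm_num
  by_cases h021 : A 0 2 1 = 0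
  swap
  · obtain ⟨p, hp, e⟩ := key 9
    refine inFamily_third_deriv hI hc hw (hdeg (c := 1 / (8 * A 0 2 1)) hp) fun t ht => ?_
    have := e t ht
    rw [h300, h210, h201, h120, h102, coeff_compatTerm021, z111, z030, z012, z003] at this
    · rw [eval_mul, eval_C, ← this]
      field_simp
      ring
    all_goals norm_num
  by_cases h111 : A 1 1 1 = 0
  swap
  · obtain ⟨p, hp, e⟩ := key 8
    -- `A 0 3 0` and `A 0 1 2` both add multiples of `t y''' + 4 y''`, and only the combination `3 A
    -- 0 3 0 - 2 A 0 1 2` enters `B`.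
    refine inFamily_cubic_third_order hI hc hw
      (B := 2 * (3 * A 0 3 0 - 2 * A 0 1 2) / A 1 1 1)
      (hdeg (c := 1 / (4 * A 1 1 1)) hp) fun t ht => ?_
    have := e t ht
    rw [h300, h210, h201, h120, h102, h021, coeff_compatTerm111, coeff_compatTerm030,
      coeff_compatTerm012, z003] at this
    · rw [eval_mul, eval_C, ← this]
      field_simp
      ring
    all_goals norm_num
  by_cases hmix : 3 * A 0 3 0 - 2 * A 0 1 2 = 0
  swap
  · obtain ⟨p, hp, e⟩ := key 8
    refine inFamily_euler_neg_one_zero_two hI hc hw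
      (hdeg (c := 1 / (8 * (3 * A 0 3 0 - 2 * A 0 1 2))) hp) fun t ht => ?_
    have := e t ht
    rw [h300, h210, h201, h120, h102, h021, h111, coeff_compatTerm030,
      coeff_compatTerm012, z003] at this
    · rw [eval_mul, eval_C, ← this]
      field_simp
      ring
    all_goals norm_num
  -- The combination in degree eight now vanishes, so these two constants act together through
  -- `compatTermMixed`, of degree at most six, and degree seven is left to `A 0 0 3`.
  have mixed (t : ℝ) (m : ℕ) : A 0 3 0 * (compatTerm030 (C t) X fun k => C (w k t)).coeff m
      + A 0 1 2 * (compatTerm012 (C t) X fun k => C (w k t)).coeff m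
      = A 0 3 0 / 2 * (compatTermMixed (C t) X fun k => C (w k t)).coeff m := by
    have e : A 0 1 2 = 3 / 2 * A 0 3 0 := by linear_combination -hmix / 2
    rw [compatTermMixed_eq, e, coeff_add, ← map_ofNat (C (R := ℝ)) 3, ← map_ofNat (C (R := ℝ)) 2,
      coeff_C_mul, coeff_C_mul]
    ring
  by_cases h003 : A 0 0 3 = 0
  swap
  · obtain ⟨p, hp, e⟩ := key 7
    refine inFamily_euler_zero_two_four hI hc hw (hdeg (c := 1 / (24 * A 0 0 3)) hp)
      fun t ht => ?_
    have := e t ht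
    have m7 := mixed t 7
    rw [z (natDegree_compatTermMixed t fun k => w k t) (by norm_num)] at m7
    rw [h300, h210, h201, h120, h102, h021, h111, coeff_compatTerm003] at this
    rw [eval_mul, eval_C, ← this]
    field_simp
    linear_combination -m7
  -- At this point all ten constants vanish, contrary to hypothesis.
  by_cases h030 : A 0 3 0 = 0
  · exfalso
    have h012 : A 0 1 2 = 0 := by linear_combination 3 / 2 * h030 - hmix / 2
    obtain ⟨j, k, l, hs, hne⟩ := hA
    have hj : j ≤ 3 := by omega
    have hk : k ≤ 3 := by omega
    obtain rfl : l = 3 - j - k := by omega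
    interval_cases j <;> interval_cases k <;> first | omega | simp_all
  · obtain ⟨p, hp, e⟩ := key 6
    refine inFamily_euler_two_four_six hI hc hw (hdeg (c := 1 / (12 * A 0 3 0)) hp)
      fun t ht => ?_
    have := e t ht
    have m6 := mixed t 6
    rw [coeff_compatTermMixed] at m6
    rw [h300, h210, h201, h120, h102, h021, h111, h003] at this
    rw [eval_mul, eval_C, ← this]
    field_simp
    linear_combination -m6

end Parabolic
end

/-! ### The theorem. -/

theorem theorem1 (Ω : Set (ℝ × ℝ)) (hopen : IsOpen Ω) (hconn : IsConnected Ω)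
    (h0 : (0, 0) ∉ Ω) (W₁ W₂ : ℝ → ℝ)
    (hW₁ : ContDiffOn ℝ ∞ W₁ (Prod.fst '' Ω)) (hW₂ : ContDiffOn ℝ ∞ W₂ (Prod.snd '' Ω))
    (hX : (∃ ħ : ℝ, 0 < ħ ∧ Parabolic.HasQuantumIntegral ħ Ω (Parabolic.potential W₁ W₂)) ∨
      Parabolic.HasClassicalIntegral Ω (Parabolic.potential W₁ W₂) ∨
      Parabolic.SolvesCompatibility Ω (Parabolic.potential W₁ W₂)) :
    Parabolic.InFamily W₁ (Prod.fst '' Ω) ∧ Parabolic.InFamily W₂ (Prod.snd '' Ω) := by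
  let O : TopologicalSpace.Opens (ℝ × ℝ) := ⟨Ω, hopen⟩
  have hO : (0, 0) ∉ O := h0
  have hV : ContDiffOn ℝ ∞ (Parabolic.potential W₁ W₂) O :=
    Parabolic.contDiffOn_potential hO hW₁ hW₂
  have hS : Parabolic.SolvesCompatibility O (Parabolic.potential W₁ W₂) := by
    rcases hX with ⟨ħ, hħ, h⟩ | h | h
    · exact Parabolic.HasQuantumIntegral.solvesCompatibility hO hconn.isPreconnected hħ hV h
    · exact Parabolic.HasClassicalIntegral.solvesCompatibility hO hconn.isPreconnected hV h
    · exact h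
  obtain ⟨A, hA, h⟩ := Parabolic.SolvesCompatibility.compatPoly hO hW₁ hW₂ hS
  have hswap : Prod.fst '' (Prod.swap ⁻¹' Ω) = Prod.snd '' Ω := by
    ext t
    constructor
    · rintro ⟨q, hq, rfl⟩
      exact ⟨q.swap, hq, rfl⟩
    · rintro ⟨q, hq, rfl⟩
      exact ⟨q.swap, by simpa using hq, rfl⟩
  have hpre : IsPreconnected (Prod.swap ⁻¹' Ω) := by
    rw [← Set.image_swap_eq_preimage_swap]
    exact hconn.isPreconnected.image _ continuous_swap.continuousOn
  refine ⟨?_, ?_⟩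
  · exact Parabolic.inFamily_of_compatPoly hopen hconn.isPreconnected hA
      (Parabolic.isJet_iterate_deriv (isOpenMap_fst _ hopen) hW₁) h
  · have hA' : ∃ j k l, j + k + l = 3 ∧ Parabolic.reflectCoeff A j k l ≠ 0 := by
      obtain ⟨j, k, l, hs, hne⟩ := hA
      exact ⟨j, k, l, hs, mul_ne_zero (pow_ne_zero _ (by norm_num)) hne⟩
    -- The condition is symmetric under exchange of the coordinates with `A` and its reflection
    -- interchanged; reflection changes only signs, so the reflected constants are still not all
    -- zero.
    have := Parabolic.inFamily_of_compatPoly (hopen.preimage continuous_swap) hpre hA'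
      (w := fun k => deriv^[k] W₂) (v := fun k => deriv^[k] W₁) (A' := A)
      (by rw [hswap]; exact Parabolic.isJet_iterate_deriv (isOpenMap_snd _ hopen) hW₂)
      (fun q hq => by rw [add_comm]; exact h q.swap hq)
    rwa [hswap] at this
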